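/- Let $X$ be a compact complex manifold of dimension $d\ge 1$ and $D\subset X$ a smooth hypersurface (a closed complex submanifold of codimension one, possibly disconnected). Let $\omega$ be a complex-valued differential form on $X\setminus D$ which is quasi-meromorphic with poles along $D$: $\omega$ is smooth on $X\setminus D$, and near each point of $D$, in holomorphic coordinates $z=(z_1,\dots,z_d)$ with $D=\{z_1=0\}$, the form $z_1^{a}\bar z_1^{b}\omega$ extends smoothly across $D$ for some integers $a,b\ge 0$. Let $\kappa_x(\omega)=1$ if $x\in D$ and both entries of the minimal such pair $(a,b)$ at $x$ are nonzero (i.e. $\omega$ has both a holomorphic and an antiholomorphic pole at $x$), and $\kappa_x(\omega)=0$ otherwise; put $\kappa(\omega)=\max_{x}\kappa_x(\omega)$, and assume $\kappa(\omega)>0$. Let $s$ be a holomorphic section of a holomorphic line bundle $L\to X$ with $\{s=0\}=D$, and let $|\cdot|$ be a smooth hermitian metric on $L$. Assume that $s$ vanishes to the same order along $D$ at all points $x$ with $\kappa_x(\omega)=1$, and let $o_\omega(s)$ be this order (so $o_\omega(s)=1$ if $s$ is a defining section of the reduced divisor $D$). For a smooth test form $\xi$ on $X$ of complementary degree put $$F_\xi(\lambda)=o_\omega(s)\int_X|s|^{2\lambda}\,\omega\wedge\xi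 ,$$ and define the canonical current of $\omega$ by $\langle\{\omega\},\xi\rangle=\lambda^{\kappa(\omega)}F_\xi(\lambda)\big|_{\lambda=0}$. For a $(d,d)$-form $\eta$ which is quasi-meromorphic with poles along $D$, choose a finite smooth partition of unity $(\rho_j)$ subordinate to a cover of $X$ by holomorphic charts with coordinates $z=z_j=(z_{j,1},\dots,z_{j,d})$ in which $D=\{z_{j,1}=0\}$ and $$\eta=\frac{dz_{j,1}\wedge d\bar z_{j,1}}{z_{j,1}^{m_j}\,\bar z_{j,1}^{n_j}}\wedge\widetilde\eta_j,\qquad m_j,n_j\ge 1,$$ with $\widetilde\eta_j$ smooth and containing neither $dz_{j,1}$ nor $d\bar z_{j,1}$. The Aeppli residue $\mathrm{Res}_A(\eta)\in H_A^{d-1,d-1}(D)=\ker(\partial\bar\partial)/(\mathrm{im}\,\partial+\mathrm{im}\,\bar\partial)$ is the class of the smooth form $$\mathrm{Res}_{\rho,z}(\eta)=\sum_j\frac{1}{(m_j-1)!\,(n_j-1)!}\,\frac{\partial^{m_j+n_j-2}(\rho_j\widetilde\eta_j)}{\partial z_{j,1}^{m_j-1}\,\partial\bar z_{j,1}^{n_j-1}}\bigg|_D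 .$$ Then, for every such test form $\xi$: the integral defining $F_\xi(\lambda)$ converges absolutely for $\mathrm{Re}\,\lambda$ large; $F_\xi$ extends meromorphically to $\mathbb C$; the value of $\lambda^{\kappa(\omega)}F_\xi(\lambda)$ at $\lambda=0$ exists; choices as above exist for $\eta=\omega\wedge\xi$; and for every such choice, with $\mathrm{Res}_A(\omega\wedge\xi)$ the class of the resulting form, all smooth representatives of this class have the same integral over $D$ and $$\big\langle\{\omega\},\xi\big\rangle=-2\pi i\int_D\mathrm{Res}_A(\omega\wedge\xi).$$ -/

import Mathlib

open Set Filter Topology MeasureTheory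
open scoped Manifold ContDiff

noncomputable section

namespace CxForm

/-- Coordinate space of complex dimension `d`. -/
abbrev Cn (d : ℕ) : Type := Fin d → ℂ

/-- Complex valued real-alternating `k`-forms on `ℂ^d`. -/
abbrev Alt (d k : ℕ) : Type := Cn d [⋀^Fin k]→ₗ[ℝ] ℂ

/-! ### Multilinear algebra -/

/-- The wedge product of alternating forms, as a signed sum over shuffles. -/
def wedge {d k l m : ℕ} (h : k + l = m) (a : Alt d k) (b : Alt d l) : Alt d m :=
  ((LinearMap.mul' ℝ ℂ).compAlternatingMap (a.domCoprod b)).domDomCongr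
    (finSumFinEquiv.trans (finCongr h))

/-- The real-linear map `v ↦ (dz₁(v), dz̄₁(v), dz₂(v), dz̄₂(v), …)`. -/
def zzbar (d : ℕ) : Cn d →ₗ[ℝ] (Fin (2 * d) → ℂ) where
  toFun v i := if i.val % 2 = 0 then v ⟨i.val / 2, by omega⟩
    else (starRingEnd ℂ) (v ⟨i.val / 2, by omega⟩)
  map_add' u v := by ext i; dsimp only [Pi.add_apply]; split_ifs <;> simp
  map_smul' c v := by ext i; dsimp only [Pi.smul_apply]; split_ifs <;> simp

/-- The top form `dz₁ ∧ dz̄₁ ∧ dz₂ ∧ dz̄₂ ∧ ⋯ ∧ dz_d ∧ dz̄_d`. -/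
def stdTop (d : ℕ) : Alt d (2 * d) :=
  AlternatingMap.compLinearMap
    { (Matrix.detRowAlternating (n := Fin (2 * d)) (R := ℂ)).toMultilinearMap.restrictScalars ℝ with
      map_eq_zero_of_eq' := fun v _ _ h hij =>
        (Matrix.detRowAlternating (n := Fin (2 * d)) (R := ℂ)).map_eq_zero_of_eq v h hij }
    (zzbar d)

/-- The positively oriented real frame `(e₁, i e₁, e₂, i e₂, …)` of `ℂ^d`; the value of a top form
on it is the coefficient with respect to `dx₁ ∧ dy₁ ∧ ⋯ ∧ dx_d ∧ dy_d`. -/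
def frame (d : ℕ) (j : Fin (2 * d)) : Cn d :=
  Pi.single ⟨j.val / 2, by omega⟩ (if j.val % 2 = 0 then 1 else Complex.I)

/-- `a` is of bidegree `(p, q)`. -/
def IsBidegree {d k : ℕ} (p q : ℕ) (a : Alt d k) : Prop :=
  ∀ (c : ℂ) (v : Fin k → Cn d),
    a (fun i => c • v i) = c ^ p * (starRingEnd ℂ c) ^ q * a v

/-! ### Derivatives in `ℂ^d` -/

/-- The complex linear part of the real derivative of `f` at `z`, applied to `u`; this is
`∑ⱼ (∂f/∂zⱼ)(z) uⱼ`. -/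
def del {d : ℕ} (f : Cn d → ℂ) (z u : Cn d) : ℂ :=
  (fderiv ℝ f z u - Complex.I * fderiv ℝ f z (Complex.I • u)) / 2

/-- The complex antilinear part of the real derivative: `∑ⱼ (∂f/∂z̄ⱼ)(z) ūⱼ`. -/
def delbar {d : ℕ} (f : Cn d → ℂ) (z u : Cn d) : ℂ :=
  (fderiv ℝ f z u + Complex.I * fderiv ℝ f z (Complex.I • u)) / 2

/-- `∂f/∂z₁` (the first coordinate has index `0`). -/
def dz₁ {n : ℕ} (f : Cn (n + 1) → ℂ) (z : Cn (n + 1)) : ℂ := del f z (Pi.single 0 1)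

/-- `∂f/∂z̄₁`. -/
def dzbar₁ {n : ℕ} (f : Cn (n + 1) → ℂ) (z : Cn (n + 1)) : ℂ := delbar f z (Pi.single 0 1)

/-- Smoothness on `U` of a form on `ℂ^d`: its coefficients are smooth. -/
def SmoothOn {d k : ℕ} (a : Cn d → Alt d k) (U : Set (Cn d)) : Prop :=
  ∀ v : Fin k → Cn d, ContDiffOn ℝ ∞ (fun z => a z v) U

/-! ### Forms on complex manifolds -/

section Manifold

variable {d : ℕ} {M : Type*} [TopologicalSpace M] [ChartedSpace (Cn d) M]

variable (d M) in
/-- The holomorphic coordinate charts of `M`. -/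
abbrev holAtlas : Set (OpenPartialHomeomorph M (Cn d)) :=
  IsManifold.maximalAtlas 𝓘(ℂ, Cn d) ω M

variable (d M) in
/-- Complex valued `k`-forms (without any regularity). As everywhere in Mathlib, the tangent space
at `x` is identified with the model space by means of the preferred chart `chartAt _ x`. -/
abbrev Form (k : ℕ) : Type _ := M → Alt d k

/-- The expression of a form in the coordinates given by the chart `e`, i.e. its pullback under
`e.symm`. -/
def rep {k : ℕ} (a : Form d M k) (e : OpenPartialHomeomorph M (Cn d)) (z : Cn d) : Alt d k :=
  (a (e.symm z)).compLinearMap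
    (fderiv ℝ (fun y => chartAt (Cn d) (e.symm z) (e.symm y)) z : Cn d →ₗ[ℝ] Cn d)

variable (d M) in
/-- The space of smooth complex valued `k`-forms on `M`. -/
def smoothForm (k : ℕ) : Submodule ℂ (Form d M k) where
  carrier := {a | ∀ e ∈ holAtlas d M, SmoothOn (rep a e) e.target}
  add_mem' {_ _} ha hb e he v := (ha e he v).add (hb e he v)
  zero_mem' _ _ _ := contDiffOn_const
  smul_mem' _ _ ha e he v := contDiffOn_const.smul (ha e he v)

/-- Wedge product of forms on a manifold. -/
def wedgeForm {k l m : ℕ} (h : k + l = m) (a : Form d M k) (b : Form d M l) : Form d M m :=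
  fun x => wedge h (a x) (b x)

/-- `t = ∂a`. In coordinates, `∂a = ∑ⱼ dzⱼ ∧ ∂a/∂zⱼ`. -/
def IsDel {k m : ℕ} (h : k + 1 = m) (a : Form d M k) (t : Form d M m) : Prop :=
  ∀ e ∈ holAtlas d M, ∀ z ∈ e.target, ∀ v : Fin m → Cn d,
    rep t e z v = ∑ i : Fin (k + 1), (-1 : ℂ) ^ (i : ℕ) *
      del (fun y => rep a e y (fun j => v (Fin.cast h (i.succAbove j)))) z (v (Fin.cast h i))

/-- `t = ∂̄a`. In coordinates, `∂̄a = ∑ⱼ dz̄ⱼ ∧ ∂a/∂z̄ⱼ`. -/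
def IsDelbar {k m : ℕ} (h : k + 1 = m) (a : Form d M k) (t : Form d M m) : Prop :=
  ∀ e ∈ holAtlas d M, ∀ z ∈ e.target, ∀ v : Fin m → Cn d,
    rep t e z v = ∑ i : Fin (k + 1), (-1 : ℂ) ^ (i : ℕ) *
      delbar (fun y => rep a e y (fun j => v (Fin.cast h (i.succAbove j)))) z (v (Fin.cast h i))

variable (d M) in
/-- The image of `∂` in the `(d, d)`-forms. -/
def imDel : Submodule ℂ (smoothForm d M (2 * d)) :=
  Submodule.span ℂ {t | ∃ (k : ℕ) (h : k + 1 = 2 * d) (a : smoothForm d M k),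
    (∀ x, ∃ p, p + 1 = d ∧ IsBidegree p d (a.1 x)) ∧ IsDel h a.1 t.1}

variable (d M) in
/-- The image of `∂̄` in the `(d, d)`-forms. -/
def imDelbar : Submodule ℂ (smoothForm d M (2 * d)) :=
  Submodule.span ℂ {t | ∃ (k : ℕ) (h : k + 1 = 2 * d) (a : smoothForm d M k),
    (∀ x, ∃ q, q + 1 = d ∧ IsBidegree d q (a.1 x)) ∧ IsDelbar h a.1 t.1}

variable (d M) in
/-- The Aeppli cohomology group `ker ∂∂̄ / (im ∂ + im ∂̄)` in the top bidegree `(d, d)`, where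
`d = dim M`. In this bidegree every form is `∂∂̄`-closed, and the `(d, d)`-forms are all the
`2d`-forms. -/
abbrev AeppliTop : Type _ := smoothForm d M (2 * d) ⧸ (imDel d M ⊔ imDelbar d M)

/-- The Aeppli class of a smooth top form. -/
def aeppliClass (t : smoothForm d M (2 * d)) : AeppliTop d M :=
  (imDel d M ⊔ imDelbar d M).mkQ t

/-! ### Integration of top forms -/

variable (d M) in
/-- A finite smooth partition of unity on `M` together with holomorphic charts to whose domains it
is subordinate. -/
structure ChartPartition where
  /-- number of charts -/
  N : ℕ
  /-- the charts -/
  chart : Fin N → OpenPartialHomeomorph M (Cn d)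
  chart_mem : ∀ j, chart j ∈ holAtlas d M
  /-- the partition of unity -/
  ρ : Fin N → M → ℝ
  smooth : ∀ j, ContMDiff 𝓘(ℝ, Cn d) 𝓘(ℝ, ℝ) ∞ (ρ j)
  nonneg : ∀ j x, 0 ≤ ρ j x
  sum_eq_one : ∀ x, ∑ j, ρ j x = 1
  subordinate : ∀ j, tsupport (ρ j) ⊆ (chart j).source

/-- The density, with respect to Lebesgue measure in the `j`-th chart, of `ρⱼ a`. -/
def ChartPartition.density (P : ChartPartition d M) (a : Form d M (2 * d)) (j : Fin P.N)
    (z : Cn d) : ℂ :=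
  (P.ρ j ((P.chart j).symm z) : ℂ) * rep a (P.chart j) z (frame d)

/-- Absolute integrability of a top form on a compact manifold. -/
def FormIntegrable (a : Form d M (2 * d)) : Prop :=
  ∀ (P : ChartPartition d M) (j : Fin P.N),
    IntegrableOn (P.density a j) (P.chart j).target volume

open Classical in
/-- `∫_M a` for a top form `a` on a compact complex manifold with its complex orientation. The value
does not depend on the partition of unity when `a` is integrable. -/
def formIntegral (a : Form d M (2 * d)) : ℂ :=
  if h : Nonempty (ChartPartition d M) then
    ∑ j, ∫ z in (h.some.chart j).target, h.some.density a j z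
  else 0

/-- `I` is the integral over `M` of the Aeppli class `c`: every smooth form representing `c` has
integral `I`. -/
def IsClassIntegral (c : AeppliTop d M) (I : ℂ) : Prop :=
  ∀ t : smoothForm d M (2 * d), aeppliClass t = c → formIntegral t.1 = I

end Manifold

/-! ### Smooth hypersurfaces and forms with poles along them -/

section Hypersurface

variable {n : ℕ} {X : Type*} [TopologicalSpace X] [ChartedSpace (Cn (n + 1)) X]
  {D : Type*} [TopologicalSpace D] [ChartedSpace (Cn n) D]

/-- `e` is a holomorphic chart of `X` in which the image of `ι` is given by `z₁ = 0`. -/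
def IsSlice (ι : D → X) (e : OpenPartialHomeomorph X (Cn (n + 1))) : Prop :=
  e ∈ holAtlas (n + 1) X ∧ ∀ x ∈ e.source, x ∈ range ι ↔ e x 0 = 0

variable (n) in
/-- The complex manifold `D` is, by means of `ι`, a smooth hypersurface of `X`, i.e. a closed complex
submanifold of codimension one: around every point of `D` there are coordinates `(z₁, z')` on `X`
such that `D = {z₁ = 0}` and `z'` restricts to coordinates on `D`. -/
def IsSmoothHypersurface (ι : D → X) : Prop :=
  IsClosedEmbedding ι ∧
  ∀ p : D, ∃ e : OpenPartialHomeomorph X (Cn (n + 1)), IsSlice ι e ∧ ι p ∈ e.source ∧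
    ∃ e' ∈ holAtlas n D, p ∈ e'.source ∧
      ∀ q ∈ e'.source, ι q ∈ e.source ∧ e (ι q) = Fin.cons 0 (e' q)

/-- `z₁^a z̄₁^b w` extends to a smooth form near `x`, where `z₁` is the first coordinate of the slice
chart `e`. The values of `w` on the hypersurface `z₁ = 0` play no role. -/
def PoleAtMost {k : ℕ} (w : Form (n + 1) X k) (e : OpenPartialHomeomorph X (Cn (n + 1))) (x : X)
    (a b : ℕ) : Prop :=
  ∃ (U : Set (Cn (n + 1))) (t : Cn (n + 1) → Alt (n + 1) k),
    IsOpen U ∧ e x ∈ U ∧ U ⊆ e.target ∧ SmoothOn t U ∧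
      ∀ z ∈ U, z 0 ≠ 0 → (z 0 ^ a * (starRingEnd ℂ (z 0)) ^ b) • rep w e z = t z

/-- `w` is a quasi-meromorphic form whose poles lie along the hypersurface `D`: it is smooth outside
of `D`, and locally `w = t / (z₁^a z̄₁^b)` with `t` smooth, where `D = {z₁ = 0}`. -/
def IsQuasiMeromorphic (ι : D → X) {k : ℕ} (w : Form (n + 1) X k) : Prop :=
  (∀ e ∈ holAtlas (n + 1) X, SmoothOn (rep w e) (e.target ∩ e.symm ⁻¹' (range ι)ᶜ)) ∧
  ∀ p : D, ∃ e : OpenPartialHomeomorph X (Cn (n + 1)), IsSlice ι e ∧ ι p ∈ e.source ∧ ∃ a b, PoleAtMost w e (ι p) a b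

/-- `w` has both a holomorphic and an antiholomorphic pole at `p`: in the minimal pair `(a, b)` such
that `z₁^a z̄₁^b w` is smooth near `p`, both numbers are nonzero. -/
def HasBothPoles (ι : D → X) {k : ℕ} (w : Form (n + 1) X k) (p : D) : Prop :=
  ∀ e : OpenPartialHomeomorph X (Cn (n + 1)), IsSlice ι e → ι p ∈ e.source →
    (¬ ∃ b, PoleAtMost w e (ι p) 0 b) ∧ (¬ ∃ a, PoleAtMost w e (ι p) a 0)

open Classical in
/-- `κ(w)`, the maximum over all points of the number of local branches of `D` along which `w` has
both holomorphic and antiholomorphic poles (as `D` is smooth, there is at most one branch). -/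
def kappa (ι : D → X) {k : ℕ} (w : Form (n + 1) X k) : ℕ :=
  ⨆ p : D, if HasBothPoles ι w p then 1 else 0

/-! ### Line bundles, metrics, and the canonical current -/

section LineBundle

variable {L : X → Type*} [TopologicalSpace (Bundle.TotalSpace ℂ L)]
  [∀ x, AddCommGroup (L x)] [∀ x, Module ℂ (L x)] [∀ x, TopologicalSpace (L x)]
  [FiberBundle ℂ L]

variable (n) in
/-- `h` is (the norm of) a smooth hermitian metric on the line bundle `L`. -/
structure IsMetric (h : ∀ x, L x → ℝ) : Prop where
  nonneg : ∀ x v, 0 ≤ h x v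
  eq_zero : ∀ x v, h x v = 0 → v = 0
  smul : ∀ x (c : ℂ) v, h x (c • v) = ‖c‖ * h x v
  smooth : ∀ (t : Bundle.Trivialization ℂ (Bundle.TotalSpace.proj : Bundle.TotalSpace ℂ L → X))
    [MemTrivializationAtlas t],
    ContMDiffOn 𝓘(ℝ, Cn (n + 1)) 𝓘(ℝ, ℝ) ∞ (fun x => h x (t.symm x 1)) t.baseSet

variable (n) in
/-- `s` is a holomorphic section of `L`. -/
def IsHolSection (s : ∀ x, L x) : Prop :=
  ContMDiff 𝓘(ℂ, Cn (n + 1)) (𝓘(ℂ, Cn (n + 1)).prod 𝓘(ℂ, ℂ)) ω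
    (fun x => (⟨x, s x⟩ : Bundle.TotalSpace ℂ L))

variable (n) in
/-- In a local frame of `L` near `ι p`, `s = z₁^r φ` with `φ` holomorphic and nonvanishing. -/
def VanishesToOrder (ι : D → X) (s : ∀ x, L x) (p : D) (r : ℕ) : Prop :=
  ∃ e : OpenPartialHomeomorph X (Cn (n + 1)), IsSlice ι e ∧ ι p ∈ e.source ∧ ∃ φ : X → ℂ,
    ContMDiffAt 𝓘(ℂ, Cn (n + 1)) 𝓘(ℂ, ℂ) ω φ (ι p) ∧ φ (ι p) ≠ 0 ∧
    ∀ᶠ y in 𝓝 (ι p), (trivializationAt ℂ L (ι p) ⟨y, s y⟩).2 = e y 0 ^ r * φ y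

variable (n) in
/-- The vanishing order along `D` of the section `s` at the point `p` (the set is a singleton). -/
def vanishingOrder (ι : D → X) (s : ∀ x, L x) (p : D) : ℕ :=
  sInf {r | VanishesToOrder n ι s p r}

open Classical in
/-- `o_w(s)`: the maximum over all points of the vanishing order of `s` along those branches of `D`
on which `w` has both kinds of poles (an empty product being `1`). -/
def oOrder (ι : D → X) {k : ℕ} (w : Form (n + 1) X k) (s : ∀ x, L x) : ℕ :=
  ⨆ p : D, if HasBothPoles ι w p then vanishingOrder n ι s p else 1

/-- The form `|s|^{2λ} a`. -/
def regularized {k : ℕ} (h : ∀ x, L x → ℝ) (s : ∀ x, L x) (lam : ℂ) (a : Form (n + 1) X k) :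
    Form (n + 1) X k :=
  fun x => ((h x (s x) : ℂ) ^ (2 * lam)) • a x

/-- The canonical current `{w}`, defined by means of the section `s` and the metric `h`, has the
value `c` on the test form `ξ`: the function `F(λ) = o_w(s) ∫_X |s|^{2λ} w ∧ ξ`, given by an
absolutely convergent integral for `Re λ` large, has a meromorphic extension to `ℂ`, and
`λ^{κ(w)} F(λ)` has the value `c` at `λ = 0`. By the identity theorem `c` is unique. -/
def CanonicalCurrentEq (ι : D → X) (h : ∀ x, L x → ℝ) (s : ∀ x, L x) {k l : ℕ}
    (hkl : k + l = 2 * (n + 1)) (w : Form (n + 1) X k) (ξ : Form (n + 1) X l) (c : ℂ) : Prop :=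
  ∃ F : ℂ → ℂ, Meromorphic F ∧
    (∃ R : ℝ, ∀ lam : ℂ, R < lam.re →
      FormIntegrable (regularized h s lam (wedgeForm hkl w ξ)) ∧
      F lam = (oOrder ι w s : ℂ) * formIntegral (regularized h s lam (wedgeForm hkl w ξ))) ∧
    Tendsto (fun lam => lam ^ kappa ι w * F lam) (𝓝[≠] 0) (𝓝 c)

end LineBundle

/-! ### The Aeppli residue -/

/-- The choices entering the definition of `Res_{ρ,z}(η)`: a partition of unity subordinate to a
cover by charts in which `D` is given by `z₁ = 0`, and in each chart an expression
`η = ψ / (z₁^{a+1} z̄₁^{b+1}) dz₁ ∧ dz̄₁ ∧ ⋯ ∧ dz_d ∧ dz̄_d` with `ψ` smooth. Thus the orders of the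
poles are `a + 1` and `b + 1`, and `η = dz₁ ∧ dz̄₁ / (z₁^{a+1} z̄₁^{b+1}) ∧ η̃` where
`η̃ = ψ dz₂ ∧ dz̄₂ ∧ ⋯ ∧ dz_d ∧ dz̄_d` contains neither `dz₁` nor `dz̄₁`. -/
structure ResidueData (ι : D → X) (η : Form (n + 1) X (2 * (n + 1))) extends
    ChartPartition (n + 1) X where
  slice : ∀ j, IsSlice ι (chart j)
  /-- holomorphic pole order minus one -/
  a : Fin N → ℕ
  /-- antiholomorphic pole order minus one -/
  b : Fin N → ℕ
  /-- coefficient -/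
  ψ : Fin N → Cn (n + 1) → ℂ
  ψ_smooth : ∀ j, ContDiffOn ℝ ∞ (ψ j) (chart j).target
  eq : ∀ j, ∀ z ∈ (chart j).target, z 0 ≠ 0 →
    rep η (chart j) z =
      (ψ j z / (z 0 ^ (a j + 1) * (starRingEnd ℂ (z 0)) ^ (b j + 1))) • stdTop (n + 1)

/-- The coefficient `1/(a! b!) ∂^{a+b}(ρⱼ ψⱼ)/∂z₁^a ∂z̄₁^b` in the `j`-th chart. -/
def ResidueData.coeff {ι : D → X} {η : Form (n + 1) X (2 * (n + 1))} (R : ResidueData ι η)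
    (j : Fin R.N) (z : Cn (n + 1)) : ℂ :=
  (1 / ((R.a j).factorial * (R.b j).factorial : ℂ)) *
    (dz₁^[R.a j] (dzbar₁^[R.b j]
      (fun y => (R.ρ j ((R.chart j).symm y) : ℂ) * R.ψ j y))) z

open Classical in
/-- The form `Res_{ρ,z}(η)` on `D`: the sum over `j` of the restrictions to `D` of
`1/(a! b!) ∂^{a+b}(ρⱼ ψⱼ)/∂z₁^a ∂z̄₁^b dz₂ ∧ dz̄₂ ∧ ⋯ ∧ dz_d ∧ dz̄_d`. -/
def ResidueData.form {ι : D → X} {η : Form (n + 1) X (2 * (n + 1))} (R : ResidueData ι η) :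
    Form n D (2 * n) :=
  fun q => ∑ j, if ι q ∈ (R.chart j).source then
    R.coeff j (R.chart j (ι q)) • (stdTop n).compLinearMap
      (fderiv ℝ (fun y => Fin.tail (R.chart j (ι ((chartAt (Cn n) q).symm y))) : Cn n → Cn n)
        (chartAt (Cn n) q q) : Cn n →ₗ[ℝ] Cn n)
    else 0

end Hypersurface

end CxForm

end

open CxForm

noncomputable section

namespace CxForm

/-- The real basis `(e₁, i e₁, e₂, i e₂, …)` of `ℂ^d`. -/
def frameBasis (d : ℕ) : Module.Basis (Fin (2 * d)) ℝ (Cn d) :=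
  (Pi.basis fun _ : Fin d => Complex.basisOneI).reindex
    ((Equiv.sigmaEquivProd _ _).trans (finProdFinEquiv.trans (finCongr (mul_comm d 2))))

theorem coe_frameBasis (d : ℕ) : ⇑(frameBasis d) = frame d := by
  funext j
  have hj : j = finCongr (mul_comm d 2) (finProdFinEquiv
      (⟨j.val / 2, by omega⟩, ⟨j.val % 2, by omega⟩)) := by
    ext; simp [finProdFinEquiv]; omega
  simp only [frameBasis, Module.Basis.reindex_apply]
  have : ((Equiv.sigmaEquivProd (Fin d) (Fin 2)).trans
      (finProdFinEquiv.trans (finCongr (mul_comm d 2)))).symm j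
      = ⟨⟨j.val / 2, by omega⟩, ⟨j.val % 2, by omega⟩⟩ := by
    rw [Equiv.symm_apply_eq]; exact hj
  rw [this, Pi.basis_apply, frame]
  congr 1
  rcases Nat.mod_two_eq_zero_or_one j.val with h | h <;> simp [h]

theorem alternating_eq_det_mul {d : ℕ} (a : Alt d (2 * d)) (v : Fin (2 * d) → Cn d) :
    a v = ((frameBasis d).det v : ℂ) * a (frame d) := by
  set b : Alt d (2 * d) :=
    ((LinearMap.mul ℝ ℂ).flip (a (frame d)) ∘ₗ Algebra.linearMap ℝ ℂ).compAlternatingMap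
      (frameBasis d).det with hb
  have : a = b := by
    refine (frameBasis d).ext_alternating fun σ hσ => ?_
    let τ : Equiv.Perm (Fin (2 * d)) := Equiv.ofBijective σ (Finite.injective_iff_bijective.1 hσ)
    have h1 := a.map_perm (frameBasis d) τ
    have h2 := b.map_perm (frameBasis d) τ
    have h3 : (fun i => frameBasis d (σ i)) = ⇑(frameBasis d) ∘ τ := rfl
    rw [h3, h1, h2]
    congr 1
    have h4 : (frameBasis d).det (frame d) = 1 := by
      rw [← coe_frameBasis]; exact (frameBasis d).det_self
    simp [hb, coe_frameBasis, h4]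
  conv_lhs => rw [this]
  simp [hb, mul_comm]

theorem alternating_comp_frame {d : ℕ} (a : Alt d (2 * d)) (A : Cn d →ₗ[ℝ] Cn d) :
    a (fun i => A (frame d i)) = ((LinearMap.det A : ℝ) : ℂ) * a (frame d) := by
  rw [alternating_eq_det_mul]
  congr 2
  have := (frameBasis d).det_comp A (frameBasis d)
  rw [(frameBasis d).det_self, mul_one, coe_frameBasis] at this
  exact this

theorem det_restrictScalars_eq {d : ℕ} (A : Cn d →ₗ[ℂ] Cn d) :
    LinearMap.det (A.restrictScalars ℝ) = Complex.normSq (LinearMap.det A) := by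
  rw [LinearMap.det_restrictScalars]
  simp [Algebra.norm_complex_eq]

theorem stdTop_frame (d : ℕ) : stdTop d (frame d) = (-2 * Complex.I) ^ d := by
  have h1 : stdTop d (frame d) = Matrix.det (Matrix.of fun j i => zzbar d (frame d j) i) := rfl
  let E : Fin 2 × Fin d ≃ Fin (2 * d) :=
    (Equiv.prodComm _ _).trans (finProdFinEquiv.trans (finCongr (mul_comm d 2)))
  rw [h1, ← Matrix.det_submatrix_equiv_self E]
  have h2 : (Matrix.of fun j i => zzbar d (frame d j) i).submatrix E E =
      Matrix.blockDiagonal (fun _ : Fin d => !![(1 : ℂ), 1; Complex.I, -Complex.I]) := by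
    ext ⟨i, j⟩ ⟨i', j'⟩
    have e1 : ∀ (i : Fin 2) (j : Fin d), (E (i, j)).val % 2 = i.val := by
      intro i j; simp [E, finProdFinEquiv]; omega
    have e2 : ∀ (i : Fin 2) (j : Fin d), (E (i, j)).val / 2 = j.val := by
      intro i j; simp [E, finProdFinEquiv]; omega
    have e3 : ∀ (i : Fin 2) (j : Fin d) (hh : (E (i, j)).val / 2 < d),
      (⟨(E (i, j)).val / 2, hh⟩ : Fin d) = j := fun i j hh => Fin.ext (e2 i j)
    simp only [Matrix.submatrix_apply, Matrix.of_apply, zzbar, frame, LinearMap.coe_mk,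
      AddHom.coe_mk, e1, e3, Matrix.blockDiagonal_apply]
    by_cases hjj : j = j'
    · subst hjj
      fin_cases i <;> fin_cases i' <;> simp
    · rw [if_neg hjj]
      simp [Ne.symm hjj]
  rw [h2, Matrix.det_blockDiagonal]
  simp [Matrix.det_fin_two]
  ring

theorem stdTop_frame_ne_zero (d : ℕ) : stdTop d (frame d) ≠ 0 := by
  rw [stdTop_frame]; simp

theorem eq_smul_stdTop {d : ℕ} (a : Alt d (2 * d)) :
    a = (a (frame d) / stdTop d (frame d)) • stdTop d := by
  ext v
  rw [AlternatingMap.smul_apply, alternating_eq_det_mul a v, alternating_eq_det_mul (stdTop d) v,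
    smul_eq_mul]
  field_simp [stdTop_frame_ne_zero d]

theorem wedge_apply {d k l m : ℕ} (h : k + l = m) (a : Alt d k) (b : Alt d l)
    (v : Fin m → Cn d) :
    wedge h a b v = ∑ σ : Equiv.Perm.ModSumCongr (Fin k) (Fin l),
      ((Equiv.Perm.sign σ.out : ℤ) : ℂ) *
        (a (fun i => v (finCongr h (finSumFinEquiv (σ.out (Sum.inl i))))) *
        b (fun i => v (finCongr h (finSumFinEquiv (σ.out (Sum.inr i)))))) := by
  simp only [wedge, AlternatingMap.domDomCongr_apply, LinearMap.compAlternatingMap_apply]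
  have h1 : a.domCoprod b (fun i => v ((finSumFinEquiv.trans (finCongr h)) i)) =
      ∑ σ : Equiv.Perm.ModSumCongr (Fin k) (Fin l),
        AlternatingMap.domCoprod.summand a b σ
          (fun i => v ((finSumFinEquiv.trans (finCongr h)) i)) := by
    rw [← sum_apply, ← AlternatingMap.domCoprod_coe]; rfl
  rw [show (fun i => v ((finSumFinEquiv.trans (finCongr h)) i)) =
    v ∘ (finSumFinEquiv.trans (finCongr h)) from rfl] at h1
  rw [show (v ∘ ⇑(finSumFinEquiv.trans (finCongr h))) = _ from rfl, h1, map_sum]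
  refine Finset.sum_congr rfl fun σ _ => ?_
  conv_lhs => rw [← Quotient.out_eq' σ, AlternatingMap.domCoprod.summand_mk'']
  rw [smul_apply, MultilinearMap.domDomCongr_apply, MultilinearMap.domCoprod_apply]
  rw [Units.smul_def, map_zsmul]
  simp [zsmul_eq_mul]

theorem wedge_compLinearMap {d k l m : ℕ} (h : k + l = m) (a : Alt d k) (b : Alt d l)
    (A : Cn d →ₗ[ℝ] Cn d) :
    wedge h (a.compLinearMap A) (b.compLinearMap A) = (wedge h a b).compLinearMap A := by
  ext v
  simp [wedge_apply, AlternatingMap.compLinearMap_apply]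

theorem wedge_smul_left {d k l m : ℕ} (h : k + l = m) (c : ℂ) (a : Alt d k) (b : Alt d l) :
    wedge h (c • a) b = c • wedge h a b := by
  ext v
  simp only [wedge_apply, AlternatingMap.smul_apply, smul_eq_mul, Finset.mul_sum]
  exact Finset.sum_congr rfl fun σ _ => by ring

theorem SmoothOn.wedge {d k l m : ℕ} (h : k + l = m) {a : Cn d → Alt d k} {b : Cn d → Alt d l}
    {U : Set (Cn d)} (ha : SmoothOn a U) (hb : SmoothOn b U) :
    SmoothOn (fun z => CxForm.wedge h (a z) (b z)) U := by
  intro v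
  simp only [wedge_apply]
  exact ContDiffOn.sum fun σ _ => contDiffOn_const.mul ((ha _).mul (hb _))

end CxForm
end

noncomputable section

namespace CxForm

set_option linter.unusedSectionVars false

section Manifold

variable {d : ℕ} {M : Type*} [TopologicalSpace M] [ChartedSpace (Cn d) M]

/-! ### Coordinate changes -/

theorem contDiffOn_coordChange {e e' : OpenPartialHomeomorph M (Cn d)}
    (he : e ∈ holAtlas d M) (he' : e' ∈ holAtlas d M) :
    ContDiffOn ℂ ω (fun z => e' (e.symm z)) (e.target ∩ e.symm ⁻¹' e'.source) := by
  have h := IsManifold.compatible_of_mem_maximalAtlas he he'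
  have h2 := contMDiffOn_of_mem_contDiffGroupoid h
  rw [contMDiffOn_iff_contDiffOn] at h2
  simpa using! h2

theorem isOpen_overlap (e e' : OpenPartialHomeomorph M (Cn d)) :
    IsOpen (e.target ∩ e.symm ⁻¹' e'.source) :=
  e.isOpen_inter_preimage_symm e'.open_source

theorem contDiffOn_coordChange_real {e e' : OpenPartialHomeomorph M (Cn d)}
    (he : e ∈ holAtlas d M) (he' : e' ∈ holAtlas d M) :
    ContDiffOn ℝ ∞ (fun z => e' (e.symm z)) (e.target ∩ e.symm ⁻¹' e'.source) :=
  ((contDiffOn_coordChange he he').restrict_scalars ℝ).of_le (by simp)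

theorem hasFDerivAt_coordChange {e e' : OpenPartialHomeomorph M (Cn d)}
    (he : e ∈ holAtlas d M) (he' : e' ∈ holAtlas d M) {z : Cn d} (hz : z ∈ e.target)
    (hz' : e.symm z ∈ e'.source) :
    HasFDerivAt (fun z => e' (e.symm z)) (fderiv ℂ (fun z => e' (e.symm z)) z) z :=
  (((contDiffOn_coordChange he he').contDiffAt
    ((isOpen_overlap e e').mem_nhds ⟨hz, hz'⟩)).differentiableAt (by simp)).hasFDerivAt

theorem hasFDerivAt_coordChange_real {e e' : OpenPartialHomeomorph M (Cn d)}
    (he : e ∈ holAtlas d M) (he' : e' ∈ holAtlas d M) {z : Cn d} (hz : z ∈ e.target)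
    (hz' : e.symm z ∈ e'.source) :
    HasFDerivAt (fun z => e' (e.symm z))
      ((fderiv ℂ (fun z => e' (e.symm z)) z).restrictScalars ℝ) z :=
  (hasFDerivAt_coordChange he he' hz hz').restrictScalars ℝ

theorem fderiv_coordChange_real {e e' : OpenPartialHomeomorph M (Cn d)}
    (he : e ∈ holAtlas d M) (he' : e' ∈ holAtlas d M) {z : Cn d} (hz : z ∈ e.target)
    (hz' : e.symm z ∈ e'.source) :
    fderiv ℝ (fun z => e' (e.symm z)) z =
      (fderiv ℂ (fun z => e' (e.symm z)) z).restrictScalars ℝ :=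
  (hasFDerivAt_coordChange_real he he' hz hz').fderiv

theorem fderiv_coordChange_comp {e e' e'' : OpenPartialHomeomorph M (Cn d)}
    (he : e ∈ holAtlas d M) (he' : e' ∈ holAtlas d M) (he'' : e'' ∈ holAtlas d M)
    {z : Cn d} (hz : z ∈ e.target)
    (hz' : e.symm z ∈ e'.source) (hz'' : e.symm z ∈ e''.source) :
    fderiv ℝ (fun z => e'' (e.symm z)) z =
      (fderiv ℝ (fun z => e'' (e'.symm z)) (e' (e.symm z))).comp
        (fderiv ℝ (fun z => e' (e.symm z)) z) := by
  have h1 := (hasFDerivAt_coordChange_real he he' hz hz').differentiableAt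
  have h2 := (hasFDerivAt_coordChange_real he' he'' (z := e' (e.symm z)) (e'.map_source hz')
    (by rwa [e'.left_inv hz'])).differentiableAt
  rw [← fderiv_comp z h2 h1]
  refine Filter.EventuallyEq.fderiv_eq ?_
  filter_upwards [(isOpen_overlap e e').mem_nhds ⟨hz, hz'⟩] with y hy
  simp [e'.left_inv hy.2]

theorem holAtlas_chartAt [IsManifold 𝓘(ℂ, Cn d) ω M] (x : M) :
    chartAt (Cn d) x ∈ holAtlas d M := IsManifold.chart_mem_maximalAtlas x

theorem rep_coordChange [IsManifold 𝓘(ℂ, Cn d) ω M] {k : ℕ} (a : Form d M k)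
    {e e' : OpenPartialHomeomorph M (Cn d)}
    (he : e ∈ holAtlas d M) (he' : e' ∈ holAtlas d M) {z : Cn d} (hz : z ∈ e.target)
    (hz' : e.symm z ∈ e'.source) :
    rep a e z = (rep a e' (e' (e.symm z))).compLinearMap
      (fderiv ℝ (fun z => e' (e.symm z)) z : Cn d →ₗ[ℝ] Cn d) := by
  simp only [rep]
  rw [e'.left_inv hz', fderiv_coordChange_comp he he' (holAtlas_chartAt _) hz hz'
    (mem_chart_source _ _)]
  rfl

/-- The coefficient of a top form with respect to Lebesgue measure in the chart `e`. -/
def topCoeff (a : Form d M (2 * d)) (e : OpenPartialHomeomorph M (Cn d)) (z : Cn d) : ℂ :=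
  rep a e z (frame d)

/-- The real Jacobian determinant of a coordinate change. -/
def jac (e e' : OpenPartialHomeomorph M (Cn d)) (z : Cn d) : ℝ :=
  LinearMap.det (fderiv ℝ (fun z => e' (e.symm z)) z : Cn d →ₗ[ℝ] Cn d)

theorem jac_nonneg {e e' : OpenPartialHomeomorph M (Cn d)}
    (he : e ∈ holAtlas d M) (he' : e' ∈ holAtlas d M) {z : Cn d} (hz : z ∈ e.target)
    (hz' : e.symm z ∈ e'.source) : 0 ≤ jac e e' z := by
  rw [jac, fderiv_coordChange_real he he' hz hz']
  exact (det_restrictScalars_eq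
    (fderiv ℂ (fun z => e' (e.symm z)) z : Cn d →ₗ[ℂ] Cn d)).symm ▸ Complex.normSq_nonneg _

theorem topCoeff_coordChange [IsManifold 𝓘(ℂ, Cn d) ω M] (a : Form d M (2 * d))
    {e e' : OpenPartialHomeomorph M (Cn d)}
    (he : e ∈ holAtlas d M) (he' : e' ∈ holAtlas d M) {z : Cn d} (hz : z ∈ e.target)
    (hz' : e.symm z ∈ e'.source) :
    topCoeff a e z = (jac e e' z : ℂ) * topCoeff a e' (e' (e.symm z)) := by
  rw [topCoeff, rep_coordChange a he he' hz hz']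
  exact alternating_comp_frame (rep a e' (e' (e.symm z)))
    (fderiv ℝ (fun z => e' (e.symm z)) z : Cn d →ₗ[ℝ] Cn d)

theorem contDiffOn_jac {e e' : OpenPartialHomeomorph M (Cn d)}
    (he : e ∈ holAtlas d M) (he' : e' ∈ holAtlas d M) :
    ContDiffOn ℝ ∞ (jac e e') (e.target ∩ e.symm ⁻¹' e'.source) := by
  have h1 : ContDiffOn ℝ ∞ (fderiv ℝ (fun z => e' (e.symm z)))
      (e.target ∩ e.symm ⁻¹' e'.source) :=
    (contDiffOn_coordChange_real he he').fderiv_of_isOpen (isOpen_overlap e e') (by simp)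
  have h2 : ∀ z, jac e e' z = Matrix.det (Matrix.of fun i j =>
      (frameBasis d).equivFunL (fderiv ℝ (fun z => e' (e.symm z)) z (frameBasis d j)) i) := by
    intro z
    rw [jac, ← LinearMap.det_toMatrix (frameBasis d)]
    congr 1
    ext i j
    simp [LinearMap.toMatrix_apply]
  simp only [funext h2, Matrix.det_apply]
  refine ContDiffOn.sum fun σ _ => ?_
  simp only [Units.smul_def, zsmul_eq_mul]
  refine contDiffOn_const.mul (contDiffOn_prod fun i _ => ?_)
  simp only [Matrix.of_apply]
  have h3 : ContDiffOn ℝ ∞ (fun z => (frameBasis d).equivFunL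
      (fderiv ℝ (fun z => e' (e.symm z)) z (frameBasis d i)))
      (e.target ∩ e.symm ⁻¹' e'.source) :=
    (frameBasis d).equivFunL.contDiff.comp_contDiffOn (h1.clm_apply contDiffOn_const)
  exact (contDiff_apply ℝ ℝ (σ i)).comp_contDiffOn h3

theorem smoothOn_top_iff {a : Cn d → Alt d (2 * d)} {U : Set (Cn d)} :
    SmoothOn a U ↔ ContDiffOn ℝ ∞ (fun z => a z (frame d)) U := by
  refine ⟨fun h => h _, fun h v => ?_⟩
  simp only [alternating_eq_det_mul _ v]
  exact contDiffOn_const.mul h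

/-! ### Integrals in charts -/

variable [IsManifold 𝓘(ℂ, Cn d) ω M]

theorem image_overlap (e e' : OpenPartialHomeomorph M (Cn d)) :
    (fun z => e' (e.symm z)) '' (e.target ∩ e.symm ⁻¹' e'.source) =
      e'.target ∩ e'.symm ⁻¹' e.source := by
  have := (e.symm.trans e').image_source_eq_target
  rw [OpenPartialHomeomorph.trans_source, OpenPartialHomeomorph.trans_target] at this
  simpa using! this

theorem injOn_overlap (e e' : OpenPartialHomeomorph M (Cn d)) :
    InjOn (fun z => e' (e.symm z)) (e.target ∩ e.symm ⁻¹' e'.source) := by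
  have := (e.symm.trans e').injOn
  rw [OpenPartialHomeomorph.trans_source] at this
  simpa using! this

theorem integrableOn_coordChange_aux (a : Form d M (2 * d))
    {e e' : OpenPartialHomeomorph M (Cn d)}
    (he : e ∈ holAtlas d M) (he' : e' ∈ holAtlas d M) (φ : M → ℂ)
    {z : Cn d} (hz : z ∈ e.target ∩ e.symm ⁻¹' e'.source) :
    |(fderiv ℝ (fun z => e' (e.symm z)) z).det| •
      (φ (e'.symm (e' (e.symm z))) * topCoeff a e' (e' (e.symm z))) =
    φ (e.symm z) * topCoeff a e z := by
  rw [topCoeff_coordChange a he he' hz.1 hz.2, e'.left_inv hz.2]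
  have : |(fderiv ℝ (fun z => e' (e.symm z)) z).det| = jac e e' z :=
    abs_of_nonneg (jac_nonneg he he' hz.1 hz.2)
  rw [this, Complex.real_smul]; ring

theorem hasFDerivWithinAt_overlap {e e' : OpenPartialHomeomorph M (Cn d)}
    (he : e ∈ holAtlas d M) (he' : e' ∈ holAtlas d M) :
    ∀ z ∈ e.target ∩ e.symm ⁻¹' e'.source, HasFDerivWithinAt (fun z => e' (e.symm z))
      (fderiv ℝ (fun z => e' (e.symm z)) z) (e.target ∩ e.symm ⁻¹' e'.source) z := fun z hz =>
  (hasFDerivAt_coordChange_real he he' hz.1 hz.2).differentiableAt.hasFDerivAt.hasFDerivWithinAt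

theorem setIntegral_coordChange (a : Form d M (2 * d))
    {e e' : OpenPartialHomeomorph M (Cn d)}
    (he : e ∈ holAtlas d M) (he' : e' ∈ holAtlas d M) (φ : M → ℂ)
    (h1 : ∀ x ∈ e.source, φ x ≠ 0 → x ∈ e'.source)
    (h2 : ∀ x ∈ e'.source, φ x ≠ 0 → x ∈ e.source) :
    ∫ z in e.target, φ (e.symm z) * topCoeff a e z =
      ∫ z in e'.target, φ (e'.symm z) * topCoeff a e' z := by
  have key := integral_image_eq_integral_abs_det_fderiv_smul volume
    (isOpen_overlap e e').measurableSet (hasFDerivWithinAt_overlap he he') (injOn_overlap e e')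
    (fun z => φ (e'.symm z) * topCoeff a e' z)
  rw [image_overlap, setIntegral_congr_fun (isOpen_overlap e e').measurableSet
    (fun z hz => integrableOn_coordChange_aux a he he' φ hz)] at key
  have e1 : ∫ z in e.target, φ (e.symm z) * topCoeff a e z =
      ∫ z in e.target ∩ e.symm ⁻¹' e'.source, φ (e.symm z) * topCoeff a e z := by
    refine setIntegral_eq_of_subset_of_forall_sdiff_eq_zero e.open_target.measurableSet
      inter_subset_left fun z hz => ?_
    have : φ (e.symm z) = 0 := by
      by_contra h0
      exact hz.2 ⟨hz.1, h1 _ (e.map_target hz.1) h0⟩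
    rw [this, zero_mul]
  have e2 : ∫ z in e'.target, φ (e'.symm z) * topCoeff a e' z =
      ∫ z in e'.target ∩ e'.symm ⁻¹' e.source, φ (e'.symm z) * topCoeff a e' z := by
    refine setIntegral_eq_of_subset_of_forall_sdiff_eq_zero e'.open_target.measurableSet
      inter_subset_left fun z hz => ?_
    have : φ (e'.symm z) = 0 := by
      by_contra h0
      exact hz.2 ⟨hz.1, h2 _ (e'.map_target hz.1) h0⟩
    rw [this, zero_mul]
  rw [e1, e2, key]

theorem integrableOn_coordChange (a : Form d M (2 * d))
    {e e' : OpenPartialHomeomorph M (Cn d)}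
    (he : e ∈ holAtlas d M) (he' : e' ∈ holAtlas d M) (φ : M → ℂ)
    (h1 : ∀ x ∈ e.source, φ x ≠ 0 → x ∈ e'.source)
    (hi : IntegrableOn (fun z => φ (e'.symm z) * topCoeff a e' z) e'.target) :
    IntegrableOn (fun z => φ (e.symm z) * topCoeff a e z) e.target := by
  have key := integrableOn_image_iff_integrableOn_abs_det_fderiv_smul volume
    (isOpen_overlap e e').measurableSet (hasFDerivWithinAt_overlap he he') (injOn_overlap e e')
    (fun z => φ (e'.symm z) * topCoeff a e' z)
  rw [image_overlap, integrableOn_congr_fun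
    (fun z hz => integrableOn_coordChange_aux a he he' φ hz)
    (isOpen_overlap e e').measurableSet] at key
  refine (key.1 (hi.mono_set inter_subset_left)).of_forall_sdiff_eq_zero
    e.open_target.measurableSet fun z hz => ?_
  have : φ (e.symm z) = 0 := by
    by_contra h0
    exact hz.2 ⟨hz.1, h1 _ (e.map_target hz.1) h0⟩
  rw [this, zero_mul]

/-! ### Partitions of unity -/

variable (d M) in
theorem isManifold_real : IsManifold 𝓘(ℝ, Cn d) ∞ M := by
  refine isManifold_of_contDiffOn 𝓘(ℝ, Cn d) ∞ M fun e e' he he' => ?_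
  have := contDiffOn_coordChange_real (IsManifold.subset_maximalAtlas he :
    e ∈ holAtlas d M) (IsManifold.subset_maximalAtlas he' : e' ∈ holAtlas d M)
  simpa using! this

theorem exists_chartPartition [T2Space M] [CompactSpace M]
    (E : M → OpenPartialHomeomorph M (Cn d)) (hE : ∀ x, E x ∈ holAtlas d M)
    (hx : ∀ x, x ∈ (E x).source) :
    ∃ P : ChartPartition d M, ∀ j, ∃ x, P.chart j = E x := by
  have := isManifold_real d M
  obtain ⟨t, ht⟩ := CompactSpace.elim_nhds_subcover (fun x => (E x).source)
    (fun x => (E x).open_source.mem_nhds (hx x))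
  let q : Fin t.card ≃ t := t.equivFin.symm
  obtain ⟨f, hf⟩ := SmoothPartitionOfUnity.exists_isSubordinate 𝓘(ℝ, Cn d)
    (isClosed_univ (X := M)) (fun j => (E (q j)).source) (fun j => (E (q j)).open_source)
    (by
      intro x _
      have : x ∈ ⋃ x ∈ t, (E x).source := ht ▸ mem_univ x
      simp only [mem_iUnion] at this ⊢
      obtain ⟨y, hy, hxy⟩ := this
      exact ⟨q.symm ⟨y, hy⟩, by simpa using hxy⟩)
  exact ⟨{ N := t.card
           chart := fun j => E (q j)
           chart_mem := fun j => hE _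
           ρ := fun j => f j
           smooth := fun j => (f j).contMDiff
           nonneg := fun j x => f.nonneg j x
           sum_eq_one := fun x => by
            rw [← finsum_eq_sum_of_fintype]; exact f.sum_eq_one (mem_univ x)
           subordinate := hf }, fun j => ⟨q j, rfl⟩⟩

variable (d M) in
theorem nonempty_chartPartition [T2Space M] [CompactSpace M] : Nonempty (ChartPartition d M) :=
  ⟨(exists_chartPartition (fun x : M => chartAt (Cn d) x) holAtlas_chartAt
    (mem_chart_source _)).choose⟩

theorem ChartPartition.mem_source (P : ChartPartition d M) {j : Fin P.N} {x : M}
    (h : P.ρ j x ≠ 0) : x ∈ (P.chart j).source :=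
  P.subordinate j (subset_tsupport _ h)

theorem ChartPartition.continuous (P : ChartPartition d M) (j : Fin P.N) :
    Continuous (P.ρ j) := (P.smooth j).continuous

theorem ChartPartition.le_one (P : ChartPartition d M) (j : Fin P.N) (x : M) :
    P.ρ j x ≤ 1 := by
  rw [← P.sum_eq_one x]
  exact Finset.single_le_sum (f := fun j => P.ρ j x) (fun i _ => P.nonneg i x) (Finset.mem_univ j)

theorem integrableOn_partition_mul {a : Form d M (2 * d)} (Q P : ChartPartition d M)
    (hQ : ∀ j, IntegrableOn (Q.density a j) (Q.chart j).target) (i : Fin Q.N) (j : Fin P.N) :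
    IntegrableOn (fun z => ((P.ρ j ((Q.chart i).symm z) * Q.ρ i ((Q.chart i).symm z) : ℝ) : ℂ) *
      topCoeff a (Q.chart i) z) (Q.chart i).target := by
  have h1 := (hQ i).bdd_mul (c := 1)
    (f := fun z => (P.ρ j ((Q.chart i).symm z) : ℂ)) ?_ ?_
  · refine h1.congr (ae_of_all _ fun z => ?_)
    simp [ChartPartition.density, topCoeff]; ring
  · refine ContinuousOn.aestronglyMeasurable ?_ (Q.chart i).open_target.measurableSet
    exact (Complex.continuous_ofReal.comp (P.continuous j)).comp_continuousOn
      (Q.chart i).continuousOn_symm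
  · refine ae_of_all _ fun z => ?_
    rw [Complex.norm_real, Real.norm_of_nonneg (P.nonneg _ _)]
    exact P.le_one _ _

theorem ChartPartition.integrableOn_of (Q P : ChartPartition d M) {a : Form d M (2 * d)}
    (hQ : ∀ j, IntegrableOn (Q.density a j) (Q.chart j).target) :
    (∀ j, IntegrableOn (P.density a j) (P.chart j).target) ∧
      ∑ j, ∫ z in (P.chart j).target, P.density a j z =
        ∑ j, ∫ z in (Q.chart j).target, Q.density a j z := by
  have hint : ∀ i j, IntegrableOn (fun z => ((P.ρ j ((P.chart j).symm z) *
      Q.ρ i ((P.chart j).symm z) : ℝ) : ℂ) * topCoeff a (P.chart j) z) (P.chart j).target := by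
    intro i j
    refine integrableOn_coordChange a (P.chart_mem j) (Q.chart_mem i)
      (fun x => ((P.ρ j x * Q.ρ i x : ℝ) : ℂ)) ?_ (integrableOn_partition_mul Q P hQ i j)
    intro x _ hx
    refine Q.mem_source (j := i) fun h => hx (by simp [h])
  have hchg : ∀ i j, ∫ z in (P.chart j).target, ((P.ρ j ((P.chart j).symm z) *
      Q.ρ i ((P.chart j).symm z) : ℝ) : ℂ) * topCoeff a (P.chart j) z =
      ∫ z in (Q.chart i).target, ((P.ρ j ((Q.chart i).symm z) *
      Q.ρ i ((Q.chart i).symm z) : ℝ) : ℂ) * topCoeff a (Q.chart i) z := by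
    intro i j
    refine setIntegral_coordChange a (P.chart_mem j) (Q.chart_mem i)
      (fun x => ((P.ρ j x * Q.ρ i x : ℝ) : ℂ)) ?_ ?_
    · intro x _ hx
      refine Q.mem_source (j := i) fun h => hx (by simp [h])
    · intro x _ hx
      refine P.mem_source (j := j) fun h => hx (by simp [h])
  have hP : ∀ j, P.density a j = fun z => ∑ i, ((P.ρ j ((P.chart j).symm z) *
      Q.ρ i ((P.chart j).symm z) : ℝ) : ℂ) * topCoeff a (P.chart j) z := by
    intro j; funext z
    rw [← Finset.sum_mul, ← Complex.ofReal_sum, ← Finset.mul_sum, Q.sum_eq_one, mul_one]; rfl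
  have hQ' : ∀ i, Q.density a i = fun z => ∑ j, ((P.ρ j ((Q.chart i).symm z) *
      Q.ρ i ((Q.chart i).symm z) : ℝ) : ℂ) * topCoeff a (Q.chart i) z := by
    intro i; funext z
    rw [← Finset.sum_mul, ← Complex.ofReal_sum, ← Finset.sum_mul, P.sum_eq_one, one_mul]; rfl
  refine ⟨fun j => ?_, ?_⟩
  · rw [hP]; exact integrable_finsetSum _ fun i _ => hint i j
  · have s1 : ∀ j, ∫ z in (P.chart j).target, P.density a j z = ∑ i,
        ∫ z in (Q.chart i).target, ((P.ρ j ((Q.chart i).symm z) *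
          Q.ρ i ((Q.chart i).symm z) : ℝ) : ℂ) * topCoeff a (Q.chart i) z := by
      intro j
      rw [hP, integral_finsetSum _ fun i _ => hint i j]
      exact Finset.sum_congr rfl fun i _ => hchg i j
    have s2 : ∀ i, ∫ z in (Q.chart i).target, Q.density a i z = ∑ j,
        ∫ z in (Q.chart i).target, ((P.ρ j ((Q.chart i).symm z) *
          Q.ρ i ((Q.chart i).symm z) : ℝ) : ℂ) * topCoeff a (Q.chart i) z := by
      intro i
      rw [hQ', integral_finsetSum _ fun j _ => integrableOn_partition_mul Q P hQ i j]
    simp only [s1, s2]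
    exact Finset.sum_comm

theorem ChartPartition.formIntegrable (Q : ChartPartition d M) {a : Form d M (2 * d)}
    (hQ : ∀ j, IntegrableOn (Q.density a j) (Q.chart j).target) : FormIntegrable a :=
  fun P => (Q.integrableOn_of P hQ).1

theorem ChartPartition.formIntegral_eq (Q : ChartPartition d M) {a : Form d M (2 * d)}
    (hQ : ∀ j, IntegrableOn (Q.density a j) (Q.chart j).target) :
    formIntegral a = ∑ j, ∫ z in (Q.chart j).target, Q.density a j z := by
  have h : Nonempty (ChartPartition d M) := ⟨Q⟩
  rw [formIntegral, dif_pos h]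
  exact (Q.integrableOn_of h.some hQ).2

end Manifold

end CxForm
end

noncomputable section

namespace CxForm

/-! ### Holomorphic dependence of integrals on parameters -/

theorem differentiableOn_integral_of_locally_dominated {α : Type*} [MeasurableSpace α]
    {μ : Measure α} {U : Set ℂ} (hU : IsOpen U) (F : ℂ → α → ℂ)
    (hmeas : ∀ l ∈ U, AEStronglyMeasurable (F l) μ)
    (hdiff : ∀ᵐ a ∂μ, DifferentiableOn ℂ (fun l => F l a) U)
    (hb : ∀ l ∈ U, ∃ ε > 0, ∃ b : α → ℝ, Integrable b μ ∧
      ∀ᵐ a ∂μ, ∀ l' ∈ Metric.ball l ε, ‖F l' a‖ ≤ b a) :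
    DifferentiableOn ℂ (fun l => ∫ a, F l a ∂μ) U := by
  intro l₀ hl₀
  obtain ⟨ε₁, hε₁, b, hbi, hb⟩ := hb l₀ hl₀
  obtain ⟨ε₂, hε₂, hball⟩ := Metric.isOpen_iff.1 hU l₀ hl₀
  set ε := min ε₁ ε₂ with hε
  have hε0 : 0 < ε := lt_min hε₁ hε₂
  have hsub : Metric.ball l₀ ε ⊆ U := (Metric.ball_subset_ball (min_le_right _ _)).trans hball
  have hder : ∀ᵐ a ∂μ, ∀ l ∈ Metric.ball l₀ ε, HasDerivAt (fun l => F l a)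
      (deriv (fun l => F l a) l) l := by
    filter_upwards [hdiff] with a ha l hl
    exact (ha.differentiableAt (hU.mem_nhds (hsub hl))).hasDerivAt
  refine (hasDerivAt_integral_of_dominated_loc_of_deriv_le
    (F := F) (F' := fun l a => deriv (fun l => F l a) l) (bound := fun a => b a / (ε / 4))
    (Metric.ball_mem_nhds l₀ (half_pos hε0)) ?_ ?_ ?_ ?_ (hbi.div_const _) ?_).2.differentiableAt.differentiableWithinAt
  · filter_upwards [hU.mem_nhds hl₀] with l hl using hmeas l hl
  · refine hbi.mono' (hmeas _ hl₀) ?_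
    filter_upwards [hb] with a ha using ha _ (Metric.mem_ball_self hε₁)
  · have hseq : Tendsto (fun k : ℕ => l₀ + ((ε / 2 / (k + 1) : ℝ) : ℂ)) atTop (𝓝[≠] l₀) := by
      refine tendsto_nhdsWithin_iff.2 ⟨?_, Eventually.of_forall fun k => ?_⟩
      · have : Tendsto (fun k : ℕ => (ε / 2 / (k + 1) : ℝ)) atTop (𝓝 0) :=
          tendsto_const_div_atTop_nhds_zero_nat (ε / 2) |>.comp (tendsto_add_atTop_nat 1)
            |>.congr fun k => by simp
        have h2 := (Complex.continuous_ofReal.tendsto 0).comp this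
        simpa using h2.const_add l₀
      · have : (ε / 2 / (k + 1) : ℝ) ≠ 0 := by positivity
        have h3 : ((ε / 2 / (k + 1) : ℝ) : ℂ) ≠ 0 := by exact_mod_cast this
        exact fun h4 => h3 (by simpa only [mem_singleton_iff, add_eq_left] using h4)
    refine aestronglyMeasurable_of_tendsto_ae atTop
      (f := fun (k : ℕ) a => slope (fun l => F l a) l₀ (l₀ + ((ε / 2 / (k + 1) : ℝ) : ℂ)))
      (fun k => ?_) ?_
    · simp only [slope, vsub_eq_sub]
      refine AEStronglyMeasurable.fun_const_smul (AEStronglyMeasurable.sub (hmeas _ (hsub ?_))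
        (hmeas _ hl₀)) _
      rw [Metric.mem_ball, dist_eq_norm, add_sub_cancel_left, Complex.norm_real,
        Real.norm_of_nonneg (by positivity)]
      have : ε / 2 / ((k : ℝ) + 1) ≤ ε / 2 := div_le_self (by positivity) (by simp)
      linarith
    · filter_upwards [hder] with a ha
      exact ((hasDerivAt_iff_tendsto_slope.1 (ha l₀ (Metric.mem_ball_self hε0))).comp hseq)
  · filter_upwards [hb, hdiff] with a ha hd l hl
    have hcb : Metric.closedBall l (ε / 4) ⊆ Metric.ball l₀ ε := by
      intro w hw
      rw [Metric.mem_closedBall] at hw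
      rw [Metric.mem_ball] at hl ⊢
      have := dist_triangle w l l₀
      linarith
    refine Complex.norm_deriv_le_of_forall_mem_sphere_norm_le (by positivity) ?_ ?_
    · refine DifferentiableOn.diffContOnCl ?_
      exact hd.mono ((Metric.closure_ball_subset_closedBall).trans (hcb.trans hsub))
    · intro w hw
      exact ha w (Metric.ball_subset_ball (min_le_left _ _)
        (hcb (Metric.sphere_subset_closedBall hw)))
  · filter_upwards [hder] with a ha l hl
    exact ha l (Metric.ball_subset_ball (by linarith) hl)

/-! ### The singular kernel -/

section Kernel

variable {n : ℕ}

/-- The kernel `|z₁|^{2μ} z₁^p z̄₁^q`. -/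
def kern (μ : ℂ) (p q : ℤ) (z : Cn (n + 1)) : ℂ :=
  (‖z 0‖ : ℂ) ^ (2 * μ) * (z 0 ^ p * (starRingEnd ℂ (z 0)) ^ q)

theorem measurable_kern (μ : ℂ) (p q : ℤ) : Measurable (kern (n := n) μ p q) := by
  have h0 : Measurable fun z : Cn (n + 1) => z 0 := measurable_pi_apply 0
  have h1 : Measurable fun z : Cn (n + 1) => starRingEnd ℂ (z 0) :=
    Complex.continuous_conj.measurable.comp h0
  exact ((Complex.measurable_ofReal.comp h0.norm).pow_const _).mul
    ((h0.pow_const p).mul (h1.pow_const q))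

theorem norm_kern {μ : ℂ} {p q : ℤ} {z : Cn (n + 1)} (hz : z 0 ≠ 0) :
    ‖kern μ p q z‖ = ‖z 0‖ ^ (2 * μ.re + p + q) := by
  have h : 0 < ‖z 0‖ := norm_pos_iff.2 hz
  rw [kern, norm_mul, norm_mul, Complex.norm_cpow_eq_rpow_re_of_pos h, norm_zpow, norm_zpow,
    RCLike.norm_conj, Real.rpow_add h, Real.rpow_add h, Real.rpow_intCast, Real.rpow_intCast]
  simp [mul_assoc]

theorem ae_ne_zero : ∀ᵐ z : Cn (n + 1), z 0 ≠ 0 := by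
  rw [ae_iff]
  simpa using! Measure.pi_hyperplane (fun _ : Fin (n + 1) => (volume : Measure ℂ)) 0 0

theorem differentiable_kern {z : Cn (n + 1)} (hz : z 0 ≠ 0) (r : ℂ) (p q : ℤ) :
    Differentiable ℂ fun l : ℂ => kern (r * l) p q z := by
  unfold kern
  have : (‖z 0‖ : ℂ) ≠ 0 := by simpa using hz
  refine Differentiable.mul ?_ (differentiable_const _)
  exact Differentiable.const_cpow (by fun_prop) (Or.inl this)

/-- A weight that is integrable for `-2 < s`. -/
def weight (B s : ℝ) (z : Cn (n + 1)) : ℝ :=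
  (‖z 0‖ ^ s * Real.exp (-‖z 0‖ ^ (2 : ℝ))) *
    (Metric.closedBall (0 : Cn n) B).indicator 1 (fun j => z j.succ)

theorem integrable_prod_split {f : ℂ → ℂ} {g : Cn n → ℂ} (hf : Integrable f)
    (hg : Integrable g) : Integrable fun z : Cn (n + 1) => f (z 0) * g (fun j => z j.succ) := by
  have h := hf.mul_prod hg
  have hmp := volume_preserving_piFinSuccAbove (fun _ : Fin (n + 1) => ℂ) 0
  have := hmp.integrable_comp_emb (MeasurableEquiv.measurableEmbedding _) |>.2 h
  simpa [Function.comp_def, MeasurableEquiv.piFinSuccAbove, Fin.removeNth] using! this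

theorem integral_prod_split (f : ℂ → ℂ) (g : Cn n → ℂ) :
    ∫ z : Cn (n + 1), f (z 0) * g (fun j => z j.succ) = (∫ w, f w) * ∫ y, g y := by
  have hmp := volume_preserving_piFinSuccAbove (fun _ : Fin (n + 1) => ℂ) 0
  have := hmp.integral_comp (MeasurableEquiv.measurableEmbedding _)
    (fun x : ℂ × Cn n => f x.1 * g x.2)
  rw [← integral_prod_mul f g, Measure.volume_eq_prod ℂ (Cn n) |>.symm]
  simpa [MeasurableEquiv.piFinSuccAbove, Fin.removeNth] using! this

theorem integrable_radial {s : ℝ} (hs : -2 < s) :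
    Integrable fun w : ℂ => ‖w‖ ^ s * Real.exp (-‖w‖ ^ (2 : ℝ)) := by
  by_contra h
  have h1 := Complex.integral_rpow_mul_exp_neg_rpow (p := 2) (q := s) (by norm_num) hs
  rw [integral_undef h] at h1
  have : 0 < Real.Gamma ((s + 2) / 2) := Real.Gamma_pos_of_pos (by linarith)
  have h2 : 0 < (2 * Real.pi / 2) * Real.Gamma ((s + 2) / 2) := by positivity
  linarith

theorem integrable_weight (B : ℝ) {s : ℝ} (hs : -2 < s) :
    Integrable (weight (n := n) B s) := by
  have h1 : Integrable fun w : ℂ => ((‖w‖ ^ s * Real.exp (-‖w‖ ^ (2 : ℝ)) : ℝ) : ℂ) :=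
    (integrable_radial hs).ofReal
  have h2 : Integrable fun y : Cn n =>
      (((Metric.closedBall (0 : Cn n) B).indicator 1 y : ℝ) : ℂ) := by
    refine Integrable.ofReal (f := (Metric.closedBall (0 : Cn n) B).indicator (1 : Cn n → ℝ)) ?_
    rw [integrable_indicator_iff Metric.isClosed_closedBall.measurableSet]
    exact integrableOn_const (isCompact_closedBall _ _).measure_lt_top.ne
  have h3 := (integrable_prod_split h1 h2).re
  refine h3.congr (ae_of_all _ fun z => ?_)
  simp only [← Complex.ofReal_mul]
  exact Complex.ofReal_re _

theorem weight_nonneg (B s : ℝ) (z : Cn (n + 1)) : 0 ≤ weight B s z := by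
  unfold weight
  have : 0 ≤ (Metric.closedBall (0 : Cn n) B).indicator (1 : Cn n → ℝ) (fun j => z j.succ) :=
    Set.indicator_nonneg (fun _ _ => by simp) _
  positivity

theorem norm_tail_le (z : Cn (n + 1)) : ‖(fun j : Fin n => z j.succ)‖ ≤ ‖z‖ :=
  (pi_norm_le_iff_of_nonneg (norm_nonneg _)).2 fun j => norm_le_pi_norm z j.succ

theorem weight_of_mem {B s : ℝ} {z : Cn (n + 1)} (hz : ‖(fun j : Fin n => z j.succ)‖ ≤ B) :
    weight B s z = ‖z 0‖ ^ s * Real.exp (-‖z 0‖ ^ (2 : ℝ)) := by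
  rw [weight, indicator_of_mem (by simpa using hz)]; simp

theorem rpow_le_weight {B s : ℝ} {z : Cn (n + 1)} (hz : ‖z‖ ≤ B) :
    ‖z 0‖ ^ s ≤ Real.exp (B ^ (2 : ℝ)) * weight B s z := by
  rw [weight_of_mem ((norm_tail_le z).trans hz)]
  have h0 : ‖z 0‖ ≤ B := (norm_le_pi_norm z 0).trans hz
  have h1 : 1 ≤ Real.exp (B ^ (2 : ℝ)) * Real.exp (-‖z 0‖ ^ (2 : ℝ)) := by
    rw [← Real.exp_add]
    refine Real.one_le_exp ?_
    have := Real.rpow_le_rpow (norm_nonneg _) h0 (by norm_num : (0 : ℝ) ≤ 2)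
    linarith
  have h2 : 0 ≤ ‖z 0‖ ^ s := by positivity
  nlinarith

/-- If `f` is bounded by `C` and vanishes outside the ball of radius `B`, then `kern · f` is
dominated by a weight. -/
theorem norm_kern_mul_le {μ : ℂ} {p q : ℤ} {C B : ℝ} {z : Cn (n + 1)} {c : ℂ}
    (hz : z 0 ≠ 0) (hc : ‖c‖ ≤ C) (hB : c ≠ 0 → ‖z‖ ≤ B) :
    ‖kern μ p q z * c‖ ≤ C * Real.exp (B ^ (2 : ℝ)) * weight B (2 * μ.re + p + q) z := by
  have hw := weight_nonneg B (2 * μ.re + p + q) z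
  have hC : 0 ≤ C := (norm_nonneg c).trans hc
  by_cases h : c = 0
  · rw [h, mul_zero, norm_zero]; positivity
  · rw [norm_mul, norm_kern hz, mul_comm, mul_assoc]
    exact mul_le_mul hc (rpow_le_weight (hB h)) (by positivity) hC

theorem rpow_le_add {t s s₀ s₁ : ℝ} (ht : 0 < t) (h0 : s₀ ≤ s) (h1 : s ≤ s₁) :
    t ^ s ≤ t ^ s₀ + t ^ s₁ := by
  have p0 : 0 ≤ t ^ s₀ := by positivity
  have p1 : 0 ≤ t ^ s₁ := by positivity
  rcases le_total t 1 with h | h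
  · have := Real.rpow_le_rpow_of_exponent_ge ht h h0; linarith
  · have := Real.rpow_le_rpow_of_exponent_le h h1; linarith

theorem weight_le_add {B s s₀ s₁ : ℝ} {z : Cn (n + 1)} (hz : z 0 ≠ 0) (h0 : s₀ ≤ s)
    (h1 : s ≤ s₁) : weight B s z ≤ weight B s₀ z + weight B s₁ z := by
  unfold weight
  rw [← add_mul, ← add_mul]
  have h := rpow_le_add (norm_pos_iff.2 hz) h0 h1
  have : 0 ≤ (Metric.closedBall (0 : Cn n) B).indicator (1 : Cn n → ℝ) (fun j => z j.succ) :=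
    Set.indicator_nonneg (fun _ _ => by simp) _
  gcongr

theorem integrable_kern_mul {μ : ℂ} {p q : ℤ} {f : Cn (n + 1) → ℂ} (hf : Continuous f)
    (hfc : HasCompactSupport f) (h : -2 < 2 * μ.re + p + q) :
    Integrable fun z => kern μ p q z * f z := by
  obtain ⟨C, hC⟩ := hfc.exists_bound_of_continuous hf
  obtain ⟨B, hB⟩ := hfc.isCompact.isBounded.exists_norm_le
  refine ((integrable_weight (n := n) B h).const_mul (C * Real.exp (B ^ (2 : ℝ)))).mono'
    ((measurable_kern _ _ _).mul hf.measurable).aestronglyMeasurable ?_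
  filter_upwards [ae_ne_zero] with z hz
  exact norm_kern_mul_le hz (hC z) fun h => hB z (subset_tsupport _ h)

/-! ### Admissible families -/

/-- Families of the form `∑ₖ λ^k exp(λ v) χₖ` with smooth compactly supported `χₖ`. -/
inductive Adm (v : Cn (n + 1) → ℂ) : (ℂ → Cn (n + 1) → ℂ) → Prop
  | exp {χ : Cn (n + 1) → ℂ} (h : ContDiff ℝ ∞ χ) (hc : HasCompactSupport χ) :
      Adm v fun l z => Complex.exp (l * v z) * χ z
  | add {g g' : ℂ → Cn (n + 1) → ℂ} : Adm v g → Adm v g' → Adm v fun l z => g l z + g' l z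
  | smul {g : ℂ → Cn (n + 1) → ℂ} (c : ℂ) : Adm v g → Adm v fun l z => c * g l z
  | param {g : ℂ → Cn (n + 1) → ℂ} : Adm v g → Adm v fun l z => l * g l z

variable {v : Cn (n + 1) → ℂ} {g : ℂ → Cn (n + 1) → ℂ}

theorem Adm.contDiff (hv : ContDiff ℝ ∞ v) (hg : Adm v g) (l : ℂ) : ContDiff ℝ ∞ (g l) := by
  induction hg with
  | exp h _ => exact (Complex.contDiff_exp.comp (contDiff_const.mul hv)).mul h
  | add _ _ h h' => exact h.add h'
  | smul c _ h => exact contDiff_const.mul h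
  | param _ h => exact contDiff_const.mul h

theorem Adm.differentiable (hg : Adm v g) (z : Cn (n + 1)) :
    Differentiable ℂ fun l => g l z := by
  induction hg with
  | exp _ _ => fun_prop
  | add _ _ h h' => exact h.add h'
  | smul c _ h => exact h.const_mul c
  | param _ h => exact differentiable_id.mul h

theorem Adm.continuous (hv : ContDiff ℝ ∞ v) (hg : Adm v g) :
    Continuous fun x : ℂ × Cn (n + 1) => g x.1 x.2 := by
  induction hg with
  | exp h _ =>
    have := h.continuous
    have := hv.continuous
    fun_prop
  | add _ _ h h' => exact h.add h'
  | smul c _ h => exact continuous_const.mul h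
  | param _ h => exact continuous_fst.mul h

theorem Adm.exists_bound_support (hg : Adm v g) : ∃ B : ℝ, ∀ l z, g l z ≠ 0 → ‖z‖ ≤ B := by
  induction hg with
  | exp _ hc =>
    obtain ⟨B, hB⟩ := hc.isCompact.isBounded.exists_norm_le
    exact ⟨B, fun l z h => hB z (subset_tsupport _ (right_ne_zero_of_mul h))⟩
  | @add g g' _ _ h h' =>
    obtain ⟨B, hB⟩ := h
    obtain ⟨B', hB'⟩ := h'
    refine ⟨max B B', fun l z hne => ?_⟩
    by_cases h0 : g l z = 0
    · have h1 : g' l z ≠ 0 := fun h1 => hne (by simp [h0, h1])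
      exact (hB' l z h1).trans (le_max_right _ _)
    · exact (hB l z h0).trans (le_max_left _ _)
  | smul c _ h =>
    obtain ⟨B, hB⟩ := h
    exact ⟨B, fun l z h => hB l z (right_ne_zero_of_mul h)⟩
  | param _ h =>
    obtain ⟨B, hB⟩ := h
    exact ⟨B, fun l z h => hB l z (right_ne_zero_of_mul h)⟩

theorem Adm.hasCompactSupport (hg : Adm v g) (l : ℂ) : HasCompactSupport (g l) := by
  obtain ⟨B, hB⟩ := hg.exists_bound_support
  refine HasCompactSupport.intro (isCompact_closedBall 0 B) fun z hz => ?_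
  by_contra h
  exact hz (by simpa using hB l z h)

theorem Adm.lineDeriv (hv : ContDiff ℝ ∞ v) (hg : Adm v g) (u : Cn (n + 1)) :
    Adm v fun l z => fderiv ℝ (g l) z u := by
  induction hg with
  | @exp χ h hc =>
    have e : (fun (l : ℂ) z => fderiv ℝ (fun z => Complex.exp (l * v z) * χ z) z u) =
        fun l z => Complex.exp (l * v z) * fderiv ℝ χ z u +
          l * (Complex.exp (l * v z) * (fderiv ℝ v z u * χ z)) := by
      funext l z
      have h1 : HasFDerivAt v (fderiv ℝ v z) z := (hv.differentiable (by simp) z).hasFDerivAt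
      have h2 : HasFDerivAt χ (fderiv ℝ χ z) z := (h.differentiable (by simp) z).hasFDerivAt
      rw [(((h1.const_mul l).cexp).fun_mul h2).fderiv]
      simp; ring
    rw [e]
    refine .add (.exp ?_ ?_) (.param (.exp ?_ ?_))
    · exact (h.fderiv_right (m := ∞) (by simp)).clm_apply contDiff_const
    · exact hc.fderiv_apply (𝕜 := ℝ) u
    · exact ((hv.fderiv_right (m := ∞) (by simp)).clm_apply contDiff_const).mul h
    · exact hc.mul_left
  | @add g g' hg hg' h h' =>
    have e : (fun (l : ℂ) z => fderiv ℝ (fun z => g l z + g' l z) z u) =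
        fun l z => fderiv ℝ (g l) z u + fderiv ℝ (g' l) z u := by
      funext l z
      rw [fderiv_fun_add ((hg.contDiff hv l).differentiable (by simp) z)
        ((hg'.contDiff hv l).differentiable (by simp) z)]
      rfl
    rw [e]; exact .add h h'
  | @smul g c hg h =>
    have e : (fun (l : ℂ) z => fderiv ℝ (fun z => c * g l z) z u) =
        fun l z => c * fderiv ℝ (g l) z u := by
      funext l z
      rw [fderiv_const_mul ((hg.contDiff hv l).differentiable (by simp) z)]
      rfl
    rw [e]; exact .smul c h
  | @param g hg h =>
    have e : (fun (l : ℂ) z => fderiv ℝ (fun z => l * g l z) z u) =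
        fun l z => l * fderiv ℝ (g l) z u := by
      funext l z
      rw [fderiv_const_mul ((hg.contDiff hv l).differentiable (by simp) z)]
      rfl
    rw [e]; exact .param h

theorem Adm.dz₁ (hv : ContDiff ℝ ∞ v) (hg : Adm v g) : Adm v fun l => CxForm.dz₁ (g l) := by
  have e : (fun l => CxForm.dz₁ (g l)) = fun l z =>
      (1 / 2 : ℂ) * (fderiv ℝ (g l) z (Pi.single 0 1) +
        (-Complex.I) * fderiv ℝ (g l) z (Complex.I • Pi.single 0 1)) := by
    funext l z; simp only [CxForm.dz₁, del]; ring
  rw [e]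
  exact .smul _ (.add (hg.lineDeriv hv _) (.smul _ (hg.lineDeriv hv _)))

theorem Adm.dzbar₁ (hv : ContDiff ℝ ∞ v) (hg : Adm v g) :
    Adm v fun l => CxForm.dzbar₁ (g l) := by
  have e : (fun l => CxForm.dzbar₁ (g l)) = fun l z =>
      (1 / 2 : ℂ) * (fderiv ℝ (g l) z (Pi.single 0 1) +
        Complex.I * fderiv ℝ (g l) z (Complex.I • Pi.single 0 1)) := by
    funext l z; simp only [CxForm.dzbar₁, delbar]; ring
  rw [e]
  exact .smul _ (.add (hg.lineDeriv hv _) (.smul _ (hg.lineDeriv hv _)))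

/-- Constant families are admissible. -/
theorem Adm.const {f : Cn (n + 1) → ℂ} (hf : ContDiff ℝ ∞ f) (hc : HasCompactSupport f) :
    Adm 0 fun _ : ℂ => f := by
  have := Adm.exp (v := 0) hf hc
  simpa using this

theorem isOpen_halfPlane (r s : ℝ) : IsOpen {l : ℂ | s < 2 * (r * l.re)} :=
  isOpen_lt continuous_const (by fun_prop)

theorem Adm.differentiableOn_integral (hv : ContDiff ℝ ∞ v) (hg : Adm v g) (r : ℝ) (p q : ℤ) :
    DifferentiableOn ℂ (fun l : ℂ => ∫ z, kern (r * l) p q z * g l z)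
      {l | -2 - p - q < 2 * (r * l.re)} := by
  have hre : ∀ l : ℂ, ((r : ℂ) * l).re = r * l.re := fun l => by simp
  refine differentiableOn_integral_of_locally_dominated (isOpen_halfPlane r _) _ ?_ ?_ ?_
  · intro l _
    exact ((measurable_kern _ _ _).mul (hg.contDiff hv l).continuous.measurable).aestronglyMeasurable
  · filter_upwards [ae_ne_zero] with z hz
    exact ((differentiable_kern hz r p q).mul (hg.differentiable z)).differentiableOn
  · intro l hl
    rw [mem_ofPred_eq] at hl
    obtain ⟨B, hB⟩ := hg.exists_bound_support
    obtain ⟨C, hC⟩ := ((isCompact_closedBall l 1).prod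
      (isCompact_closedBall (0 : Cn (n + 1)) B)).exists_bound_of_continuousOn
      (hg.continuous hv).continuousOn
    set δ := (2 * (r * l.re) - (-2 - p - q)) / 2 with hδ
    have hδ0 : 0 < δ := by rw [hδ]; linarith
    obtain ⟨ε, hε, hεb⟩ : ∃ ε > 0, ε ≤ 1 ∧ 2 * |r| * ε ≤ δ := by
      refine ⟨min 1 (δ / (2 * |r| + 1)), by positivity, min_le_left _ _, ?_⟩
      have h1 : min 1 (δ / (2 * |r| + 1)) ≤ δ / (2 * |r| + 1) := min_le_right _ _
      have h2 : 0 ≤ 2 * |r| := by positivity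
      calc 2 * |r| * min 1 (δ / (2 * |r| + 1)) ≤ 2 * |r| * (δ / (2 * |r| + 1)) := by gcongr
        _ ≤ (2 * |r| + 1) * (δ / (2 * |r| + 1)) := by gcongr; linarith
        _ = δ := by field_simp
    refine ⟨ε, hε, fun z => |C| * Real.exp (B ^ (2 : ℝ)) *
      (weight B (2 * (r * l.re) - δ + p + q) z + weight B (2 * (r * l.re) + δ + p + q) z),
      ((integrable_weight B ?_).add (integrable_weight B ?_)).const_mul _, ?_⟩
    · rw [hδ]; linarith
    · rw [hδ]; linarith
    · filter_upwards [ae_ne_zero] with z hz l' hl'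
      have hl1 : l' ∈ Metric.closedBall l 1 :=
        Metric.mem_closedBall.2 ((Metric.mem_ball.1 hl').le.trans hεb.1)
      have hC' : ‖g l' z‖ ≤ |C| := by
        by_cases h : ‖z‖ ≤ B
        · exact (hC (l', z) ⟨hl1, by simpa using h⟩).trans (le_abs_self C)
        · have : g l' z = 0 := by by_contra h0; exact h (hB _ _ h0)
          rw [this, norm_zero]; exact abs_nonneg C
      have h2 := norm_kern_mul_le (μ := r * l') (p := p) (q := q) hz hC' (hB l' z)
      refine h2.trans ?_
      refine mul_le_mul_of_nonneg_left ?_ (by positivity)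
      have habs : |2 * (r * l'.re) - 2 * (r * l.re)| ≤ δ := by
        have h3 : |l'.re - l.re| ≤ ε := by
          have := Complex.abs_re_le_norm (l' - l)
          rw [Complex.sub_re] at this
          rw [Metric.mem_ball, dist_eq_norm] at hl'
          linarith
        rw [show 2 * (r * l'.re) - 2 * (r * l.re) = 2 * (r * (l'.re - l.re)) by ring, abs_mul,
          abs_mul, abs_two]
        refine le_trans ?_ hεb.2
        rw [mul_assoc]
        gcongr
      rw [abs_le] at habs
      rw [hre]
      exact weight_le_add hz (by linarith) (by linarith)

end Kernel

end CxForm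
end

noncomputable section

namespace CxForm

section Kernel

variable {n : ℕ}

/-! ### Integration by parts -/

theorem hasFDerivAt_kern_of_ne {μ : ℂ} {p q : ℤ} {z : Cn (n + 1)} (hz : z 0 ≠ 0) :
    HasFDerivAt (kern (n := n) μ p q)
      (((μ + p) * kern μ (p - 1) q z) • (ContinuousLinearMap.proj (R := ℝ) (0 : Fin (n + 1))) +
        ((μ + q) * kern μ p (q - 1) z) • (Complex.conjCLE.toContinuousLinearMap.comp
          (ContinuousLinearMap.proj (R := ℝ) (0 : Fin (n + 1))))) z := by
  set L : Cn (n + 1) →L[ℝ] ℂ := ContinuousLinearMap.proj (R := ℝ) (0 : Fin (n + 1)) with hL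
  set L' : Cn (n + 1) →L[ℝ] ℂ := Complex.conjCLE.toContinuousLinearMap.comp L with hL'
  have h1 : HasFDerivAt (fun z : Cn (n + 1) => z 0) L z := L.hasFDerivAt
  have h2 : HasFDerivAt (fun z : Cn (n + 1) => starRingEnd ℂ (z 0)) L' z := L'.hasFDerivAt
  have hz' : starRingEnd ℂ (z 0) ≠ 0 := by simpa using hz
  have hpos : 0 < ‖z 0‖ := norm_pos_iff.2 hz
  have hN : ∀ y : Cn (n + 1), (‖y 0‖ : ℂ) ^ (2 * μ) = (y 0 * starRingEnd ℂ (y 0)) ^ μ := by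
    intro y
    rw [Complex.mul_conj, Complex.normSq_eq_norm_sq, Complex.ofReal_pow, ← Complex.cpow_nat_mul']
    · simp
    · rw [Complex.arg_ofReal_of_nonneg (norm_nonneg _)]; simp [Real.pi_pos]
    · rw [Complex.arg_ofReal_of_nonneg (norm_nonneg _)]; simp [Real.pi_pos.le]
  have hslit : z 0 * starRingEnd ℂ (z 0) ∈ Complex.slitPlane := by
    rw [Complex.mul_conj]
    exact Complex.ofReal_mem_slitPlane.2 (Complex.normSq_pos.2 hz)
  have h3 := (h1.fun_mul h2)
  have h4 := ((hasDerivAt_id (z 0 * starRingEnd ℂ (z 0))).cpow_const (c := μ) hslit).comp_hasFDerivAt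
    z h3
  have h5 := (hasDerivAt_zpow p (z 0) (Or.inl hz)).comp_hasFDerivAt z h1
  have h6 := (hasDerivAt_zpow q (starRingEnd ℂ (z 0)) (Or.inl hz')).comp_hasFDerivAt z h2
  have h7 := h4.fun_mul (h5.fun_mul h6)
  have e : kern (n := n) μ p q = fun y => ((fun w => id w ^ μ) ∘ fun y : Cn (n + 1) => y 0 *
      starRingEnd ℂ (y 0)) y * (((fun w => w ^ p) ∘ fun y : Cn (n + 1) => y 0) y *
      ((fun w => w ^ q) ∘ fun y : Cn (n + 1) => starRingEnd ℂ (y 0)) y) := by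
    funext y; simp [kern, hN]
  rw [e]
  refine h7.congr_fderiv ?_
  ext u
  have hm : (z 0 * starRingEnd ℂ (z 0)) ^ (μ - 1) =
      (z 0 * starRingEnd ℂ (z 0)) ^ μ / (z 0 * starRingEnd ℂ (z 0)) :=
    by rw [Complex.cpow_sub _ _ (mul_ne_zero hz hz'), Complex.cpow_one]
  simp only [kern, hN, hm, zpow_sub_one₀ hz, zpow_sub_one₀ hz', id, Function.comp, mul_one,
    add_apply, smul_apply, smul_eq_mul]
  field_simp
  ring

theorem norm_kern_le {μ : ℂ} {p q : ℤ} (hμ : 0 < μ.re) (z : Cn (n + 1)) :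
    ‖kern μ p q z‖ ≤ ‖z 0‖ ^ (2 * μ.re + p + q) := by
  by_cases hz : z 0 = 0
  · have : μ ≠ 0 := by rintro rfl; simp at hμ
    have h : kern μ p q z = 0 := by simp [kern, hz, this]
    rw [h, norm_zero]; positivity
  · exact (norm_kern hz).le

theorem hasFDerivAt_kern {μ : ℂ} {p q : ℤ} (hμ : 0 < μ.re) (h : 2 ≤ 2 * μ.re + p + q)
    (z : Cn (n + 1)) :
    HasFDerivAt (kern (n := n) μ p q)
      (((μ + p) * kern μ (p - 1) q z) • (ContinuousLinearMap.proj (R := ℝ) (0 : Fin (n + 1))) +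
        ((μ + q) * kern μ p (q - 1) z) • (Complex.conjCLE.toContinuousLinearMap.comp
          (ContinuousLinearMap.proj (R := ℝ) (0 : Fin (n + 1))))) z := by
  by_cases hz : z 0 = 0
  · have hμ0 : μ ≠ 0 := by rintro rfl; simp at hμ
    have h0 : ∀ p q : ℤ, kern μ p q z = 0 := fun p q => by simp [kern, hz, hμ0]
    refine HasFDerivAt.congr_fderiv (f' := 0) ?_ (by ext; simp [h0])
    refine Asymptotics.IsBigO.hasFDerivAt (n := 2) (Asymptotics.IsBigO.of_bound 1 ?_) one_lt_two
    filter_upwards [Metric.ball_mem_nhds z one_pos] with y hy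
    rw [Metric.mem_ball, dist_eq_norm] at hy
    have hy0 : ‖y 0‖ ≤ ‖y - z‖ := by
      have := norm_le_pi_norm (y - z) 0
      rwa [Pi.sub_apply, hz, sub_zero] at this
    rw [one_mul, norm_pow, norm_norm]
    refine (norm_kern_le hμ y).trans ?_
    by_cases hy1 : ‖y 0‖ = 0
    · rw [hy1, Real.zero_rpow (by linarith)]; positivity
    · have hpos : 0 < ‖y 0‖ := lt_of_le_of_ne (norm_nonneg _) (Ne.symm hy1)
      calc ‖y 0‖ ^ (2 * μ.re + p + q) ≤ ‖y 0‖ ^ (2 : ℝ) :=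
            Real.rpow_le_rpow_of_exponent_ge hpos (hy0.trans hy.le) h
        _ = ‖y 0‖ ^ 2 := by norm_cast
        _ ≤ ‖y - z‖ ^ 2 := by gcongr
  · exact hasFDerivAt_kern_of_ne hz

variable {f : Cn (n + 1) → ℂ}

theorem fderiv_kern_apply {μ : ℂ} {p q : ℤ} (hμ : 0 < μ.re) (h : 2 ≤ 2 * μ.re + p + q)
    (z u : Cn (n + 1)) :
    fderiv ℝ (kern (n := n) μ p q) z u =
      (μ + p) * kern μ (p - 1) q z * u 0 + (μ + q) * kern μ p (q - 1) z * starRingEnd ℂ (u 0) := by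
  rw [(hasFDerivAt_kern hμ h z).fderiv]; simp

theorem integral_kern_fderiv {μ : ℂ} {p q : ℤ} (hμ : 0 < μ.re) (h : 2 ≤ 2 * μ.re + p + q)
    (hf : ContDiff ℝ ∞ f) (hfc : HasCompactSupport f) (u : Cn (n + 1)) :
    ∫ z, kern μ p q z * fderiv ℝ f z u =
      -((μ + p) * u 0 * ∫ z, kern μ (p - 1) q z * f z) -
        (μ + q) * starRingEnd ℂ (u 0) * ∫ z, kern μ p (q - 1) z * f z := by
  have i1 : Integrable fun z => kern μ (p - 1) q z * f z :=
    integrable_kern_mul hf.continuous hfc (by push_cast; linarith)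
  have i2 : Integrable fun z => kern μ p (q - 1) z * f z :=
    integrable_kern_mul hf.continuous hfc (by push_cast; linarith)
  have e : (fun z => fderiv ℝ (kern (n := n) μ p q) z u * f z) = fun z =>
      ((μ + p) * u 0) * (kern μ (p - 1) q z * f z) +
        ((μ + q) * starRingEnd ℂ (u 0)) * (kern μ p (q - 1) z * f z) := by
    funext z; rw [fderiv_kern_apply hμ h]; ring
  rw [integral_mul_fderiv_eq_neg_fderiv_mul_of_integrable]
  · rw [e, integral_add (i1.const_mul _) (i2.const_mul _), integral_const_mul,
      integral_const_mul]
    ring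
  · rw [e]; exact (i1.const_mul _).add (i2.const_mul _)
  · refine integrable_kern_mul ?_ (hfc.fderiv_apply (𝕜 := ℝ) u) (by linarith)
    exact (hf.continuous_fderiv (by simp)).clm_apply continuous_const
  · exact integrable_kern_mul hf.continuous hfc (by linarith)
  · exact fun z _ => (hasFDerivAt_kern hμ h z).differentiableAt
  · exact fun z _ => hf.differentiable (by simp) z

theorem contDiff_fderiv_apply_const (hf : ContDiff ℝ ∞ f) (u : Cn (n + 1)) :
    ContDiff ℝ ∞ fun z => fderiv ℝ f z u :=
  (hf.fderiv_right (m := ∞) (by simp)).clm_apply contDiff_const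

theorem integral_kern_dz₁_aux {μ : ℂ} {p q : ℤ} (hμ : 0 < μ.re) (h : 2 ≤ 2 * μ.re + p + q)
    (hf : ContDiff ℝ ∞ f) (hfc : HasCompactSupport f) :
    (∫ z, kern μ p q z * dz₁ f z = -((μ + p) * ∫ z, kern μ (p - 1) q z * f z)) ∧
    (∫ z, kern μ p q z * dzbar₁ f z = -((μ + q) * ∫ z, kern μ p (q - 1) z * f z)) := by
  have hi : ∀ u, Integrable fun z => kern μ p q z * fderiv ℝ f z u := fun u =>
    integrable_kern_mul (contDiff_fderiv_apply_const hf u).continuous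
      (hfc.fderiv_apply (𝕜 := ℝ) u) (by linarith)
  have e1 : (fun z => kern μ p q z * dz₁ f z) = fun z =>
      (1 / 2 : ℂ) * (kern μ p q z * fderiv ℝ f z (Pi.single 0 1)) +
        (-Complex.I / 2) * (kern μ p q z * fderiv ℝ f z (Complex.I • Pi.single 0 1)) := by
    funext z; simp only [dz₁, del]; ring
  have e2 : (fun z => kern μ p q z * dzbar₁ f z) = fun z =>
      (1 / 2 : ℂ) * (kern μ p q z * fderiv ℝ f z (Pi.single 0 1)) +
        (Complex.I / 2) * (kern μ p q z * fderiv ℝ f z (Complex.I • Pi.single 0 1)) := by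
    funext z; simp only [dzbar₁, delbar]; ring
  rw [e1, e2, integral_add ((hi _).const_mul _) ((hi _).const_mul _),
    integral_add ((hi _).const_mul _) ((hi _).const_mul _)]
  simp only [integral_const_mul]
  rw [integral_kern_fderiv hμ h hf hfc, integral_kern_fderiv hμ h hf hfc]
  simp only [Pi.smul_apply, Pi.single_eq_same, smul_eq_mul, mul_one, map_one, Complex.conj_I]
  constructor <;> ring_nf <;> simp only [Complex.I_sq] <;> ring

theorem integral_kern_dz₁ (μ : ℂ) {p q : ℤ} (h : -2 < 2 * μ.re + (p - 1) + q)
    (hf : ContDiff ℝ ∞ f) (hfc : HasCompactSupport f) :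
    (μ + p) * ∫ z, kern μ (p - 1) q z * f z = -∫ z, kern μ p q z * dz₁ f z := by
  have hA := Adm.const hf hfc
  have hv : ContDiff ℝ ∞ (0 : Cn (n + 1) → ℂ) := contDiff_const
  set U : Set ℂ := {l | -2 - (p - 1 : ℤ) - q < 2 * ((1 : ℝ) * l.re)} with hU
  have hUo : IsOpen U := isOpen_halfPlane 1 _
  have hUc : IsPreconnected U := by
    have : U = Complex.re ⁻¹' Ioi ((-2 - (p - 1 : ℤ) - q) / 2) := by
      ext l; simp only [hU, mem_ofPred_eq, mem_preimage, mem_Ioi]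
      constructor <;> intro h <;> linarith
    rw [this]
    exact ((convex_Ioi _).linear_preimage Complex.reLm).isPreconnected
  have d1 := hA.differentiableOn_integral hv 1 (p - 1) q
  have d2 : DifferentiableOn ℂ (fun l : ℂ => ∫ z, kern ((1 : ℝ) * l) p q z * dz₁ f z) U :=
    ((hA.dz₁ hv).differentiableOn_integral hv 1 p q).mono fun l hl => by
      simp only [hU, mem_ofPred_eq] at hl ⊢; push_cast at hl; linarith
  have d3 : DifferentiableOn ℂ (fun l : ℂ => (l + p) * ∫ z, kern ((1 : ℝ) * l) (p - 1) q z * f z) U :=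
    DifferentiableOn.mul (by fun_prop) d1
  have key : EqOn (fun l : ℂ => (l + p) * ∫ z, kern ((1 : ℝ) * l) (p - 1) q z * f z)
      (fun l : ℂ => -∫ z, kern ((1 : ℝ) * l) p q z * dz₁ f z) U := by
    set c : ℝ := |(p : ℝ)| + |(q : ℝ)| + 2 with hc
    have hp := neg_abs_le (p : ℝ)
    have hq := neg_abs_le (q : ℝ)
    refine AnalyticOnNhd.eqOn_of_preconnected_of_eventuallyEq (d3.analyticOnNhd hUo)
      (d2.neg.analyticOnNhd hUo) hUc (z₀ := (c : ℂ)) ?_ ?_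
    · simp only [hU, mem_ofPred_eq, Complex.ofReal_re]; push_cast; linarith [abs_nonneg (p : ℝ), abs_nonneg (q : ℝ)]
    · have hn : {l : ℂ | c - 1 < l.re} ∈ 𝓝 (c : ℂ) :=
        (isOpen_lt continuous_const Complex.continuous_re).mem_nhds (by simp)
      filter_upwards [hn] with l hl
      change c - 1 < l.re at hl
      have := (integral_kern_dz₁_aux (μ := l) (p := p) (q := q) (n := n)
        (by linarith [abs_nonneg (p : ℝ), abs_nonneg (q : ℝ)])
        (by linarith [abs_nonneg (p : ℝ), abs_nonneg (q : ℝ)]) hf hfc).1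
      simp only [Complex.ofReal_one, one_mul, this, neg_neg]
  have := key (x := μ) (by simp only [hU, mem_ofPred_eq]; push_cast; linarith)
  simpa using this

theorem integral_kern_dzbar₁ (μ : ℂ) {p q : ℤ} (h : -2 < 2 * μ.re + p + (q - 1))
    (hf : ContDiff ℝ ∞ f) (hfc : HasCompactSupport f) :
    (μ + q) * ∫ z, kern μ p (q - 1) z * f z = -∫ z, kern μ p q z * dzbar₁ f z := by
  have hA := Adm.const hf hfc
  have hv : ContDiff ℝ ∞ (0 : Cn (n + 1) → ℂ) := contDiff_const
  set U : Set ℂ := {l | -2 - p - (q - 1 : ℤ) < 2 * ((1 : ℝ) * l.re)} with hU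
  have hUo : IsOpen U := isOpen_halfPlane 1 _
  have hUc : IsPreconnected U := by
    have : U = Complex.re ⁻¹' Ioi ((-2 - p - (q - 1 : ℤ)) / 2) := by
      ext l; simp only [hU, mem_ofPred_eq, mem_preimage, mem_Ioi]
      constructor <;> intro h <;> linarith
    rw [this]
    exact ((convex_Ioi _).linear_preimage Complex.reLm).isPreconnected
  have d1 := hA.differentiableOn_integral hv 1 p (q - 1)
  have d2 : DifferentiableOn ℂ (fun l : ℂ => ∫ z, kern ((1 : ℝ) * l) p q z * dzbar₁ f z) U :=
    ((hA.dzbar₁ hv).differentiableOn_integral hv 1 p q).mono fun l hl => by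
      simp only [hU, mem_ofPred_eq] at hl ⊢; push_cast at hl; linarith
  have d3 : DifferentiableOn ℂ (fun l : ℂ => (l + q) * ∫ z, kern ((1 : ℝ) * l) p (q - 1) z * f z) U :=
    DifferentiableOn.mul (by fun_prop) d1
  have key : EqOn (fun l : ℂ => (l + q) * ∫ z, kern ((1 : ℝ) * l) p (q - 1) z * f z)
      (fun l : ℂ => -∫ z, kern ((1 : ℝ) * l) p q z * dzbar₁ f z) U := by
    set c : ℝ := |(p : ℝ)| + |(q : ℝ)| + 2 with hc
    have hp := neg_abs_le (p : ℝ)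
    have hq := neg_abs_le (q : ℝ)
    refine AnalyticOnNhd.eqOn_of_preconnected_of_eventuallyEq (d3.analyticOnNhd hUo)
      (d2.neg.analyticOnNhd hUo) hUc (z₀ := (c : ℂ)) ?_ ?_
    · simp only [hU, mem_ofPred_eq, Complex.ofReal_re]; push_cast; linarith [abs_nonneg (p : ℝ), abs_nonneg (q : ℝ)]
    · have hn : {l : ℂ | c - 1 < l.re} ∈ 𝓝 (c : ℂ) :=
        (isOpen_lt continuous_const Complex.continuous_re).mem_nhds (by simp)
      filter_upwards [hn] with l hl
      change c - 1 < l.re at hl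
      have := (integral_kern_dz₁_aux (μ := l) (p := p) (q := q) (n := n)
        (by linarith [abs_nonneg (p : ℝ), abs_nonneg (q : ℝ)])
        (by linarith [abs_nonneg (p : ℝ), abs_nonneg (q : ℝ)]) hf hfc).2
      simp only [Complex.ofReal_one, one_mul, this, neg_neg]
  have := key (x := μ) (by simp only [hU, mem_ofPred_eq]; push_cast; linarith)
  simpa using this

/-! ### The delta distribution as a limit -/

theorem exists_bound_sub_gaussian (hf : ContDiff ℝ ∞ f) (hfc : HasCompactSupport f) :
    ∃ C B : ℝ, ∀ z, ‖f z - f (Fin.cons 0 fun j => z j.succ) * Real.exp (-‖z 0‖ ^ (2 : ℝ))‖ ≤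
      C * weight B 1 z := by
  obtain ⟨L, hL⟩ := ContDiff.lipschitzWith_of_hasCompactSupport hfc hf (by simp)
  obtain ⟨M, hM⟩ := hfc.exists_bound_of_continuous hf.continuous
  obtain ⟨B₀, hB₀⟩ := hfc.isCompact.isBounded.exists_norm_le
  set B := max B₀ 1 with hB
  have hB1 : 1 ≤ B := le_max_right _ _
  have hM0 : 0 ≤ M := (norm_nonneg _).trans (hM 0)
  have hBs : ∀ z, f z ≠ 0 → ‖z‖ ≤ B := fun z hz =>
    (hB₀ z (subset_tsupport _ hz)).trans (le_max_left _ _)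
  refine ⟨(L + M * B) * Real.exp (B ^ (2 : ℝ)) + M, B, fun z => ?_⟩
  set z' : Cn (n + 1) := Fin.cons 0 fun j => z j.succ with hz'
  have htail : (fun j : Fin n => z' j.succ) = fun j => z j.succ := by
    funext j; simp [hz']
  have hL0 : (0 : ℝ) ≤ L := L.2
  have hw := weight_nonneg B 1 z
  have hE : 0 < Real.exp (B ^ (2 : ℝ)) := Real.exp_pos _
  by_cases ht : ‖(fun j : Fin n => z j.succ)‖ ≤ B
  · have hws := weight_of_mem (s := 1) ht
    rw [Real.rpow_one] at hws
    by_cases h0 : ‖z 0‖ ≤ B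
    · have hzB : ‖z‖ ≤ B := by
        refine (pi_norm_le_iff_of_nonneg (by linarith)).2 fun i => ?_
        refine Fin.cases h0 (fun j => ?_) i
        exact (norm_le_pi_norm (fun j : Fin n => z j.succ) j).trans ht
      have hd : ‖f z - f z'‖ ≤ L * ‖z 0‖ := by
        have h1 := hL.dist_le_mul z z'
        rw [dist_eq_norm] at h1
        refine h1.trans (mul_le_mul_of_nonneg_left ?_ hL0)
        rw [dist_eq_norm]
        refine (pi_norm_le_iff_of_nonneg (norm_nonneg _)).2 fun i => ?_
        refine Fin.cases ?_ (fun j => ?_) i <;> simp [hz']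
      have hg : ‖f z' * (1 - Real.exp (-‖z 0‖ ^ (2 : ℝ)) : ℝ)‖ ≤ M * B * ‖z 0‖ := by
        rw [norm_mul, mul_assoc]
        refine mul_le_mul (hM _) ?_ (norm_nonneg _) hM0
        have h1 : Real.exp (-‖z 0‖ ^ (2 : ℝ)) ≤ 1 := Real.exp_le_one_iff.2 (by
          have : (0:ℝ) ≤ ‖z 0‖ ^ (2 : ℝ) := by positivity
          linarith)
        rw [Complex.norm_real, Real.norm_of_nonneg (by linarith)]
        have h2 := Real.add_one_le_exp (-‖z 0‖ ^ (2 : ℝ))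
        have h3 : ‖z 0‖ ^ (2 : ℝ) ≤ B * ‖z 0‖ := by
          rw [Real.rpow_two, sq]
          exact mul_le_mul_of_nonneg_right h0 (norm_nonneg (z 0))
        generalize Real.exp (-‖z 0‖ ^ (2 : ℝ)) = E at *
        generalize ‖z 0‖ ^ (2 : ℝ) = F at *
        linarith
      have hsum : ‖f z - f z' * Real.exp (-‖z 0‖ ^ (2 : ℝ))‖ ≤ (L + M * B) * ‖z 0‖ := by
        have : f z - f z' * Real.exp (-‖z 0‖ ^ (2 : ℝ)) =
          (f z - f z') + f z' * (1 - Real.exp (-‖z 0‖ ^ (2 : ℝ)) : ℝ) := by push_cast; ring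
        rw [this, add_mul]
        exact (norm_add_le _ _).trans (add_le_add hd hg)
      have h1 := rpow_le_weight (s := 1) hzB
      rw [Real.rpow_one] at h1
      have h2 : 0 ≤ L + M * B := by positivity
      nlinarith [mul_le_mul_of_nonneg_left h1 h2]
    · have hfz : f z = 0 := by
        by_contra h
        exact h0 ((norm_le_pi_norm z 0).trans (hBs z h))
      push Not at h0
      have hexp := Real.exp_pos (-‖z 0‖ ^ (2 : ℝ))
      rw [hfz, zero_sub, norm_neg, norm_mul, Complex.norm_real,
        Real.norm_of_nonneg hexp.le]
      have h1 : ‖f z'‖ * Real.exp (-‖z 0‖ ^ (2 : ℝ)) ≤ M * weight B 1 z := by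
        rw [hws]
        refine mul_le_mul (hM _) ?_ hexp.le hM0
        nlinarith
      have h2 : 0 ≤ (L + M * B) * Real.exp (B ^ (2 : ℝ)) * weight B 1 z := by positivity
      nlinarith
  · have h1 : f z = 0 := by
      by_contra h
      exact ht ((norm_tail_le z).trans (hBs z h))
    have h2 : f z' = 0 := by
      by_contra h
      exact ht (htail ▸ (norm_tail_le z').trans (hBs z' h))
    rw [h1, h2]
    simp only [zero_mul, sub_zero, norm_zero]
    positivity

end Kernel

end CxForm
end

noncomputable section

namespace CxForm

section Kernel

variable {n : ℕ} {f : Cn (n + 1) → ℂ}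

theorem kern_neg_one_neg_one {t : ℝ} {z : Cn (n + 1)} (hz : z 0 ≠ 0) :
    kern (t : ℂ) (-1) (-1) z = ((‖z 0‖ ^ (2 * t - 2) : ℝ) : ℂ) := by
  have hpos : 0 < ‖z 0‖ := norm_pos_iff.2 hz
  rw [kern, zpow_neg_one, zpow_neg_one, ← mul_inv, Complex.mul_conj, Complex.normSq_eq_norm_sq,
    Real.rpow_sub hpos, Real.rpow_two]
  push_cast
  rw [Complex.ofReal_cpow hpos.le]
  push_cast
  rw [div_eq_mul_inv]

theorem rpow_mul_weight {B s s' : ℝ} {z : Cn (n + 1)} (hz : z 0 ≠ 0) :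
    ‖z 0‖ ^ s * weight B s' z = weight B (s + s') z := by
  rw [weight, weight, Real.rpow_add (norm_pos_iff.2 hz)]; ring

theorem continuous_cons_zero : Continuous fun y : Cn n => (Fin.cons 0 y : Cn (n + 1)) := by
  refine continuous_pi fun i => Fin.cases ?_ (fun j => ?_) i
  · simpa using continuous_const
  · simpa using continuous_apply j

theorem norm_le_norm_cons (y : Cn n) : ‖y‖ ≤ ‖(Fin.cons 0 y : Cn (n + 1))‖ := by
  have := norm_tail_le (Fin.cons 0 y : Cn (n + 1))
  simpa using this

theorem integrable_comp_cons (hf : Continuous f) (hfc : HasCompactSupport f) :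
    Integrable fun y : Cn n => f (Fin.cons 0 y) := by
  refine (hf.comp continuous_cons_zero).integrable_of_hasCompactSupport ?_
  obtain ⟨B, hB⟩ := hfc.isCompact.isBounded.exists_norm_le
  refine HasCompactSupport.intro (isCompact_closedBall 0 B) fun y hy => ?_
  by_contra h
  exact hy (by simpa using (norm_le_norm_cons y).trans (hB _ (subset_tsupport _ h)))

theorem cauchyPompeiu (hf : ContDiff ℝ ∞ f) (hfc : HasCompactSupport f) :
    -∫ z, kern 0 0 (-1) z * dz₁ f z = Real.pi * ∫ y : Cn n, f (Fin.cons 0 y) := by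
  have hv : ContDiff ℝ ∞ (0 : Cn (n + 1) → ℂ) := contDiff_const
  have hcont : ContinuousAt (fun l : ℂ => -∫ z, kern ((1 : ℝ) * l) 0 (-1) z * dz₁ f z) 0 :=
    ((((Adm.const hf hfc).dz₁ hv).differentiableOn_integral hv 1 0 (-1)).differentiableAt
      ((isOpen_halfPlane 1 _).mem_nhds (by simp))).continuousAt.neg
  have hofReal : Tendsto (fun t : ℝ => (t : ℂ)) (𝓝[>] 0) (𝓝 0) := by
    have := Complex.continuous_ofReal.tendsto 0
    rw [Complex.ofReal_zero] at this
    exact this.mono_left nhdsWithin_le_nhds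
  have h1 : Tendsto (fun t : ℝ => -∫ z, kern (t : ℂ) 0 (-1) z * dz₁ f z) (𝓝[>] 0)
      (𝓝 (-∫ z, kern 0 0 (-1) z * dz₁ f z)) := by
    have := hcont.tendsto.comp hofReal
    simpa [Function.comp_def] using this
  refine tendsto_nhds_unique h1 ?_
  obtain ⟨C, B, hCB⟩ := exists_bound_sub_gaussian hf hfc
  set k : Cn (n + 1) → ℂ := fun z =>
    f z - f (Fin.cons 0 fun j => z j.succ) * Real.exp (-‖z 0‖ ^ (2 : ℝ)) with hk
  have htail : Continuous fun z : Cn (n + 1) => f (Fin.cons 0 fun j => z j.succ) :=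
    (hf.continuous.comp continuous_cons_zero).comp
      (continuous_pi fun j => continuous_apply _)
  have hC0 : 0 ≤ |C| := abs_nonneg C
  have hdom : ∀ t : ℝ, t ∈ Ioc (0 : ℝ) 1 → ∀ᵐ z : Cn (n + 1), ‖kern (t : ℂ) (-1) (-1) z * k z‖ ≤
      |C| * (weight B (-1) z + weight B 1 z) := by
    intro t ht
    filter_upwards [ae_ne_zero] with z hz
    rw [norm_mul, kern_neg_one_neg_one hz, Complex.norm_real, Real.norm_of_nonneg (by positivity)]
    calc ‖z 0‖ ^ (2 * t - 2) * ‖k z‖ ≤ ‖z 0‖ ^ (2 * t - 2) * (|C| * weight B 1 z) := by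
          refine mul_le_mul_of_nonneg_left ((hCB z).trans ?_) (by positivity)
          exact mul_le_mul_of_nonneg_right (le_abs_self C) (weight_nonneg _ _ _)
      _ = |C| * weight B (2 * t - 2 + 1) z := by rw [← rpow_mul_weight hz]; ring
      _ ≤ _ := mul_le_mul_of_nonneg_left
          (weight_le_add hz (by linarith [ht.1]) (by linarith [ht.2])) hC0
  have hwi : Integrable fun z : Cn (n + 1) => |C| * (weight B (-1) z + weight B 1 z) :=
    ((integrable_weight B (by norm_num)).add (integrable_weight B (by norm_num))).const_mul _
  have hki : ∀ t : ℝ, t ∈ Ioc (0 : ℝ) 1 → Integrable fun z => kern (t : ℂ) (-1) (-1) z * k z := by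
    intro t ht
    refine hwi.mono' ?_ (hdom t ht)
    refine ((measurable_kern _ _ _).mul ?_).aestronglyMeasurable
    refine hf.continuous.measurable.sub (htail.measurable.mul ?_)
    exact Complex.measurable_ofReal.comp (by fun_prop)
  set W := ∫ z : Cn (n + 1), |C| * (weight B (-1) z + weight B 1 z) with hW
  set I := ∫ y : Cn n, f (Fin.cons 0 y) with hI
  have hsplit : ∀ t : ℝ, t ∈ Ioc (0 : ℝ) 1 → -∫ z, kern (t : ℂ) 0 (-1) z * dz₁ f z =
      t * (∫ z, kern (t : ℂ) (-1) (-1) z * k z) + (t * Complex.Gamma t) * (Real.pi * I) := by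
    intro t ht
    have ibp := integral_kern_dz₁ (t : ℂ) (p := 0) (q := -1)
      (by simp; linarith [ht.1]) hf hfc
    rw [← ibp]
    have hg : Integrable fun w : ℂ => ((‖w‖ ^ (2 * t - 2) * Real.exp (-‖w‖ ^ (2 : ℝ)) : ℝ) : ℂ) :=
      (integrable_radial (by linarith [ht.1])).ofReal
    have i2 := integrable_prod_split hg (integrable_comp_cons hf.continuous hfc)
    have e2 := integral_prod_split (n := n)
      (fun w : ℂ => ((‖w‖ ^ (2 * t - 2) * Real.exp (-‖w‖ ^ (2 : ℝ)) : ℝ) : ℂ))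
      (fun y : Cn n => f (Fin.cons 0 y))
    have e3 : ∫ w : ℂ, ((‖w‖ ^ (2 * t - 2) * Real.exp (-‖w‖ ^ (2 : ℝ)) : ℝ) : ℂ) =
        Real.pi * Complex.Gamma t := by
      rw [integral_complex_ofReal, Complex.integral_rpow_mul_exp_neg_rpow (by norm_num)
        (by linarith [ht.1])]
      rw [show (2 * t - 2 + 2) / 2 = t by ring, show 2 * Real.pi / 2 = Real.pi by ring]
      push_cast
      rw [Complex.Gamma_ofReal]
    have e4 : ∫ z, kern (t : ℂ) (0 - 1) (-1) z * f z =
        ∫ z, (kern (t : ℂ) (-1) (-1) z * k z +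
          ((‖z 0‖ ^ (2 * t - 2) * Real.exp (-‖z 0‖ ^ (2 : ℝ)) : ℝ) : ℂ) *
            f (Fin.cons 0 fun j => z j.succ)) := by
      refine integral_congr_ae ?_
      filter_upwards [ae_ne_zero] with z hz
      rw [zero_sub, kern_neg_one_neg_one hz, hk]
      push_cast; ring
    rw [e4, integral_add (hki t ht) i2, e2, e3]
    push_cast; ring
  have hz : Tendsto (fun t : ℝ => (t : ℂ) * ∫ z, kern (t : ℂ) (-1) (-1) z * k z) (𝓝[>] 0)
      (𝓝 0) := by
    rw [tendsto_zero_iff_norm_tendsto_zero]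
    have hl : Tendsto (fun t : ℝ => t * W) (𝓝[>] 0) (𝓝 0) := by
      have : Tendsto (fun t : ℝ => t * W) (𝓝 0) (𝓝 (0 * W)) := tendsto_id.mul_const W
      rw [zero_mul] at this
      exact this.mono_left nhdsWithin_le_nhds
    refine squeeze_zero' (Eventually.of_forall fun _ => norm_nonneg _) ?_ hl
    filter_upwards [Ioc_mem_nhdsGT one_pos] with t ht
    rw [norm_mul, Complex.norm_real, Real.norm_of_nonneg ht.1.le]
    exact mul_le_mul_of_nonneg_left (norm_integral_le_of_norm_le hwi (hdom t ht)) ht.1.le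
  have hG : Tendsto (fun t : ℝ => (t : ℂ) * Complex.Gamma t) (𝓝[>] 0) (𝓝 1) := by
    refine Complex.tendsto_self_mul_Gamma_nhds_zero.comp (tendsto_nhdsWithin_iff.2 ⟨hofReal, ?_⟩)
    filter_upwards [self_mem_nhdsWithin] with t ht
    simpa using (ne_of_gt ht)
  have := hz.add (hG.mul_const (Real.pi * I))
  rw [zero_add, one_mul] at this
  refine this.congr' ?_
  filter_upwards [Ioc_mem_nhdsGT one_pos] with t ht using (hsplit t ht).symm

/-! ### Analytic continuation -/

variable {v : Cn (n + 1) → ℂ} {g : ℂ → Cn (n + 1) → ℂ}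

theorem Adm.iterate_dz₁ (hv : ContDiff ℝ ∞ v) (hg : Adm v g) (N : ℕ) :
    Adm v fun l => CxForm.dz₁^[N] (g l) := by
  induction N with
  | zero => simpa using hg
  | succ N ih => simpa only [Function.iterate_succ_apply'] using ih.dz₁ hv

theorem Adm.iterate_dzbar₁ (hv : ContDiff ℝ ∞ v) (hg : Adm v g) (N : ℕ) :
    Adm v fun l => CxForm.dzbar₁^[N] (g l) := by
  induction N with
  | zero => simpa using hg
  | succ N ih => simpa only [Function.iterate_succ_apply'] using ih.dzbar₁ hv

theorem Adm.exists_entire (hv : ContDiff ℝ ∞ v) (hg : Adm v g) {r : ℝ} (hr : 0 < r) :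
    ∃ E : ℂ → ℂ, Differentiable ℂ E ∧
      (∀ l : ℂ, 0 < l.re →
        ∫ z, kern (r * l) (-1) (-1) z * g l z = Complex.Gamma (r * l) * E l) ∧
      E 0 = Real.pi * ∫ y : Cn n, g 0 (Fin.cons 0 y) := by
  set e : ℕ → ℂ → ℂ := fun N l => (-1) ^ N * (Complex.Gamma (r * l + N))⁻¹ *
    ∫ z, kern (r * l) (N - 1) (-1) z * (CxForm.dz₁^[N] (g l)) z with he
  have hdiff : ∀ N : ℕ, DifferentiableOn ℂ (e N) {l | -(N : ℝ) < 2 * (r * l.re)} := by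
    intro N
    refine DifferentiableOn.mul (DifferentiableOn.const_mul ?_ _) ?_
    · exact (Complex.differentiable_one_div_Gamma.comp (by fun_prop :
        Differentiable ℂ fun l : ℂ => (r : ℂ) * l + N)).differentiableOn
    · refine ((hg.iterate_dz₁ hv N).differentiableOn_integral hv r (N - 1) (-1)).mono fun l hl => ?_
      simp only [mem_ofPred_eq] at hl ⊢; push_cast; linarith
  have hstep : ∀ (N : ℕ) (l : ℂ), -(N : ℝ) < 2 * (r * l.re) → e (N + 1) l = e N l := by
    intro N l hl
    have hA := hg.iterate_dz₁ hv N
    have ibp := integral_kern_dz₁ ((r : ℂ) * l) (p := N) (q := -1) (f := CxForm.dz₁^[N] (g l))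
      (by simp; linarith) (hA.contDiff hv l) (hA.hasCompactSupport l)
    simp only [he, Function.iterate_succ_apply']
    have hG := Complex.one_div_Gamma_eq_self_mul_one_div_Gamma_add_one ((r : ℂ) * l + N)
    rw [hG]
    push_cast at ibp ⊢
    rw [add_sub_cancel_right, ← add_assoc]
    rw [eq_neg_iff_add_eq_zero, add_comm, ← eq_neg_iff_add_eq_zero] at ibp
    rw [ibp]
    ring
  have hle : ∀ (N N' : ℕ) (l : ℂ), N ≤ N' → -(N : ℝ) < 2 * (r * l.re) → e N' l = e N l := by
    intro N N' l hNN hl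
    induction N', hNN using Nat.le_induction with
    | base => rfl
    | succ m hm ih =>
      rw [hstep m l, ih]
      have : (N : ℝ) ≤ m := by exact_mod_cast hm
      linarith
  set N₀ : ℂ → ℕ := fun l => ⌈2 * |r * l.re|⌉₊ + 1 with hN₀
  have hN₀' : ∀ l, -(N₀ l : ℝ) < 2 * (r * l.re) := by
    intro l
    have h1 := Nat.le_ceil (2 * |r * l.re|)
    have h2 := neg_abs_le (r * l.re)
    simp only [hN₀]; push_cast; linarith
  have hEq : ∀ (N : ℕ) (l : ℂ), -(N : ℝ) < 2 * (r * l.re) → e (N₀ l) l = e N l := by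
    intro N l hl
    rw [← hle N (max N (N₀ l)) l (le_max_left _ _) hl,
      ← hle (N₀ l) (max N (N₀ l)) l (le_max_right _ _) (hN₀' l)]
  refine ⟨fun l => e (N₀ l) l, fun l => ?_, fun l hl => ?_, ?_⟩
  · have hmem : {l' : ℂ | -(N₀ l : ℝ) < 2 * (r * l'.re)} ∈ 𝓝 l :=
      (isOpen_halfPlane r _).mem_nhds (hN₀' l)
    refine ((hdiff (N₀ l)).differentiableAt hmem).congr_of_eventuallyEq ?_
    filter_upwards [hmem] with l' hl' using hEq _ _ hl'
  · have hl' : 0 < r * l.re := mul_pos hr hl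
    simp only
    rw [hEq 0 l (by simp; linarith)]
    have hG : Complex.Gamma (r * l) ≠ 0 := Complex.Gamma_ne_zero_of_re_pos (by simpa using hl')
    simp only [he, pow_zero, one_mul, Nat.cast_zero, add_zero, zero_sub, Function.iterate_zero, id]
    field_simp
  · simp only
    rw [hEq 1 0 (by simp)]
    simp only [he, pow_one, mul_zero, zero_add, Nat.cast_one, Complex.Gamma_one, inv_one, mul_one,
      sub_self, Function.iterate_one]
    rw [neg_one_mul]
    exact cauchyPompeiu (hg.contDiff hv 0) (hg.hasCompactSupport 0)

theorem prod_mul_integral_kern_dzbar₁ (μ : ℂ) (p : ℤ) (b : ℕ) (hf : ContDiff ℝ ∞ f)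
    (hfc : HasCompactSupport f) (h : -1 < 2 * μ.re + p - b) :
    (∏ j ∈ Finset.range b, (μ - (j + 1))) * ∫ z, kern μ p (-(b + 1 : ℤ)) z * f z =
      (-1) ^ b * ∫ z, kern μ p (-1) z * dzbar₁^[b] f z := by
  induction b generalizing f with
  | zero => simp
  | succ b ih =>
    have hA := (Adm.const hf hfc).dzbar₁ contDiff_const
    have ibp := integral_kern_dzbar₁ μ (p := p) (q := -(b + 1 : ℤ)) (f := f)
      (by push_cast at h ⊢; linarith) hf hfc
    have h2 := ih (hA.contDiff contDiff_const 0) (hA.hasCompactSupport 0)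
      (by push_cast at h ⊢; linarith)
    rw [Finset.prod_range_succ, Function.iterate_succ_apply, pow_succ]
    have e : (-((b + 1 : ℕ) + 1 : ℤ)) = -(b + 1 : ℤ) - 1 := by push_cast; ring
    rw [e, mul_assoc]
    have e2 : μ - ((b : ℂ) + 1) = μ + ((-(b + 1 : ℤ) : ℤ) : ℂ) := by push_cast; ring
    rw [e2, ibp, mul_neg, h2]; ring

theorem prod_mul_integral_kern_dz₁ (μ : ℂ) (q : ℤ) (a : ℕ) (hf : ContDiff ℝ ∞ f)
    (hfc : HasCompactSupport f) (h : -1 < 2 * μ.re + q - a) :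
    (∏ j ∈ Finset.range a, (μ - (j + 1))) * ∫ z, kern μ (-(a + 1 : ℤ)) q z * f z =
      (-1) ^ a * ∫ z, kern μ (-1) q z * dz₁^[a] f z := by
  induction a generalizing f with
  | zero => simp
  | succ a ih =>
    have hA := (Adm.const hf hfc).dz₁ contDiff_const
    have ibp := integral_kern_dz₁ μ (p := -(a + 1 : ℤ)) (q := q) (f := f)
      (by push_cast at h ⊢; linarith) hf hfc
    have h2 := ih (hA.contDiff contDiff_const 0) (hA.hasCompactSupport 0)
      (by push_cast at h ⊢; linarith)
    rw [Finset.prod_range_succ, Function.iterate_succ_apply, pow_succ]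
    have e : (-((a + 1 : ℕ) + 1 : ℤ)) = -(a + 1 : ℤ) - 1 := by push_cast; ring
    rw [e, mul_assoc]
    have e2 : μ - ((a : ℂ) + 1) = μ + ((-(a + 1 : ℤ) : ℤ) : ℂ) := by push_cast; ring
    rw [e2, ibp, mul_neg, h2]; ring

end Kernel

/-- `J`, considered for `Re λ` large, has a meromorphic continuation `F` to `ℂ` such that `λ F(λ)`
has the value `c` at `0`. -/
def HasResidue (J : ℂ → ℂ) (c : ℂ) : Prop :=
  ∃ F : ℂ → ℂ, Meromorphic F ∧ (∃ R : ℝ, ∀ l : ℂ, R < l.re → F l = J l) ∧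
    Tendsto (fun l => l * F l) (𝓝[≠] 0) (𝓝 c)

theorem HasResidue.congr {J J' : ℂ → ℂ} {c : ℂ} (h : HasResidue J c) (R' : ℝ)
    (hJ : ∀ l : ℂ, R' < l.re → J l = J' l) : HasResidue J' c := by
  obtain ⟨F, hF, ⟨R, hR⟩, hc⟩ := h
  exact ⟨F, hF, ⟨max R R', fun l hl => (hR l ((le_max_left _ _).trans_lt hl)).trans
    (hJ l ((le_max_right _ _).trans_lt hl))⟩, hc⟩

theorem HasResidue.const_mul {J : ℂ → ℂ} {c : ℂ} (h : HasResidue J c) (k : ℂ) :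
    HasResidue (fun l => k * J l) (k * c) := by
  obtain ⟨F, hF, ⟨R, hR⟩, hc⟩ := h
  refine ⟨fun l => k * F l, (Meromorphic.const k).mul hF, ⟨R, fun l hl => by simp only [hR l hl]⟩, ?_⟩
  exact (hc.const_mul k).congr fun l => by ring

theorem HasResidue.sum {α : Type*} (s : Finset α) {J : α → ℂ → ℂ} {c : α → ℂ}
    (h : ∀ i ∈ s, HasResidue (J i) (c i)) :
    HasResidue (fun l => ∑ i ∈ s, J i l) (∑ i ∈ s, c i) := by
  classical
  induction s using Finset.induction_on with
  | empty =>
    exact ⟨fun _ => 0, Meromorphic.const 0, ⟨0, fun _ _ => by simp⟩, by simp⟩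
  | insert i s hi ih =>
    obtain ⟨F, hF, ⟨R, hR⟩, hc⟩ := h i (Finset.mem_insert_self i s)
    obtain ⟨F', hF', ⟨R', hR'⟩, hc'⟩ := ih fun j hj => h j (Finset.mem_insert_of_mem hj)
    refine ⟨fun l => F l + F' l, hF.add hF', ⟨max R R', fun l hl => ?_⟩, ?_⟩
    · beta_reduce
      rw [Finset.sum_insert hi, hR l ((le_max_left _ _).trans_lt hl),
        hR' l ((le_max_right _ _).trans_lt hl)]
    · rw [Finset.sum_insert hi]
      exact (hc.add hc').congr fun l => by ring

theorem HasResidue.unique {J : ℂ → ℂ} {c c' : ℂ} (h : HasResidue J c) (h' : HasResidue J c') :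
    c = c' := by
  obtain ⟨F, hF, ⟨R, hR⟩, hc⟩ := h
  obtain ⟨F', hF', ⟨R', hR'⟩, hc'⟩ := h'
  have hm : Meromorphic (F - F') := hF.sub hF'
  set x : ℂ := ((max R R' + 1 : ℝ) : ℂ) with hx
  have hz : ∀ᶠ l in 𝓝 x, (F - F') l = 0 := by
    have : {l : ℂ | max R R' < l.re} ∈ 𝓝 x :=
      (isOpen_lt continuous_const Complex.continuous_re).mem_nhds (by
        rw [hx, mem_ofPred_eq, Complex.ofReal_re]; linarith)
    filter_upwards [this] with l hl
    rw [Pi.sub_apply, hR l ((le_max_left _ _).trans_lt hl),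
      hR' l ((le_max_right _ _).trans_lt hl), sub_self]
  have hx' : meromorphicOrderAt (F - F') x = ⊤ :=
    meromorphicOrderAt_eq_top_iff.2 (hz.filter_mono nhdsWithin_le_nhds)
  have h0 : meromorphicOrderAt (F - F') 0 = ⊤ := by
    by_contra h0
    exact hm.meromorphicOn.meromorphicOrderAt_ne_top_of_isPreconnected
      (U := univ) isPreconnected_univ (mem_univ 0) (mem_univ x) h0 hx'
  have hev : ∀ᶠ l in 𝓝[≠] (0 : ℂ), F l = F' l := by
    filter_upwards [meromorphicOrderAt_eq_top_iff.1 h0] with l hl using sub_eq_zero.1 hl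
  refine tendsto_nhds_unique hc (hc'.congr' ?_)
  filter_upwards [hev] with l hl
  rw [hl]

theorem tendsto_mul_Gamma_const_mul {r : ℝ} (hr : 0 < r) :
    Tendsto (fun l : ℂ => l * Complex.Gamma (r * l)) (𝓝[≠] 0) (𝓝 (1 / r)) := by
  have hr' : (r : ℂ) ≠ 0 := by exact_mod_cast hr.ne'
  have h1 : Tendsto (fun l : ℂ => (r : ℂ) * l) (𝓝[≠] 0) (𝓝[≠] 0) := by
    refine tendsto_nhdsWithin_iff.2 ⟨?_, ?_⟩
    · have : Tendsto (fun l : ℂ => (r : ℂ) * l) (𝓝 0) (𝓝 (r * 0)) := tendsto_id.const_mul _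
      rw [mul_zero] at this
      exact this.mono_left nhdsWithin_le_nhds
    · filter_upwards [self_mem_nhdsWithin] with l hl
      exact mul_ne_zero hr' hl
  refine ((Complex.tendsto_self_mul_Gamma_nhds_zero.comp h1).const_mul (1 / (r : ℂ))).congr'
    (Eventually.of_forall fun l => ?_) |>.trans (by simp)
  simp only [Function.comp]; field_simp

theorem prod_neg_succ (a : ℕ) :
    ∏ j ∈ Finset.range a, ((0 : ℂ) - (j + 1)) = (-1) ^ a * a.factorial := by
  induction a with
  | zero => simp
  | succ a ih => rw [Finset.prod_range_succ, ih, Nat.factorial_succ]; push_cast; ring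

/-- The residue at `λ = 0` of `∫ |z₁|^{2rλ} exp(λ v) ψ / (z₁^{a+1} z̄₁^{b+1})`. -/
theorem hasResidue_integral_kern {n : ℕ} {v ψ : Cn (n + 1) → ℂ} (hv : ContDiff ℝ ∞ v)
    (hψ : ContDiff ℝ ∞ ψ) (hc : HasCompactSupport ψ) (a b : ℕ) {r : ℝ} (hr : 0 < r) :
    HasResidue (fun l => ∫ z, kern (r * l) (-(a + 1 : ℤ)) (-(b + 1 : ℤ)) z *
        (Complex.exp (l * v z) * ψ z))
      (Real.pi / r * ((1 / (a.factorial * b.factorial : ℂ)) *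
        ∫ y : Cn n, (dz₁^[a] (dzbar₁^[b] ψ)) (Fin.cons 0 y))) := by
  have hA : Adm v fun l z => Complex.exp (l * v z) * ψ z := .exp hψ hc
  have hA1 := hA.iterate_dzbar₁ hv b
  have hA2 := hA1.iterate_dz₁ hv a
  obtain ⟨E, hE, hE1, hE0⟩ := hA2.exists_entire hv hr
  set P : ℕ → ℂ → ℂ := fun a l => ∏ j ∈ Finset.range a, ((r : ℂ) * l - (j + 1)) with hP
  have hPd : ∀ a, Differentiable ℂ (P a) := fun a =>
    Differentiable.fun_finsetProd fun j _ => by fun_prop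
  have hP0 : ∀ a, P a 0 = (-1) ^ a * a.factorial := fun a => by
    simp only [hP, mul_zero]; exact prod_neg_succ a
  have hPc : ∀ a, ContinuousAt (P a) 0 := fun a => (hPd a).continuous.continuousAt
  have hPne : ∀ a, P a 0 ≠ 0 := fun a => by
    rw [hP0]; exact mul_ne_zero (by simp) (by exact_mod_cast a.factorial_ne_zero)
  refine ⟨fun l => (-1) ^ (a + b) * ((P a l)⁻¹ * (P b l)⁻¹) * (Complex.Gamma (r * l) * E l),
    ?_, ⟨(a + b + 1) / r, fun l hl => ?_⟩, ?_⟩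
  · intro x
    have m1 : ∀ a, MeromorphicAt (P a) x := fun a =>
      ((hPd a).analyticAt x).meromorphicAt
    have m2 : MeromorphicAt (fun l : ℂ => Complex.Gamma (r * l)) x := by
      have := (Meromorphic.Gamma ((r : ℂ) * x)).comp_analyticAt (g := fun l : ℂ => (r : ℂ) * l)
        (by fun_prop)
      exact this
    exact ((MeromorphicAt.const _ x).mul ((m1 a).inv.mul (m1 b).inv)).mul
      (m2.mul (hE.analyticAt x).meromorphicAt)
  · have hrl : (a : ℝ) + b + 1 < r * l.re := by
      rw [div_lt_iff₀ hr] at hl; linarith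
    have ha0 : (0 : ℝ) ≤ a := a.cast_nonneg
    have hb0 : (0 : ℝ) ≤ b := b.cast_nonneg
    have hre : ((r : ℂ) * l).re = r * l.re := by simp
    have hlpos : 0 < l.re := by
      by_contra h
      push Not at h
      have := mul_nonpos_of_nonneg_of_nonpos hr.le h
      linarith
    have hne : ∀ a' : ℕ, (a' : ℝ) ≤ a + b → P a' l ≠ 0 := by
      intro a' ha'
      refine Finset.prod_ne_zero_iff.2 fun j hj => ?_
      intro h0
      have := congrArg Complex.re h0
      simp only [Complex.sub_re, hre, Complex.add_re, Complex.natCast_re, Complex.one_re,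
        Complex.zero_re] at this
      have hj' : (j : ℝ) + 1 ≤ a' := by exact_mod_cast Finset.mem_range.1 hj
      linarith
    have s1 := prod_mul_integral_kern_dzbar₁ ((r : ℂ) * l) (-(a + 1 : ℤ)) b
      (hA.contDiff hv l) (hA.hasCompactSupport l) (by rw [hre]; push_cast; linarith)
    have s2 := prod_mul_integral_kern_dz₁ ((r : ℂ) * l) (-1) a
      (hA1.contDiff hv l) (hA1.hasCompactSupport l) (by rw [hre]; push_cast; linarith)
    rw [hE1 l hlpos] at s2
    have hnb := hne b (by linarith)
    have hna := hne a (by linarith)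
    change P b l * _ = _ at s1
    change P a l * _ = _ at s2
    have t1 : (∫ z, kern (r * l) (-(a + 1 : ℤ)) (-(b + 1 : ℤ)) z *
        (Complex.exp (l * v z) * ψ z)) = (P b l)⁻¹ * ((-1) ^ b * ((P a l)⁻¹ *
          ((-1) ^ a * (Complex.Gamma (r * l) * E l)))) := by
      rw [← s2, inv_mul_cancel_left₀ hna, ← s1, inv_mul_cancel_left₀ hnb]
    beta_reduce
    rw [t1]; ring
  · have t1 : Tendsto (fun l => (-1) ^ (a + b) * ((P a l)⁻¹ * (P b l)⁻¹) *
        ((l * Complex.Gamma (r * l)) * E l)) (𝓝[≠] 0)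
        (𝓝 ((-1) ^ (a + b) * ((P a 0)⁻¹ * (P b 0)⁻¹) * ((1 / r) * E 0))) := by
      refine Tendsto.mul (Tendsto.const_mul _ (Tendsto.mul ?_ ?_)) (Tendsto.mul ?_ ?_)
      · exact ((hPc a).inv₀ (hPne a)).tendsto.mono_left nhdsWithin_le_nhds
      · exact ((hPc b).inv₀ (hPne b)).tendsto.mono_left nhdsWithin_le_nhds
      · exact tendsto_mul_Gamma_const_mul hr
      · exact hE.continuous.continuousAt.tendsto.mono_left nhdsWithin_le_nhds
    have hψ0 : (fun z => Complex.exp (0 * v z) * ψ z) = ψ := by funext z; simp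
    have hval : (-1) ^ (a + b) * ((P a 0)⁻¹ * (P b 0)⁻¹) * ((1 / r) * E 0) =
        (Real.pi / r * ((1 / (a.factorial * b.factorial : ℂ)) *
        ∫ y : Cn n, (dz₁^[a] (dzbar₁^[b] ψ)) (Fin.cons 0 y))) := by
      rw [hE0, hP0, hP0, hψ0]
      have h1 : ((-1 : ℂ) ^ a) ≠ 0 := by simp
      have h2 : ((-1 : ℂ) ^ b) ≠ 0 := by simp
      have h3 : (a.factorial : ℂ) ≠ 0 := by exact_mod_cast a.factorial_ne_zero
      have h4 : (b.factorial : ℂ) ≠ 0 := by exact_mod_cast b.factorial_ne_zero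
      have h5 : (r : ℂ) ≠ 0 := by exact_mod_cast hr.ne'
      rw [pow_add]
      field_simp
    rw [hval] at t1
    exact t1.congr fun l => by ring

end CxForm
end

noncomputable section

namespace CxForm

set_option linter.unusedSectionVars false

/-! ### Extension by zero -/

theorem contDiff_indicator {d : ℕ} {U K : Set (Cn d)} (hU : IsOpen U) (hK : IsCompact K)
    (hKU : K ⊆ U) {F : Cn d → ℂ} (hF : ContDiffOn ℝ ∞ F U) (h0 : ∀ z ∈ U, z ∉ K → F z = 0) :
    ContDiff ℝ ∞ (U.indicator F) ∧ HasCompactSupport (U.indicator F) := by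
  classical
  have hz : ∀ z ∉ K, U.indicator F z = 0 := by
    intro z hz
    by_cases h : z ∈ U
    · rw [indicator_of_mem h, h0 z h hz]
    · rw [indicator_of_notMem h]
  refine ⟨contDiff_iff_contDiffAt.2 fun z => ?_, HasCompactSupport.intro hK hz⟩
  by_cases h : z ∈ U
  · refine (hF.contDiffAt (hU.mem_nhds h)).congr_of_eventuallyEq ?_
    filter_upwards [hU.mem_nhds h] with y hy using indicator_of_mem hy F
  · refine (contDiffAt_const (c := (0 : ℂ))).congr_of_eventuallyEq ?_
    filter_upwards [hK.isClosed.isOpen_compl.mem_nhds fun hh => h (hKU hh)] with y hy using hz y hy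

theorem integrableOn_of_zero_off {d : ℕ} {U K : Set (Cn d)} (hU : IsOpen U) (hK : IsCompact K)
    (hKU : K ⊆ U) {F : Cn d → ℂ} (hF : ContDiffOn ℝ ∞ F U) (h0 : ∀ z ∈ U, z ∉ K → F z = 0) :
    IntegrableOn F U := by
  obtain ⟨h1, h2⟩ := contDiff_indicator hU hK hKU hF h0
  exact (integrable_indicator_iff hU.measurableSet).1
    (h1.continuous.integrable_of_hasCompactSupport h2)

/-! ### The complex linear and antilinear parts of a derivative -/

/-- The real linear functional `u ↦ (df(u) + c df(iu)) / 2`. -/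
def cdel {d : ℕ} (c : ℂ) (f : Cn d → ℂ) (z : Cn d) : Cn d →ₗ[ℝ] ℂ where
  toFun u := (fderiv ℝ f z u + c * fderiv ℝ f z (Complex.I • u)) / 2
  map_add' u v := by simp only [smul_add, map_add]; ring
  map_smul' r u := by
    rw [smul_comm Complex.I r u]
    simp only [map_smul, Complex.real_smul, RingHom.id_apply]; ring

theorem del_eq_cdel {d : ℕ} (f : Cn d → ℂ) (z u : Cn d) : del f z u = cdel (-Complex.I) f z u := by
  simp only [del, cdel, LinearMap.coe_mk, AddHom.coe_mk]; ring

theorem delbar_eq_cdel {d : ℕ} (f : Cn d → ℂ) (z u : Cn d) :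
    delbar f z u = cdel Complex.I f z u := rfl

section cdel

variable {d : ℕ} {c : ℂ} {f g : Cn d → ℂ} {z : Cn d}

theorem cdel_congr (h : f =ᶠ[𝓝 z] g) : cdel c f z = cdel c g z := by
  ext u; simp only [cdel, h.fderiv_eq]

theorem cdel_mul (hf : DifferentiableAt ℝ f z) (hg : DifferentiableAt ℝ g z) (u : Cn d) :
    cdel c (fun y => f y * g y) z u = f z * cdel c g z u + g z * cdel c f z u := by
  simp only [cdel, LinearMap.coe_mk, AddHom.coe_mk, fderiv_fun_mul hf hg, add_apply, smul_apply,
    smul_eq_mul]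
  ring

theorem cdel_comp {τ : Cn d → Cn d} (A : Cn d →L[ℂ] Cn d) (hτ : HasFDerivAt τ A z)
    (hf : DifferentiableAt ℝ f (τ z)) (u : Cn d) :
    cdel c (fun y => f (τ y)) z u = cdel c f (τ z) (A u) := by
  have h := hf.hasFDerivAt.comp z (hτ.restrictScalars ℝ)
  have h2 : fderiv ℝ (fun y => f (τ y)) z = _ := h.fderiv
  simp only [cdel, LinearMap.coe_mk, AddHom.coe_mk, h2]
  simp

theorem cdel_sum {α : Type*} (s : Finset α) {f : α → Cn d → ℂ}
    (hf : ∀ i ∈ s, DifferentiableAt ℝ (f i) z) (u : Cn d) :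
    cdel c (fun y => ∑ i ∈ s, f i y) z u = ∑ i ∈ s, cdel c (f i) z u := by
  simp only [cdel, LinearMap.coe_mk, AddHom.coe_mk, fderiv_fun_sum hf, sum_apply,
    ← Finset.sum_div, Finset.sum_add_distrib, Finset.mul_sum]

theorem cdel_const (k : ℂ) (u : Cn d) : cdel c (fun _ => k) z u = 0 := by
  simp [cdel]

theorem integral_cdel_eq_zero (hf : ContDiff ℝ ∞ f) (hfc : HasCompactSupport f) (u : Cn d) :
    ∫ z, cdel c f z u = 0 := by
  have hi : ∀ u, Integrable fun z => fderiv ℝ f z u := fun u =>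
    ((hf.continuous_fderiv (by simp)).clm_apply continuous_const).integrable_of_hasCompactSupport
      (hfc.fderiv_apply (𝕜 := ℝ) u)
  have h0 : ∀ u, ∫ z, fderiv ℝ f z u = 0 := by
    intro u
    have := integral_mul_fderiv_eq_neg_fderiv_mul_of_integrable (μ := volume) (𝕜 := ℂ)
      (f := fun _ : Cn d => (1 : ℂ)) (g := f) (v := u) (by simp) (by simpa using hi u)
      (by simpa using hf.continuous.integrable_of_hasCompactSupport hfc)
      (fun z _ => by fun_prop) (fun z _ => hf.differentiable (by simp) z)
    simpa using this
  have e : (fun z => cdel c f z u) = fun z => (1 / 2 : ℂ) * fderiv ℝ f z u +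
      (c / 2) * fderiv ℝ f z (Complex.I • u) := by
    funext z; simp only [cdel, LinearMap.coe_mk, AddHom.coe_mk]; ring
  rw [e, integral_add ((hi _).const_mul _) ((hi _).const_mul _), integral_const_mul,
    integral_const_mul, h0, h0]
  simp

theorem ContDiffOn.cdel {U : Set (Cn d)} (hU : IsOpen U) (hf : ContDiffOn ℝ ∞ f U) (u : Cn d) :
    ContDiffOn ℝ ∞ (fun z => CxForm.cdel c f z u) U := by
  have h : ∀ u, ContDiffOn ℝ ∞ (fun z => fderiv ℝ f z u) U := fun u =>
    (hf.fderiv_of_isOpen hU (by simp)).clm_apply contDiffOn_const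
  simp only [CxForm.cdel, LinearMap.coe_mk, AddHom.coe_mk, div_eq_mul_inv]
  exact ((h u).add (contDiffOn_const.mul (h _))).mul contDiffOn_const

end cdel

section Manifold

variable {d : ℕ} {M : Type*} [TopologicalSpace M] [ChartedSpace (Cn d) M]
  [IsManifold 𝓘(ℂ, Cn d) ω M]

theorem mem_maximalAtlas_real {e : OpenPartialHomeomorph M (Cn d)} (he : e ∈ holAtlas d M) :
    e ∈ IsManifold.maximalAtlas 𝓘(ℝ, Cn d) ∞ M := by
  rw [IsManifold.mem_maximalAtlas_iff, mem_maximalAtlas_iff]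
  intro e' he'
  have he'' : e' ∈ holAtlas d M := IsManifold.subset_maximalAtlas he'
  have h1 := contDiffOn_coordChange_real he he''
  have h2 := contDiffOn_coordChange_real he'' he
  have key : ∀ e e' : OpenPartialHomeomorph M (Cn d),
      ContDiffOn ℝ ∞ (fun z => e' (e.symm z)) (e.target ∩ e.symm ⁻¹' e'.source) →
      ContDiffOn ℝ ∞ (fun z => e (e'.symm z)) (e'.target ∩ e'.symm ⁻¹' e.source) →
      e.symm.trans e' ∈ contDiffGroupoid ∞ 𝓘(ℝ, Cn d) := by
    intro e e' h1 h2
    rw [contDiffGroupoid, mem_groupoid_of_pregroupoid]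
    constructor
    · simpa [contDiffPregroupoid] using! h1
    · simpa [contDiffPregroupoid] using! h2
  exact ⟨key _ _ h1 h2, key _ _ h2 h1⟩

theorem contDiffOn_comp_symm {θ : M → ℝ} (hθ : ContMDiff 𝓘(ℝ, Cn d) 𝓘(ℝ, ℝ) ∞ θ)
    {e : OpenPartialHomeomorph M (Cn d)} (he : e ∈ holAtlas d M) :
    ContDiffOn ℝ ∞ (fun z => (θ (e.symm z) : ℂ)) e.target := by
  have := isManifold_real d M
  have h1 := hθ.comp_contMDiffOn (contMDiffOn_symm_of_mem_maximalAtlas (mem_maximalAtlas_real he))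
  rw [contMDiffOn_iff_contDiffOn] at h1
  exact Complex.ofRealCLM.contDiff.comp_contDiffOn h1

theorem isCompact_image_tsupport [CompactSpace M] {θ : M → ℝ}
    {e : OpenPartialHomeomorph M (Cn d)} (h : tsupport θ ⊆ e.source) :
    IsCompact (e '' tsupport θ) ∧ e '' tsupport θ ⊆ e.target ∧
      ∀ z ∈ e.target, z ∉ e '' tsupport θ → e.symm z ∉ tsupport θ := by
  refine ⟨(isClosed_tsupport θ).isCompact.image_of_continuousOn (e.continuousOn.mono h), ?_, ?_⟩
  · rintro _ ⟨x, hx, rfl⟩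
    exact e.map_source (h hx)
  · intro z hz hn hz'
    exact hn ⟨e.symm z, hz', e.right_inv hz⟩

theorem contDiffOn_topCoeff {t : Form d M (2 * d)} (ht : t ∈ smoothForm d M (2 * d))
    {e : OpenPartialHomeomorph M (Cn d)} (he : e ∈ holAtlas d M) :
    ContDiffOn ℝ ∞ (topCoeff t e) e.target := ht e he _

theorem ChartPartition.integrableOn_smooth [CompactSpace M] (P : ChartPartition d M)
    {t : Form d M (2 * d)} (ht : t ∈ smoothForm d M (2 * d)) (j : Fin P.N) :
    IntegrableOn (P.density t j) (P.chart j).target := by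
  obtain ⟨h1, h2, h3⟩ := isCompact_image_tsupport (P.subordinate j)
  refine integrableOn_of_zero_off (P.chart j).open_target h1 h2
    ((contDiffOn_comp_symm (P.smooth j) (P.chart_mem j)).mul
      (contDiffOn_topCoeff ht (P.chart_mem j))) fun z hz hn => ?_
  rw [ChartPartition.density, image_eq_zero_of_notMem_tsupport (h3 z hz hn), Complex.ofReal_zero,
    zero_mul]

theorem rep_add {k : ℕ} (a b : Form d M k) (e : OpenPartialHomeomorph M (Cn d)) (z : Cn d) :
    rep (a + b) e z = rep a e z + rep b e z := rfl

theorem rep_smul {k : ℕ} (c : ℂ) (a : Form d M k) (e : OpenPartialHomeomorph M (Cn d)) (z : Cn d) :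
    rep (c • a) e z = c • rep a e z := rfl

theorem formIntegral_add [T2Space M] [CompactSpace M] {s t : Form d M (2 * d)}
    (hs : s ∈ smoothForm d M (2 * d)) (ht : t ∈ smoothForm d M (2 * d)) :
    formIntegral (s + t) = formIntegral s + formIntegral t := by
  obtain ⟨P⟩ := nonempty_chartPartition d M
  rw [P.formIntegral_eq (P.integrableOn_smooth hs), P.formIntegral_eq (P.integrableOn_smooth ht),
    P.formIntegral_eq (P.integrableOn_smooth (add_mem hs ht)), ← Finset.sum_add_distrib]
  refine Finset.sum_congr rfl fun j _ => ?_
  rw [← integral_add (P.integrableOn_smooth hs j) (P.integrableOn_smooth ht j)]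
  refine integral_congr_ae (ae_of_all _ fun z => ?_)
  simp [ChartPartition.density, rep_add, mul_add]

theorem formIntegral_smul [T2Space M] [CompactSpace M] (c : ℂ) {t : Form d M (2 * d)}
    (ht : t ∈ smoothForm d M (2 * d)) :
    formIntegral (c • t) = c * formIntegral t := by
  obtain ⟨P⟩ := nonempty_chartPartition d M
  rw [P.formIntegral_eq (P.integrableOn_smooth ht),
    P.formIntegral_eq (P.integrableOn_smooth (Submodule.smul_mem _ c ht)), Finset.mul_sum]
  refine Finset.sum_congr rfl fun j _ => ?_
  rw [← integral_const_mul]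
  refine integral_congr_ae (ae_of_all _ fun z => ?_)
  simp [ChartPartition.density, rep_smul]; ring

/-- The integral of a form supported in a single chart. -/
theorem formIntegral_eq_setIntegral [T2Space M] [CompactSpace M] {e : OpenPartialHomeomorph M (Cn d)}
    (he : e ∈ holAtlas d M) {b : Form d M (2 * d)} (hb : ∀ x ∉ e.source, b x = 0)
    (hi : IntegrableOn (topCoeff b e) e.target) :
    (∀ (P : ChartPartition d M) (j : Fin P.N),
      IntegrableOn (P.density b j) (P.chart j).target) ∧
    formIntegral b = ∫ z in e.target, topCoeff b e z := by
  classical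
  set χ : M → ℂ := fun x => if x ∈ e.source then 1 else 0 with hχ
  have hi2 : ∀ (P : ChartPartition d M) (j : Fin P.N),
      IntegrableOn (fun z => (P.ρ j (e.symm z) : ℂ) * χ (e.symm z) * topCoeff b e z) e.target := by
    intro P j
    have h1 : IntegrableOn (fun z => (P.ρ j (e.symm z) : ℂ) * topCoeff b e z) e.target := by
      refine hi.bdd_mul (c := 1) ?_ ?_
      · refine ContinuousOn.aestronglyMeasurable ?_ e.open_target.measurableSet
        exact (Complex.continuous_ofReal.comp (P.continuous j)).comp_continuousOn
          e.continuousOn_symm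
      · refine ae_of_all _ fun z => ?_
        rw [Complex.norm_real, Real.norm_of_nonneg (P.nonneg _ _)]
        exact P.le_one _ _
    refine h1.congr_fun (fun z hz => ?_) e.open_target.measurableSet
    simp [hχ, e.map_target hz]
  have hden : ∀ (P : ChartPartition d M) (j : Fin P.N), P.density b j = fun z =>
      ((P.ρ j ((P.chart j).symm z) : ℂ) * χ ((P.chart j).symm z)) * topCoeff b (P.chart j) z := by
    intro P j
    funext z
    by_cases hx : (P.chart j).symm z ∈ e.source
    · simp [hχ, hx, ChartPartition.density, topCoeff]
    · simp [hχ, hx, ChartPartition.density, rep, hb _ hx]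
  have hint : ∀ (P : ChartPartition d M) (j : Fin P.N),
      IntegrableOn (P.density b j) (P.chart j).target := by
    intro P j
    rw [hden]
    refine integrableOn_coordChange b (P.chart_mem j) he
      (fun x => (P.ρ j x : ℂ) * χ x) (fun x _ hx => ?_) (hi2 P j)
    by_contra h
    exact hx (by simp [hχ, h])
  refine ⟨hint, ?_⟩
  obtain ⟨P⟩ := nonempty_chartPartition d M
  rw [P.formIntegral_eq (hint P)]
  have hj : ∀ j, ∫ z in (P.chart j).target, P.density b j z =
      ∫ z in e.target, (P.ρ j (e.symm z) : ℂ) * χ (e.symm z) * topCoeff b e z := by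
    intro j
    rw [hden]
    refine setIntegral_coordChange b (P.chart_mem j) he
      (fun x => (P.ρ j x : ℂ) * χ x) (fun x _ hx => ?_) (fun x _ hx => ?_)
    · by_contra h
      exact hx (by simp [hχ, h])
    · refine P.mem_source (j := j) fun h => hx (by simp [h])
  rw [Finset.sum_congr rfl fun j _ => hj j, ← integral_finsetSum _ fun j _ => hi2 P j]
  refine setIntegral_congr_fun e.open_target.measurableSet fun z hz => ?_
  simp only [hχ, e.map_target hz, if_true, mul_one]
  rw [← Finset.sum_mul, ← Complex.ofReal_sum, P.sum_eq_one, Complex.ofReal_one, one_mul]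

/-! ### Stokes' theorem for `∂` and `∂̄` -/

/-- The form `∂θ ∧ a` (for `c = -i`) or `∂̄θ ∧ a` (for `c = i`). -/
def cdelWedge (c : ℂ) {k : ℕ} (h : k + 1 = 2 * d) (θ : M → ℝ) (a : Form d M k) :
    Form d M (2 * d) := fun x =>
  (AlternatingMap.alternatizeUncurryFin
    ((cdel c (fun y => (θ ((chartAt (Cn d) x).symm y) : ℂ)) (chartAt (Cn d) x x)).smulRight
      (a x))).domDomCongr (finCongr h)

theorem rep_cdelWedge (c : ℂ) {k : ℕ} (h : k + 1 = 2 * d) {θ : M → ℝ}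
    (hθ : ContMDiff 𝓘(ℝ, Cn d) 𝓘(ℝ, ℝ) ∞ θ) (a : Form d M k)
    {e : OpenPartialHomeomorph M (Cn d)} (he : e ∈ holAtlas d M) {z : Cn d} (hz : z ∈ e.target)
    (v : Fin (2 * d) → Cn d) :
    rep (cdelWedge c h θ a) e z v = ∑ i : Fin (k + 1), (-1 : ℂ) ^ (i : ℕ) *
      (cdel c (fun y => (θ (e.symm y) : ℂ)) z (v (Fin.cast h i)) *
        rep a e z (fun j => v (Fin.cast h (i.succAbove j)))) := by
  set x := e.symm z with hx
  set C := chartAt (Cn d) x with hC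
  have hxC : x ∈ C.source := mem_chart_source _ _
  have hCm : C ∈ holAtlas d M := holAtlas_chartAt x
  have hder := hasFDerivAt_coordChange he hCm hz hxC
  have hderR := fderiv_coordChange_real he hCm hz hxC
  have hθC : DifferentiableAt ℝ (fun y => (θ (C.symm y) : ℂ)) (C x) :=
    ((contDiffOn_comp_symm hθ hCm).contDiffAt (C.open_target.mem_nhds
      (C.map_source hxC))).differentiableAt (by simp)
  have hcd : ∀ u, cdel c (fun y => (θ (e.symm y) : ℂ)) z u =
      cdel c (fun y => (θ (C.symm y) : ℂ)) (C x) (fderiv ℝ (fun y => C (e.symm y)) z u) := by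
    intro u
    rw [hderR]
    have h1 := cdel_comp (c := c) _ hder hθC u
    have h2 : cdel c (fun y => (θ (e.symm y) : ℂ)) z =
        cdel c (fun y => (θ (C.symm (C (e.symm y))) : ℂ)) z := by
      refine cdel_congr ?_
      filter_upwards [(isOpen_overlap e C).mem_nhds ⟨hz, hxC⟩] with y hy
      rw [C.left_inv hy.2]
    rw [h2]; exact h1
  simp only [hcd]
  simp only [rep, cdelWedge, AlternatingMap.compLinearMap_apply, AlternatingMap.domDomCongr_apply,
    AlternatingMap.alternatizeUncurryFin_apply, LinearMap.smulRight_apply,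
    AlternatingMap.smul_apply, smul_eq_mul, zsmul_eq_mul]
  refine Finset.sum_congr rfl fun i _ => ?_
  push_cast
  rfl

theorem contDiffOn_topCoeff_cdelWedge (c : ℂ) {k : ℕ} (h : k + 1 = 2 * d) {θ : M → ℝ}
    (hθ : ContMDiff 𝓘(ℝ, Cn d) 𝓘(ℝ, ℝ) ∞ θ) {a : Form d M k} (ha : a ∈ smoothForm d M k)
    {e : OpenPartialHomeomorph M (Cn d)} (he : e ∈ holAtlas d M) :
    ContDiffOn ℝ ∞ (topCoeff (cdelWedge c h θ a) e) e.target := by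
  have h1 : ContDiffOn ℝ ∞ (fun z => ∑ i : Fin (k + 1), (-1 : ℂ) ^ (i : ℕ) *
      (cdel c (fun y => (θ (e.symm y) : ℂ)) z (frame d (Fin.cast h i)) *
        rep a e z (fun j => frame d (Fin.cast h (i.succAbove j))))) e.target :=
    ContDiffOn.sum fun i _ => contDiffOn_const.mul
      ((ContDiffOn.cdel e.open_target (contDiffOn_comp_symm hθ he) _).mul (ha e he _))
  exact h1.congr fun z hz => rep_cdelWedge c h hθ a he hz _

theorem cdelWedge_eq_zero (c : ℂ) {k : ℕ} (h : k + 1 = 2 * d) {θ : M → ℝ} (a : Form d M k)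
    {x : M} (hx : x ∉ tsupport θ) : cdelWedge c h θ a x = 0 := by
  have h0 : (fun y => (θ ((chartAt (Cn d) x).symm y) : ℂ)) =ᶠ[𝓝 (chartAt (Cn d) x x)]
      fun _ => 0 := by
    have hc := (chartAt (Cn d) x).continuousAt_symm (mem_chart_target _ x)
    rw [ContinuousAt, (chartAt (Cn d) x).left_inv (mem_chart_source _ x)] at hc
    filter_upwards [hc ((isClosed_tsupport θ).isOpen_compl.mem_nhds hx)] with y hy
    rw [image_eq_zero_of_notMem_tsupport hy, Complex.ofReal_zero]
  ext v
  simp only [cdelWedge, cdel_congr h0, AlternatingMap.domDomCongr_apply,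
    AlternatingMap.alternatizeUncurryFin_apply, LinearMap.smulRight_apply, cdel_const, zero_smul,
    AlternatingMap.zero_apply, smul_zero, Finset.sum_const_zero]

theorem formIntegral_eq_zero_of_cdel [T2Space M] [CompactSpace M] (c : ℂ) {k : ℕ}
    (h : k + 1 = 2 * d) {a : Form d M k} (ha : a ∈ smoothForm d M k) {t : Form d M (2 * d)}
    (ht : t ∈ smoothForm d M (2 * d))
    (hta : ∀ e ∈ holAtlas d M, ∀ z ∈ e.target, ∀ v : Fin (2 * d) → Cn d,
      rep t e z v = ∑ i : Fin (k + 1), (-1 : ℂ) ^ (i : ℕ) *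
        cdel c (fun y => rep a e y (fun j => v (Fin.cast h (i.succAbove j)))) z
          (v (Fin.cast h i))) : formIntegral t = 0 := by
  obtain ⟨P⟩ := nonempty_chartPartition d M
  set b : Fin P.N → Form d M (2 * d) := fun j => cdelWedge c h (P.ρ j) a with hb
  have hbz : ∀ j, ∀ x ∉ (P.chart j).source, b j x = 0 := fun j x hx =>
    cdelWedge_eq_zero c h a fun hh => hx (P.subordinate j hh)
  have hbi : ∀ j, IntegrableOn (topCoeff (b j) (P.chart j)) (P.chart j).target := by
    intro j
    obtain ⟨h1, h2, h3⟩ := isCompact_image_tsupport (P.subordinate j)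
    refine integrableOn_of_zero_off (P.chart j).open_target h1 h2
      (contDiffOn_topCoeff_cdelWedge c h (P.smooth j) ha (P.chart_mem j)) fun z hz hn => ?_
    simp [topCoeff, rep, hb, cdelWedge_eq_zero c h a (h3 z hz hn)]
  have hloc : ∀ j, ∫ z in (P.chart j).target, P.density t j z = -formIntegral (b j) := by
    intro j
    rw [(formIntegral_eq_setIntegral (P.chart_mem j) (hbz j) (hbi j)).2, eq_neg_iff_add_eq_zero,
      ← integral_add (P.integrableOn_smooth ht j) (hbi j)]
    set e := P.chart j with he
    have hem : e ∈ holAtlas d M := P.chart_mem j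
    have hρ := contDiffOn_comp_symm (P.smooth j) hem
    obtain ⟨h1, h2, h3⟩ := isCompact_image_tsupport (P.subordinate j)
    set G : Fin (k + 1) → Cn d → ℂ := fun i => e.target.indicator fun y =>
      (P.ρ j (e.symm y) : ℂ) * rep a e y (fun j => frame d (Fin.cast h (i.succAbove j))) with hG
    have hGs : ∀ i, ContDiff ℝ ∞ (G i) ∧ HasCompactSupport (G i) := fun i =>
      contDiff_indicator e.open_target h1 h2 (hρ.mul (ha e hem _)) fun z hz hn => by
        rw [image_eq_zero_of_notMem_tsupport (h3 z hz hn), Complex.ofReal_zero, zero_mul]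
    have hpt : ∀ z ∈ e.target, P.density t j z + topCoeff (b j) e z =
        ∑ i : Fin (k + 1), (-1 : ℂ) ^ (i : ℕ) * cdel c (G i) z (frame d (Fin.cast h i)) := by
      intro z hz
      rw [ChartPartition.density, topCoeff, hta _ hem z hz,
        rep_cdelWedge c h (P.smooth j) a hem hz, Finset.mul_sum, ← Finset.sum_add_distrib]
      refine Finset.sum_congr rfl fun i _ => ?_
      have hGe : G i =ᶠ[𝓝 z] fun y => (P.ρ j (e.symm y) : ℂ) *
          rep a e y (fun j => frame d (Fin.cast h (i.succAbove j))) := by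
        filter_upwards [e.open_target.mem_nhds hz] with y hy using indicator_of_mem hy _
      rw [cdel_congr hGe, cdel_mul
        ((hρ.contDiffAt (e.open_target.mem_nhds hz)).differentiableAt (by simp))
        (((ha e hem _).contDiffAt (e.open_target.mem_nhds hz)).differentiableAt (by simp))]
      ring
    rw [setIntegral_congr_fun e.open_target.measurableSet hpt,
      setIntegral_eq_integral_of_forall_compl_eq_zero]
    · rw [integral_finsetSum]
      · refine Finset.sum_eq_zero fun i _ => ?_
        rw [integral_const_mul, integral_cdel_eq_zero (hGs i).1 (hGs i).2, mul_zero]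
      · intro i _
        refine Integrable.const_mul ?_ _
        have hcd : ContDiffOn ℝ ∞ (fun z => cdel c (G i) z (frame d (Fin.cast h i))) univ :=
          ContDiffOn.cdel isOpen_univ (hGs i).1.contDiffOn _
        refine (contDiffOn_univ.1 hcd).continuous.integrable_of_hasCompactSupport
          (HasCompactSupport.intro (hGs i).2 fun z hz => ?_)
        rw [cdel_congr (g := fun _ => 0) (notMem_tsupport_iff_eventuallyEq.1 hz), cdel_const]
    · intro z hz
      refine Finset.sum_eq_zero fun i _ => ?_
      rw [cdel_congr (g := fun _ => 0), cdel_const, mul_zero]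
      have : z ∉ e '' tsupport (P.ρ j) := fun hh => hz (h2 hh)
      filter_upwards [h1.isClosed.isOpen_compl.mem_nhds this] with y hy
      by_cases hyt : y ∈ e.target
      · rw [hG]; simp only
        rw [indicator_of_mem hyt, image_eq_zero_of_notMem_tsupport (h3 y hyt hy),
          Complex.ofReal_zero, zero_mul]
      · exact indicator_of_notMem hyt _
  rw [P.formIntegral_eq (P.integrableOn_smooth ht), Finset.sum_congr rfl fun j _ => hloc j,
    Finset.sum_neg_distrib, neg_eq_zero]
  have hbP := fun j => (formIntegral_eq_setIntegral (P.chart_mem j) (hbz j) (hbi j)).1 P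
  rw [Finset.sum_congr rfl fun j _ => P.formIntegral_eq (hbP j), Finset.sum_comm]
  refine Finset.sum_eq_zero fun i _ => ?_
  rw [← integral_finsetSum _ fun j _ => hbP j i]
  refine setIntegral_eq_zero_of_forall_eq_zero fun z hz => ?_
  simp only [ChartPartition.density, ← Finset.mul_sum]
  have : ∑ j, rep (b j) (P.chart i) z (frame d) = 0 := by
    simp only [hb, rep_cdelWedge c h (P.smooth _) a (P.chart_mem i) hz]
    rw [Finset.sum_comm]
    refine Finset.sum_eq_zero fun m _ => ?_
    rw [← Finset.mul_sum, ← Finset.sum_mul, ← cdel_sum]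
    · have : (fun y => ∑ j, (P.ρ j ((P.chart i).symm y) : ℂ)) = fun _ => 1 := by
        funext y
        rw [← Complex.ofReal_sum, P.sum_eq_one, Complex.ofReal_one]
      rw [this, cdel_const, zero_mul, mul_zero]
    · intro j _
      exact ((contDiffOn_comp_symm (P.smooth j) (P.chart_mem i)).contDiffAt
        ((P.chart i).open_target.mem_nhds hz)).differentiableAt (by simp)
  rw [this, mul_zero]

/-- The integral of a smooth top form depends on its Aeppli class only. -/
theorem isClassIntegral_formIntegral [T2Space M] [CompactSpace M]
    (t : smoothForm d M (2 * d)) : IsClassIntegral (aeppliClass t) (formIntegral t.1) := by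
  have hker : ∀ s ∈ imDel d M ⊔ imDelbar d M, formIntegral s.1 = 0 := by
    have hspan : ∀ S : Set (smoothForm d M (2 * d)), (∀ s ∈ S, formIntegral s.1 = 0) →
        ∀ s ∈ Submodule.span ℂ S, formIntegral s.1 = 0 := by
      intro S hS s hs
      induction hs using Submodule.span_induction with
      | mem x hx => exact hS x hx
      | zero =>
        have := formIntegral_smul 0 (zero_mem (smoothForm d M (2 * d)))
        simpa using this
      | add x y _ _ hx hy =>
        rw [Submodule.coe_add, formIntegral_add x.2 y.2, hx, hy, add_zero]
      | smul c x _ hx => rw [Submodule.coe_smul, formIntegral_smul c x.2, hx, mul_zero]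
    intro s hs
    obtain ⟨x, hx, y, hy, rfl⟩ := Submodule.mem_sup.1 hs
    rw [Submodule.coe_add, formIntegral_add x.2 y.2]
    have h1 : formIntegral x.1 = 0 := by
      refine hspan _ ?_ x hx
      rintro s ⟨k, h, a, -, hs⟩
      refine formIntegral_eq_zero_of_cdel (-Complex.I) h a.2 s.2 fun e he z hz v => ?_
      simpa only [del_eq_cdel] using hs e he z hz v
    have h2 : formIntegral y.1 = 0 := by
      refine hspan _ ?_ y hy
      rintro s ⟨k, h, a, -, hs⟩
      refine formIntegral_eq_zero_of_cdel Complex.I h a.2 s.2 fun e he z hz v => ?_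
      simpa only [delbar_eq_cdel] using hs e he z hz v
    rw [h1, h2, add_zero]
  intro s hs
  have h1 : s - t ∈ imDel d M ⊔ imDelbar d M := by
    rw [← Submodule.Quotient.eq]; exact hs
  have h2 := hker _ h1
  have h3 : s.1 = (s - t).1 + t.1 := by simp
  rw [h3, formIntegral_add (s - t).2 t.2, h2, zero_add]

end Manifold

end CxForm
end

noncomputable section

namespace CxForm

/-! ### Division of holomorphic functions by a coordinate -/

/-- An average of an analytic function over a family of linear contractions is analytic. -/
theorem analyticAt_integral_comp {E : Type*} [NormedAddCommGroup E] [NormedSpace ℂ E]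
    {h : E → ℂ} {p : E} (hh : AnalyticAt ℂ h p) {T : ℝ → E →L[ℂ] E} (hT : Continuous T)
    (hT1 : ∀ t ∈ Icc (0 : ℝ) 1, ‖T t‖ ≤ 1) :
    AnalyticAt ℂ (fun z => ∫ t in (0 : ℝ)..1, h (p + T t (z - p))) p := by
  obtain ⟨P, R, hP⟩ := hh
  obtain ⟨r, hr0, hrR⟩ := ENNReal.lt_iff_exists_nnreal_btwn.1 hP.r_pos
  have hrad : (r : ENNReal) < P.radius := hrR.trans_le hP.r_le
  have hTI : ∀ t ∈ Set.uIoc (0 : ℝ) 1, ‖T t‖ ≤ 1 := fun t ht => by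
    rw [uIoc_of_le zero_le_one] at ht
    exact hT1 t (Ioc_subset_Icc_self ht)
  have hcomp : ∀ k t, t ∈ Set.uIoc (0 : ℝ) 1 →
      ‖(P k).compContinuousLinearMap (fun _ => T t)‖ ≤ ‖P k‖ := by
    intro k t ht
    refine ((P k).norm_compContinuousLinearMap_le _).trans ?_
    refine mul_le_of_le_one_right (norm_nonneg _) ?_
    exact Finset.prod_le_one (fun _ _ => norm_nonneg _) fun _ _ => hTI t ht
  have hcont : ∀ k, Continuous fun t => (P k).compContinuousLinearMap (fun _ => T t) := by
    intro k
    have h1 := (ContinuousMultilinearMap.compContinuousLinearMapContinuousMultilinear ℂ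
      (fun _ : Fin k => E) (fun _ : Fin k => E) ℂ).cont
    exact (h1.comp (continuous_pi fun _ => hT)).clm_apply continuous_const
  refine ⟨fun k => ∫ t in (0 : ℝ)..1, (P k).compContinuousLinearMap (fun _ => T t), r, ?_, hr0, ?_⟩
  · obtain ⟨C, _, hC⟩ := P.norm_mul_pow_le_of_lt_radius hrad
    refine FormalMultilinearSeries.le_radius_of_bound _ C fun k => ?_
    refine le_trans ?_ (hC k)
    gcongr
    have := intervalIntegral.norm_integral_le_of_norm_le_const (hcomp k)
    simpa using this
  · intro y hy
    have hy' : ‖y‖ < r := by simpa [← NNReal.coe_lt_coe] using hy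
    have hint : ∀ k, (∫ t in (0 : ℝ)..1, (P k).compContinuousLinearMap (fun _ => T t))
        (fun _ => y) = ∫ t in (0 : ℝ)..1, P k (fun _ => T t y) := by
      intro k
      have := (ContinuousMultilinearMap.apply ℂ (fun _ : Fin k => E) ℂ
        (fun _ => y)).intervalIntegral_comp_comm ((hcont k).intervalIntegrable (μ := volume) 0 1)
      exact this.symm
    simp only [hint, add_sub_cancel_left]
    refine intervalIntegral.hasSum_integral_of_dominated_convergence
      (fun k _ => ‖P k‖ * ‖y‖ ^ k) ?_ ?_ ?_ ?_ ?_
    · intro k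
      refine Continuous.aestronglyMeasurable ?_
      exact (P k).cont.comp (continuous_pi fun _ => hT.clm_apply continuous_const)
    · intro k
      refine ae_of_all _ fun t ht => ?_
      refine ((P k).le_opNorm _).trans ?_
      gcongr
      rw [Finset.prod_const, Finset.card_univ, Fintype.card_fin]
      gcongr
      refine ((T t).le_opNorm y).trans ?_
      exact mul_le_of_le_one_left (norm_nonneg _) (hTI t ht)
    · refine ae_of_all _ fun t _ => ?_
      refine (P.summable_norm_mul_pow hrad).of_nonneg_of_le (fun k => by positivity) fun k => ?_
      gcongr
    · exact intervalIntegrable_const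
    · refine ae_of_all _ fun t ht => ?_
      refine hP.hasSum ?_
      have : ‖T t y‖ < r := (((T t).le_opNorm y).trans
        (mul_le_of_le_one_left (norm_nonneg _) (hTI t ht))).trans_lt hy'
      have h3 : T t y ∈ Metric.eball (0 : E) r := by simpa using this
      exact Metric.eball_subset_eball hrR.le h3

section

variable {n : ℕ}

/-- The map `z ↦ (t z₁, z')`. -/
def contract (n : ℕ) (t : ℝ) : Cn (n + 1) →L[ℂ] Cn (n + 1) :=
  ContinuousLinearMap.id ℂ _ + ((t - 1 : ℝ) : ℂ) •
    (ContinuousLinearMap.proj (R := ℂ) (0 : Fin (n + 1))).smulRight (Pi.single 0 1)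

theorem contract_apply_zero (t : ℝ) (z : Cn (n + 1)) : contract n t z 0 = t * z 0 := by
  simp [contract]; ring

theorem contract_apply_succ (t : ℝ) (z : Cn (n + 1)) (j : Fin n) :
    contract n t z j.succ = z j.succ := by
  simp [contract]

theorem contract_apply (t : ℝ) (z : Cn (n + 1)) :
    contract n t z = z + ((t : ℂ) - 1) • (z 0 • Pi.single 0 1) := by
  simp [contract]

theorem norm_contract_apply_le {t : ℝ} (ht : t ∈ Icc (0 : ℝ) 1) (z : Cn (n + 1)) :
    ‖contract n t z‖ ≤ ‖z‖ := by
  refine (pi_norm_le_iff_of_nonneg (norm_nonneg _)).2 fun i => Fin.cases ?_ (fun j => ?_) i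
  · rw [contract_apply_zero, norm_mul, Complex.norm_real, Real.norm_of_nonneg ht.1]
    exact (mul_le_of_le_one_left (norm_nonneg _) ht.2).trans (norm_le_pi_norm z 0)
  · rw [contract_apply_succ]; exact norm_le_pi_norm z j.succ

theorem exists_divide {g : Cn (n + 1) → ℂ} {p : Cn (n + 1)} (hg : AnalyticAt ℂ g p)
    (hp : p 0 = 0) (h0 : ∀ᶠ z in 𝓝 p, z 0 = 0 → g z = 0) :
    ∃ φ : Cn (n + 1) → ℂ, AnalyticAt ℂ φ p ∧ ∀ᶠ z in 𝓝 p, g z = z 0 * φ z := by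
  set e₀ : Cn (n + 1) := Pi.single 0 1 with he
  have hd : AnalyticAt ℂ (fun z => fderiv ℂ g z e₀) p :=
    ((ContinuousLinearMap.apply ℂ ℂ e₀).analyticAt _).comp hg.fderiv
  refine ⟨_, analyticAt_integral_comp hd (T := contract n) ?_ ?_, ?_⟩
  · unfold contract
    have : Continuous fun t : ℝ => ((t - 1 : ℝ) : ℂ) :=
      Complex.continuous_ofReal.comp (continuous_id.sub continuous_const)
    exact continuous_const.add (this.smul continuous_const)
  · intro t ht
    refine ContinuousLinearMap.opNorm_le_bound _ zero_le_one fun z => ?_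
    rw [one_mul]; exact norm_contract_apply_le ht z
  · obtain ⟨ε, hε, hball⟩ := Metric.eventually_nhds_iff_ball.1
      (h0.and (hg.eventually_analyticAt.and hd.eventually_analyticAt))
    filter_upwards [Metric.ball_mem_nhds p hε] with z hz
    have hmem : ∀ t ∈ Icc (0 : ℝ) 1, p + contract n t (z - p) ∈ Metric.ball p ε := by
      intro t ht
      rw [Metric.mem_ball, dist_eq_norm] at hz ⊢
      rw [add_sub_cancel_left]
      exact (norm_contract_apply_le ht _).trans_lt hz
    have hder : ∀ t ∈ uIcc (0 : ℝ) 1, HasDerivAt (fun t : ℝ => g (p + contract n t (z - p)))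
        (z 0 * fderiv ℂ g (p + contract n t (z - p)) e₀) t := by
      intro t ht
      rw [uIcc_of_le zero_le_one] at ht
      have h1 := ((hball _ (hmem t ht)).2.1.differentiableAt).hasFDerivAt.restrictScalars ℝ
      have h2 : HasDerivAt (fun t : ℝ => p + contract n t (z - p)) (z 0 • e₀) t := by
        simp only [contract_apply, Pi.sub_apply, hp, sub_zero]
        have h3 : HasDerivAt (fun t : ℝ => (t : ℂ) - 1) 1 t :=
          (Complex.ofRealCLM.hasDerivAt (x := t)).sub_const 1
        simpa using ((h3.smul_const (z 0 • e₀)).const_add (z - p)).const_add p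
      have h4 := h1.comp_hasDerivAt t h2
      simpa using! h4
    have hcont : ContinuousOn (fun t : ℝ => fderiv ℂ g (p + contract n t (z - p)) e₀)
        (uIcc (0 : ℝ) 1) := by
      intro t ht
      rw [uIcc_of_le zero_le_one] at ht
      have h1 := (hball _ (hmem t ht)).2.2.continuousAt
      refine ContinuousAt.continuousWithinAt (ContinuousAt.comp (f := fun t : ℝ =>
        p + contract n t (z - p)) h1 ?_)
      simp only [contract_apply]
      fun_prop
    have hFT := intervalIntegral.integral_eq_sub_of_hasDerivAt hder
      ((continuousOn_const.mul hcont).intervalIntegrable)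
    rw [intervalIntegral.integral_const_mul] at hFT
    have hz1 : p + contract n 1 (z - p) = z := by simp [contract_apply]
    have hz0 : g (p + contract n 0 (z - p)) = 0 := by
      refine (hball _ (hmem 0 (by simp))).1 ?_
      rw [Pi.add_apply, contract_apply_zero, hp]; simp
    rw [hz1, hz0, sub_zero] at hFT
    exact hFT.symm

theorem exists_factorization {g : Cn (n + 1) → ℂ} {p : Cn (n + 1)} (hg : AnalyticAt ℂ g p)
    (hp : p 0 = 0) (hz : ∀ᶠ z in 𝓝 p, (g z = 0 ↔ z 0 = 0)) :
    ∃ (r : ℕ) (φ : Cn (n + 1) → ℂ), AnalyticAt ℂ φ p ∧ φ p ≠ 0 ∧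
      ∀ᶠ z in 𝓝 p, g z = z 0 ^ r * φ z := by
  set S : Set ℕ := {r | ∃ φ : Cn (n + 1) → ℂ, AnalyticAt ℂ φ p ∧
      ∀ᶠ z in 𝓝 p, g z = z 0 ^ r * φ z} with hS
  have hS0 : 0 ∈ S := ⟨g, hg, Eventually.of_forall fun z => by simp⟩
  set l : ℂ → Cn (n + 1) := fun w => p + w • Pi.single 0 1 with hl
  have hl0 : l 0 = p := by simp [hl]
  have hlz : ∀ w, l w 0 = w := fun w => by simp [hl, hp]
  have hlan : AnalyticAt ℂ l 0 := by fun_prop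
  have hlt : Tendsto l (𝓝 0) (𝓝 p) := by
    have := hlan.continuousAt.tendsto
    rwa [hl0] at this
  have hbdd : BddAbove S := by
    have hγ : AnalyticAt ℂ (fun w => g (l w)) 0 := AnalyticAt.fun_comp (hl0 ▸ hg) hlan
    have hne : ¬ ∀ᶠ w in 𝓝 (0 : ℂ), g (l w) = 0 := by
      intro h
      have h1 : ∀ᶠ w in 𝓝 (0 : ℂ), w = 0 := by
        filter_upwards [h, hlt.eventually hz] with w hw hw'
        rw [← hlz w]; exact hw'.1 hw
      have h2 : ∀ᶠ w in 𝓝[≠] (0 : ℂ), False := by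
        filter_upwards [h1.filter_mono nhdsWithin_le_nhds, self_mem_nhdsWithin] with w hw hw'
        exact hw' hw
      exact (NormedField.nhdsNE_neBot (0 : ℂ)).ne (by simpa using h2)
    obtain ⟨m, u, hu, hu0, hgu⟩ := hγ.exists_eventuallyEq_pow_smul_nonzero_iff.2 hne
    refine ⟨m, ?_⟩
    rintro r ⟨φ, hφ, hgφ⟩
    by_contra hmr
    push Not at hmr
    have h1 : ∀ᶠ w in 𝓝[≠] (0 : ℂ), u w = w ^ (r - m) * φ (l w) := by
      filter_upwards [hgu.filter_mono nhdsWithin_le_nhds,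
        (hlt.eventually hgφ).filter_mono nhdsWithin_le_nhds, self_mem_nhdsWithin] with w h1 h2 hw
      have hw : w ≠ 0 := hw
      rw [h1, hlz, sub_zero, smul_eq_mul, ← Nat.add_sub_cancel' hmr.le, pow_add, mul_assoc] at h2
      exact mul_left_cancel₀ (pow_ne_zero m hw) h2
    have h2 : Tendsto (fun w => w ^ (r - m) * φ (l w)) (𝓝[≠] 0) (𝓝 (0 * φ p)) := by
      refine Tendsto.mul ?_ ?_
      · have : Tendsto (fun w : ℂ => w ^ (r - m)) (𝓝 0) (𝓝 (0 ^ (r - m))) :=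
          (continuous_pow _).tendsto 0
        rw [zero_pow (by omega)] at this
        exact this.mono_left nhdsWithin_le_nhds
      · exact (hφ.continuousAt.tendsto.comp hlt).mono_left nhdsWithin_le_nhds
    rw [zero_mul] at h2
    have h3 : Tendsto u (𝓝[≠] 0) (𝓝 (u 0)) :=
      hu.continuousAt.tendsto.mono_left nhdsWithin_le_nhds
    exact hu0 (tendsto_nhds_unique (h3.congr' h1) h2)
  obtain ⟨φ, hφ, hgφ⟩ := Nat.sSup_mem ⟨0, hS0⟩ hbdd
  refine ⟨sSup S, φ, hφ, fun hφ0 => ?_, hgφ⟩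
  by_cases hv : ∀ᶠ z in 𝓝 p, z 0 = 0 → φ z = 0
  · obtain ⟨φ', hφ', h'⟩ := exists_divide hφ hp hv
    have : sSup S + 1 ∈ S := ⟨φ', hφ', by
      filter_upwards [hgφ, h'] with z h1 h2
      rw [h1, h2, pow_succ, mul_assoc]⟩
    exact absurd (le_csSup hbdd this) (by omega)
  · rw [not_eventually] at hv
    have hgood : ∀ᶠ z in 𝓝 p, (z 0 ≠ 0 → φ z ≠ 0) ∧ AnalyticAt ℂ φ z := by
      filter_upwards [hz, hgφ, hφ.eventually_analyticAt] with z h1 h2 h3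
      exact ⟨fun h0 h4 => h0 (h1.1 (by rw [h2, h4, mul_zero])), h3⟩
    obtain ⟨ε', hε', hball'⟩ := Metric.eventually_nhds_iff_ball.1 hgood
    set ε := ε' / 2 with hε
    have hε0 : 0 < ε := by positivity
    have hball : ∀ z ∈ Metric.closedBall p ε, (z 0 ≠ 0 → φ z ≠ 0) ∧ AnalyticAt ℂ φ z :=
      fun z hz => hball' z (Metric.closedBall_subset_ball (by rw [hε]; linarith) hz)
    set C : Set (Cn (n + 1)) := Metric.closedBall p ε ∩ {z | ‖z 0‖ = ε} with hC
    have hCc : IsCompact C := (isCompact_closedBall p ε).inter_right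
      (isClosed_eq (continuous_apply 0).norm continuous_const)
    have hCne : ∀ z ∈ C, φ z ≠ 0 := by
      intro z hz
      refine (hball z hz.1).1 fun h => ?_
      have h2 : ‖z 0‖ = ε := hz.2
      rw [h, norm_zero] at h2
      exact hε0.ne h2
    obtain ⟨δ, hδ, hδC⟩ : ∃ δ > 0, ∀ z ∈ C, δ ≤ ‖φ z‖ := by
      have hcon : ContinuousOn (fun z => ‖φ z‖) C := fun z hz =>
        ((hball z hz.1).2.continuousAt.norm).continuousWithinAt
      rcases C.eq_empty_or_nonempty with hE | hN
      · exact ⟨1, one_pos, fun z hz => by simp [hE] at hz⟩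
      · obtain ⟨z₀, hz₀, hmin⟩ := hCc.exists_isMinOn hN hcon
        exact ⟨‖φ z₀‖, norm_pos_iff.2 (hCne z₀ hz₀), fun z hz => hmin hz⟩
    have hlow : ∀ z ∈ Metric.closedBall p ε, z 0 = 0 → φ z ≠ 0 → δ ≤ ‖φ z‖ := by
      intro z hzb hz0 hzne
      set k : ℂ → Cn (n + 1) := fun w => z + w • Pi.single 0 1 with hk
      have hkz : ∀ w, k w 0 = w := fun w => by simp [hk, hz0]
      have hks : ∀ w (j : Fin n), k w j.succ = z j.succ := fun w j => by simp [hk]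
      have hkmem : ∀ w ∈ Metric.closedBall (0 : ℂ) ε, k w ∈ Metric.closedBall p ε := by
        intro w hw
        rw [mem_closedBall_iff_norm] at hzb ⊢
        refine (pi_norm_le_iff_of_nonneg hε0.le).2 fun i => Fin.cases ?_ (fun j => ?_) i
        · rw [Pi.sub_apply, hkz, hp, sub_zero]; simpa using hw
        · rw [Pi.sub_apply, hks]; exact (norm_le_pi_norm (z - p) j.succ).trans hzb
      have hkne : ∀ w ∈ Metric.closedBall (0 : ℂ) ε, φ (k w) ≠ 0 := by
        intro w hw
        by_cases hw0 : w = 0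
        · rw [hw0]; simpa [hk] using hzne
        · exact (hball _ (hkmem w hw)).1 (by rwa [hkz])
      have hdiff : DifferentiableOn ℂ (fun w => (φ (k w))⁻¹) (Metric.closedBall 0 ε) := by
        intro w hw
        refine DifferentiableAt.differentiableWithinAt (DifferentiableAt.inv ?_ (hkne w hw))
        exact DifferentiableAt.comp w (hball _ (hkmem w hw)).2.differentiableAt (by fun_prop)
      have hbound := Complex.norm_le_of_forall_mem_frontier_norm_le
        (U := Metric.ball (0 : ℂ) ε) (C := δ⁻¹) Metric.isBounded_ball
        (f := fun w => (φ (k w))⁻¹) (z := 0)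
        (DifferentiableOn.diffContOnCl (hdiff.mono Metric.closure_ball_subset_closedBall)) ?_
        (subset_closure (Metric.mem_ball_self hε0))
      · have hk0 : k 0 = z := by simp [hk]
        rw [hk0, norm_inv] at hbound
        exact (inv_le_inv₀ (norm_pos_iff.2 hzne) hδ).1 hbound
      · intro w hw
        have hw' : w ∈ Metric.sphere (0 : ℂ) ε := Metric.frontier_ball_subset_sphere hw
        rw [norm_inv]
        refine inv_anti₀ hδ (hδC _ ⟨hkmem w (Metric.sphere_subset_closedBall hw'), ?_⟩)
        rw [mem_ofPred_eq, hkz]; simpa using hw'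
    have hsmall : ∀ᶠ z in 𝓝 p, ‖φ z‖ < δ := by
      refine hφ.continuousAt.norm.eventually (gt_mem_nhds ?_)
      simpa [hφ0] using hδ
    obtain ⟨z, hz1, hz2, hz3⟩ := (hv.and_eventually
      (hsmall.and (Metric.closedBall_mem_nhds p hε0))).exists
    push Not at hz1
    exact absurd (hlow z hz3 hz1.1 hz1.2) (not_le.2 hz2)

end

end CxForm
end

noncomputable section

namespace CxForm

set_option linter.unusedSectionVars false

/-! ### Slice charts and the vanishing order of a section -/

section Slice

variable {n : ℕ} {X : Type*} [TopologicalSpace X] [ChartedSpace (Cn (n + 1)) X]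
  {D : Type*}
  {ι : D → X}

theorem IsSlice.symm_mem_range {e : OpenPartialHomeomorph X (Cn (n + 1))} (he : IsSlice ι e)
    {z : Cn (n + 1)} (hz : z ∈ e.target) : e.symm z ∈ range ι ↔ z 0 = 0 := by
  rw [he.2 _ (e.map_target hz), e.right_inv hz]

theorem IsSlice.apply_zero {e : OpenPartialHomeomorph X (Cn (n + 1))} (he : IsSlice ι e)
    {p : D} (hp : ι p ∈ e.source) : e (ι p) 0 = 0 := (he.2 _ hp).1 ⟨p, rfl⟩

theorem exponent_unique {p : Cn (n + 1)} (hp : p 0 = 0) {a b : ℕ} {φ ψ : Cn (n + 1) → ℂ}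
    (hφ : ContinuousAt φ p) (hψ : ContinuousAt ψ p) (hφ0 : φ p ≠ 0) (hψ0 : ψ p ≠ 0)
    (h : ∀ᶠ z in 𝓝 p, z 0 ^ a * φ z = z 0 ^ b * ψ z) : a = b := by
  wlog hab : a ≤ b generalizing a b φ ψ
  · exact (this hψ hφ hψ0 hφ0 (h.mono fun z hz => hz.symm) (le_of_not_ge hab)).symm
  by_contra hne
  have hlt : a < b := lt_of_le_of_ne hab hne
  set l : ℂ → Cn (n + 1) := fun w => p + w • Pi.single 0 1 with hl
  have hl0 : l 0 = p := by simp [hl]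
  have hlz : ∀ w, l w 0 = w := fun w => by simp [hl, hp]
  have hlt' : Tendsto l (𝓝[≠] 0) (𝓝 p) := by
    have : Continuous l := by fun_prop
    have h1 := this.tendsto 0
    rw [hl0] at h1
    exact h1.mono_left nhdsWithin_le_nhds
  have h1 : ∀ᶠ w in 𝓝[≠] (0 : ℂ), φ (l w) = w ^ (b - a) * ψ (l w) := by
    filter_upwards [hlt'.eventually h, self_mem_nhdsWithin] with w hw hw0
    have hw0 : w ≠ 0 := hw0
    rw [hlz, ← Nat.add_sub_cancel' hab, pow_add, mul_assoc] at hw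
    exact mul_left_cancel₀ (pow_ne_zero a hw0) hw
  have h2 : Tendsto (fun w => w ^ (b - a) * ψ (l w)) (𝓝[≠] 0) (𝓝 (0 * ψ p)) := by
    refine Tendsto.mul ?_ (hψ.tendsto.comp hlt')
    have : Tendsto (fun w : ℂ => w ^ (b - a)) (𝓝 0) (𝓝 (0 ^ (b - a))) :=
      (continuous_pow _).tendsto 0
    rw [zero_pow (by omega)] at this
    exact this.mono_left nhdsWithin_le_nhds
  rw [zero_mul] at h2
  exact hφ0 (tendsto_nhds_unique ((hφ.tendsto.comp hlt').congr' h1) h2)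

theorem IsSlice.exists_factorization_coordChange
    {e e' : OpenPartialHomeomorph X (Cn (n + 1))} (he : IsSlice ι e) (he' : IsSlice ι e')
    {z : Cn (n + 1)} (hz : z ∈ e.target) (hz0 : z 0 = 0) (hz' : e.symm z ∈ e'.source) :
    ∃ (r : ℕ) (φ : Cn (n + 1) → ℂ), AnalyticAt ℂ φ z ∧ φ z ≠ 0 ∧
      ∀ᶠ y in 𝓝 z, e' (e.symm y) 0 = y 0 ^ r * φ y := by
  have hm : e.target ∩ e.symm ⁻¹' e'.source ∈ 𝓝 z := (isOpen_overlap e e').mem_nhds ⟨hz, hz'⟩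
  have h1 : AnalyticAt ℂ (fun y => e' (e.symm y)) z :=
    ((contDiffOn_coordChange he.1 he'.1).contDiffAt hm).analyticAt
  have h2 : AnalyticAt ℂ (fun y => e' (e.symm y) 0) z :=
    ((ContinuousLinearMap.proj (R := ℂ) (φ := fun _ : Fin (n + 1) => ℂ) 0).analyticAt _).comp h1
  refine exists_factorization h2 hz0 ?_
  filter_upwards [hm] with y hy
  rw [← he'.2 _ hy.2, he.symm_mem_range hy.1]

/-- The defining functions of a hypersurface in two slice charts differ by a nonvanishing
factor. -/
theorem IsSlice.exists_unit {e e' : OpenPartialHomeomorph X (Cn (n + 1))} (he : IsSlice ι e)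
    (he' : IsSlice ι e') {z : Cn (n + 1)} (hz : z ∈ e.target) (hz0 : z 0 = 0)
    (hz' : e.symm z ∈ e'.source) :
    ∃ φ : Cn (n + 1) → ℂ, AnalyticAt ℂ φ z ∧ φ z ≠ 0 ∧
      ∀ᶠ y in 𝓝 z, e' (e.symm y) 0 = y 0 * φ y := by
  obtain ⟨r, φ, hφ, hφ0, h⟩ := he.exists_factorization_coordChange he' hz hz0 hz'
  have hw : e' (e.symm z) 0 = 0 := (he'.2 _ hz').1 ((he.symm_mem_range hz).2 hz0)
  obtain ⟨m, ψ, hψ, hψ0, h'⟩ := he'.exists_factorization_coordChange he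
    (e'.map_source hz') hw (by rw [e'.left_inv hz']; exact e.map_target hz)
  have hm : e.target ∩ e.symm ⁻¹' e'.source ∈ 𝓝 z := (isOpen_overlap e e').mem_nhds ⟨hz, hz'⟩
  have hc : ContinuousAt (fun y => e' (e.symm y)) z :=
    (contDiffOn_coordChange he.1 he'.1).continuousOn.continuousAt hm
  have key : 1 = r * m := by
    refine exponent_unique (φ := fun _ => 1) (ψ := fun y => φ y ^ m * ψ (e' (e.symm y))) hz0
      continuousAt_const ((hφ.continuousAt.pow m).mul (ContinuousAt.comp (g := ψ)
        hψ.continuousAt hc)) one_ne_zero (mul_ne_zero (pow_ne_zero _ hφ0) hψ0) ?_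
    filter_upwards [hm, h, hc.tendsto.eventually h'] with y hy h1 h2
    rw [e'.left_inv hy.2, e.right_inv hy.1, h1] at h2
    rw [pow_one, mul_one, pow_mul, ← mul_assoc, ← mul_pow]
    exact h2
  have hr : r = 1 := Nat.eq_one_of_mul_eq_one_right key.symm
  exact ⟨φ, hφ, hφ0, by simpa [hr] using h⟩

end Slice

section Section

variable {n : ℕ} {X : Type*} [TopologicalSpace X]
  [ChartedSpace (Cn (n + 1)) X] [IsManifold 𝓘(ℂ, Cn (n + 1)) ω X]
  {D : Type*} [TopologicalSpace D] [ChartedSpace (Cn n) D]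
  {ι : D → X}
  {L : X → Type*} [TopologicalSpace (Bundle.TotalSpace ℂ L)]
  [∀ x, AddCommGroup (L x)] [∀ x, Module ℂ (L x)] [∀ x, TopologicalSpace (L x)]
  [FiberBundle ℂ L] [VectorBundle ℂ ℂ L] [ContMDiffVectorBundle ω ℂ L 𝓘(ℂ, Cn (n + 1))]
  {s : ∀ x, L x} {h : ∀ x, L x → ℝ}

theorem trivializationAt_eq_zero_iff (s : ∀ x, L x) (x : X) {y : X}
    (hy : y ∈ (trivializationAt ℂ L x).baseSet) :
    (trivializationAt ℂ L x ⟨y, s y⟩).2 = 0 ↔ s y = 0 := by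
  set t := trivializationAt ℂ L x
  have h1 := t.symm_proj_apply ⟨y, s y⟩ hy
  rw [← Bundle.Trivialization.symmₗ_apply (R := ℂ) t hy] at h1
  constructor
  · intro h2
    rw [h2, map_zero] at h1
    exact h1.symm
  · intro h2
    have h3 := (t.linear ℂ hy).map_smul 0 0
    rw [h2]; simpa using h3

theorem metric_eq (hh : IsMetric n h) (s : ∀ x, L x) (x : X) {y : X}
    (hy : y ∈ (trivializationAt ℂ L x).baseSet) :
    h y (s y) = ‖(trivializationAt ℂ L x ⟨y, s y⟩).2‖ * h y ((trivializationAt ℂ L x).symm y 1) ∧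
      0 < h y ((trivializationAt ℂ L x).symm y 1) := by
  set t := trivializationAt ℂ L x
  constructor
  · rw [← hh.smul]
    congr 1
    have h1 := t.symm_proj_apply ⟨y, s y⟩ hy
    rw [← Bundle.Trivialization.symmₗ_apply (R := ℂ) t hy,
      ← mul_one (t ⟨y, s y⟩).2, ← smul_eq_mul, map_smul,
      Bundle.Trivialization.symmₗ_apply (R := ℂ) t hy] at h1
    exact h1.symm
  · refine lt_of_le_of_ne (hh.nonneg _ _) fun h0 => ?_
    have h1 := t.apply_mk_symm hy 1
    have h2 := congrArg Prod.snd h1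
    have h3 := (trivializationAt_eq_zero_iff (fun y => t.symm y 1) x hy).2 (hh.eq_zero _ _ h0.symm)
    exact one_ne_zero (h2.symm.trans h3)

theorem analyticAt_section (hs : IsHolSection n s) {e : OpenPartialHomeomorph X (Cn (n + 1))}
    (he : e ∈ holAtlas (n + 1) X) {z : Cn (n + 1)} (hz : z ∈ e.target) :
    AnalyticAt ℂ (fun y => (trivializationAt ℂ L (e.symm z) ⟨e.symm y, s (e.symm y)⟩).2) z := by
  have h1 := (Bundle.contMDiffAt_section (e.symm z)).1 (hs (e.symm z))
  have h2 : ContMDiffAt 𝓘(ℂ, Cn (n + 1)) 𝓘(ℂ, Cn (n + 1)) ω e.symm z :=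
    (contMDiffOn_symm_of_mem_maximalAtlas he).contMDiffAt (e.open_target.mem_nhds hz)
  have h3 := ContMDiffAt.comp z h1 h2
  exact h3.contDiffAt.analyticAt

/-- In every slice chart a section vanishes to the order `vanishingOrder`. -/
theorem exists_vanishing (hs : IsHolSection n s) (hsD : ∀ x, s x = 0 ↔ x ∈ range ι)
    {e : OpenPartialHomeomorph X (Cn (n + 1))} (he : IsSlice ι e) {p : D} (hp : ι p ∈ e.source) :
    1 ≤ vanishingOrder n ι s p ∧
    ∃ φ : Cn (n + 1) → ℂ, AnalyticAt ℂ φ (e (ι p)) ∧ φ (e (ι p)) ≠ 0 ∧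
      ∀ᶠ y in 𝓝 (e (ι p)), (trivializationAt ℂ L (ι p) ⟨e.symm y, s (e.symm y)⟩).2 =
        y 0 ^ vanishingOrder n ι s p * φ y := by
  have hz := e.map_source hp
  have hb := FiberBundle.mem_baseSet_trivializationAt' (F := ℂ) (E := L) (ι p)
  have hsymm : e.symm (e (ι p)) = ι p := e.left_inv hp
  have hcs : ContinuousAt e.symm (e (ι p)) := e.continuousAt_symm hz
  have hev : ∀ᶠ y in 𝓝 (e (ι p)), e.symm y ∈ (trivializationAt ℂ L (ι p)).baseSet :=
    hcs.eventually_mem ((trivializationAt ℂ L (ι p)).open_baseSet.mem_nhds (hsymm.symm ▸ hb))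
  have hg := analyticAt_section (L := L) hs he.1 hz
  rw [hsymm] at hg
  obtain ⟨r, φ, hφ, hφ0, hgφ⟩ := exists_factorization hg (he.apply_zero hp) (by
    filter_upwards [hev, e.open_target.mem_nhds hz] with y hy hy'
    rw [trivializationAt_eq_zero_iff s _ hy, hsD, he.symm_mem_range hy'])
  have hr : 1 ≤ r := by
    by_contra hr0
    have h1 := hgφ.self_of_nhds
    rw [hsymm, (trivializationAt_eq_zero_iff s (ι p) hb).2 ((hsD _).2 ⟨p, rfl⟩),
      Nat.lt_one_iff.1 (not_le.1 hr0), pow_zero, one_mul] at h1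
    exact hφ0 h1.symm
  have hmem : VanishesToOrder n ι s p r := by
    refine ⟨e, he, hp, fun y => φ (e y), ?_, hφ0, ?_⟩
    · have h1 : ContMDiffAt 𝓘(ℂ, Cn (n + 1)) 𝓘(ℂ, Cn (n + 1)) ω e (ι p) :=
        (contMDiffOn_of_mem_maximalAtlas he.1).contMDiffAt (e.open_source.mem_nhds hp)
      exact ContMDiffAt.comp (ι p) hφ.contDiffAt.contMDiffAt h1
    · filter_upwards [(e.continuousAt hp).eventually hgφ, e.open_source.mem_nhds hp] with y hy hy'
      rw [e.left_inv hy'] at hy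
      exact hy
  have hv : vanishingOrder n ι s p = r := by
    obtain ⟨e', he', hp', φ', hφ', hφ'0, hgφ'⟩ := Nat.sInf_mem (s := {r | VanishesToOrder n ι s p r})
      ⟨r, hmem⟩
    change ∀ᶠ y in 𝓝 (ι p), (trivializationAt ℂ L (ι p) ⟨y, s y⟩).2 =
      e' y 0 ^ vanishingOrder n ι s p * φ' y at hgφ'
    obtain ⟨u, hu, hu0, hue⟩ := he.exists_unit he' hz (he.apply_zero hp) (by rwa [hsymm])
    refine exponent_unique (he.apply_zero hp) (φ := fun y => u y ^ vanishingOrder n ι s p *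
      φ' (e.symm y)) (ψ := φ) ?_ hφ.continuousAt
      (mul_ne_zero (pow_ne_zero _ hu0) (by rwa [hsymm])) hφ0 ?_
    · refine (hu.continuousAt.pow _).mul (ContinuousAt.comp (g := φ') ?_ hcs)
      rw [hsymm]; exact hφ'.continuousAt
    · have hcs' : Tendsto e.symm (𝓝 (e (ι p))) (𝓝 (ι p)) := by
        have := hcs.tendsto; rwa [hsymm] at this
      filter_upwards [hcs'.eventually hgφ', hgφ, hue] with y h1 h2 h3
      rw [h2, h3, mul_pow, mul_assoc] at h1
      exact h1.symm
  rw [hv]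
  exact ⟨hr, φ, hφ, hφ0, hgφ⟩

/-- In a slice chart, `|s| = |z₁|^r e^v` with `v` smooth. -/
theorem exists_metric_eq_exp (hs : IsHolSection n s) (hsD : ∀ x, s x = 0 ↔ x ∈ range ι)
    (hι : Function.Injective ι) (hh : IsMetric n h)
    {e : OpenPartialHomeomorph X (Cn (n + 1))} (he : IsSlice ι e) {z : Cn (n + 1)}
    (hz : z ∈ e.target) :
    ∃ r : ℕ, 1 ≤ r ∧ (∀ p, ι p = e.symm z → r = vanishingOrder n ι s p) ∧
      ∃ (v : Cn (n + 1) → ℝ) (U : Set (Cn (n + 1))), IsOpen U ∧ z ∈ U ∧ U ⊆ e.target ∧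
        ContDiffOn ℝ ∞ v U ∧
        ∀ y ∈ U, h (e.symm y) (s (e.symm y)) = ‖y 0‖ ^ r * Real.exp (v y) := by
  have hb := FiberBundle.mem_baseSet_trivializationAt' (F := ℂ) (E := L) (e.symm z)
  have hev : ∀ᶠ y in 𝓝 z, e.symm y ∈ (trivializationAt ℂ L (e.symm z)).baseSet :=
    (e.continuousAt_symm hz).eventually_mem
      ((trivializationAt ℂ L (e.symm z)).open_baseSet.mem_nhds hb)
  have main : ∀ (r : ℕ) (φ : Cn (n + 1) → ℂ), AnalyticAt ℂ φ z → φ z ≠ 0 →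
      (∀ᶠ y in 𝓝 z, (trivializationAt ℂ L (e.symm z) ⟨e.symm y, s (e.symm y)⟩).2 =
        y 0 ^ r * φ y) →
      ∃ (v : Cn (n + 1) → ℝ) (U : Set (Cn (n + 1))), IsOpen U ∧ z ∈ U ∧ U ⊆ e.target ∧
        ContDiffOn ℝ ∞ v U ∧
        ∀ y ∈ U, h (e.symm y) (s (e.symm y)) = ‖y 0‖ ^ r * Real.exp (v y) := by
    intro r φ hφ hφ0 hgφ
    set H : Cn (n + 1) → ℝ :=
      fun y => h (e.symm y) ((trivializationAt ℂ L (e.symm z)).symm (e.symm y) 1) with hHdef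
    have hφr : ContDiffAt ℝ ∞ φ z := (hφ.contDiffAt.restrict_scalars ℝ)
    have hev2 : ∀ᶠ y in 𝓝 z, AnalyticAt ℂ φ y ∧ φ y ≠ 0 ∧ ContDiffAt ℝ ∞ H y ∧
        y ∈ e.target ∧ e.symm y ∈ (trivializationAt ℂ L (e.symm z)).baseSet ∧
        (trivializationAt ℂ L (e.symm z) ⟨e.symm y, s (e.symm y)⟩).2 = y 0 ^ r * φ y := by
      have hH' : ∀ᶠ y in 𝓝 z, ContDiffAt ℝ ∞ H y := by
        have h1 := (hh.smooth (trivializationAt ℂ L (e.symm z)))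
        have := isManifold_real (n + 1) X
        filter_upwards [hev, e.open_target.mem_nhds hz] with y hy hy'
        have h2 := h1.contMDiffAt ((trivializationAt ℂ L (e.symm z)).open_baseSet.mem_nhds hy)
        have h3 : ContMDiffAt 𝓘(ℝ, Cn (n + 1)) 𝓘(ℝ, Cn (n + 1)) ∞ e.symm y :=
          (contMDiffOn_symm_of_mem_maximalAtlas (mem_maximalAtlas_real he.1)).contMDiffAt
            (e.open_target.mem_nhds hy')
        exact (ContMDiffAt.comp y h2 h3).contDiffAt
      exact hφ.eventually_analyticAt.and ((hφ.continuousAt.eventually_ne hφ0).and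
        (hH'.and ((e.open_target.eventually_mem hz).and (hev.and hgφ))))
    obtain ⟨U, hU, hUo, hzU⟩ := mem_nhds_iff.1 hev2
    refine ⟨fun y => Real.log (‖φ y‖ * H y), U, hUo, hzU, fun y hy => (hU hy).2.2.2.1, ?_, ?_⟩
    · intro y hy
      obtain ⟨h1, h2, h3, h4, h5, h6⟩ := hU hy
      refine ContDiffAt.contDiffWithinAt (ContDiffAt.log ?_ ?_)
      · exact ContDiffAt.mul (ContDiffAt.norm ℝ (h1.contDiffAt.restrict_scalars ℝ) h2) h3
      · exact (mul_pos (norm_pos_iff.2 h2) (metric_eq hh s (e.symm z) h5).2).ne'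
    · intro y hy
      obtain ⟨h1, h2, h3, h4, h5, h6⟩ := hU hy
      obtain ⟨h7, h8⟩ := metric_eq hh s (e.symm z) h5
      rw [Real.exp_log (mul_pos (norm_pos_iff.2 h2) h8), h7, h6, norm_mul, norm_pow, mul_assoc]
  by_cases hzD : e.symm z ∈ range ι
  · obtain ⟨p, hp⟩ := hzD
    have hps : ι p ∈ e.source := hp ▸ e.map_target hz
    have hep : e (ι p) = z := by rw [hp, e.right_inv hz]
    obtain ⟨h1, φ, hφ, hφ0, hg⟩ := exists_vanishing hs hsD he hps
    rw [hep] at hφ hφ0 hg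
    rw [hp] at hg
    refine ⟨vanishingOrder n ι s p, h1, fun q hq => ?_, main _ φ hφ hφ0 hg⟩
    rw [hι (hq.trans hp.symm)]
  · have hz0 : z 0 ≠ 0 := fun h0 => hzD ((he.symm_mem_range hz).2 h0)
    refine ⟨1, le_rfl, fun p hp => absurd ⟨p, hp⟩ hzD, main 1
      (fun y => (trivializationAt ℂ L (e.symm z) ⟨e.symm y, s (e.symm y)⟩).2 / y 0) ?_ ?_ ?_⟩
    · exact (analyticAt_section (L := L) hs he.1 hz).div
        ((ContinuousLinearMap.proj (R := ℂ) (φ := fun _ : Fin (n + 1) => ℂ) 0).analyticAt _) hz0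
    · refine div_ne_zero ?_ hz0
      rw [Ne, trivializationAt_eq_zero_iff s _ hb, hsD]
      exact hzD
    · filter_upwards [(continuous_apply (A := fun _ : Fin (n + 1) => ℂ) 0).continuousAt.eventually_ne hz0] with y hy
      rw [pow_one, mul_div_cancel₀ _ hy]

end Section

end CxForm
end

noncomputable section

namespace CxForm

set_option linter.unusedSectionVars false

/-! ### The residue of a regularized integral in a slice chart -/

section ChartResidue

variable {n : ℕ}

theorem iterate_dz₁_prop {f : Cn (n + 1) → ℂ} (hf : ContDiff ℝ ∞ f) (hc : HasCompactSupport f)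
    (N : ℕ) : ContDiff ℝ ∞ (dz₁^[N] f) ∧ HasCompactSupport (dz₁^[N] f) := by
  have h := (Adm.const hf hc).iterate_dz₁ contDiff_const N
  exact ⟨h.contDiff contDiff_const 0, h.hasCompactSupport 0⟩

theorem iterate_dzbar₁_prop {f : Cn (n + 1) → ℂ} (hf : ContDiff ℝ ∞ f) (hc : HasCompactSupport f)
    (N : ℕ) : ContDiff ℝ ∞ (dzbar₁^[N] f) ∧ HasCompactSupport (dzbar₁^[N] f) := by
  have h := (Adm.const hf hc).iterate_dzbar₁ contDiff_const N
  exact ⟨h.contDiff contDiff_const 0, h.hasCompactSupport 0⟩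

theorem dz₁_sum {α : Type*} (s : Finset α) {f : α → Cn (n + 1) → ℂ}
    (hf : ∀ i, ContDiff ℝ ∞ (f i)) :
    dz₁ (fun z => ∑ i ∈ s, f i z) = fun z => ∑ i ∈ s, dz₁ (f i) z := by
  funext z
  have h : fderiv ℝ (fun z => ∑ i ∈ s, f i z) z = ∑ i ∈ s, fderiv ℝ (f i) z :=
    fderiv_fun_sum fun i _ => ((hf i).differentiable (by simp)).differentiableAt
  simp only [dz₁, del, h, sum_apply, Finset.mul_sum,
    ← Finset.sum_sub_distrib, Finset.sum_div]

theorem dzbar₁_sum {α : Type*} (s : Finset α) {f : α → Cn (n + 1) → ℂ}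
    (hf : ∀ i, ContDiff ℝ ∞ (f i)) :
    dzbar₁ (fun z => ∑ i ∈ s, f i z) = fun z => ∑ i ∈ s, dzbar₁ (f i) z := by
  funext z
  have h : fderiv ℝ (fun z => ∑ i ∈ s, f i z) z = ∑ i ∈ s, fderiv ℝ (f i) z :=
    fderiv_fun_sum fun i _ => ((hf i).differentiable (by simp)).differentiableAt
  simp only [dzbar₁, delbar, h, sum_apply, Finset.mul_sum,
    ← Finset.sum_add_distrib, Finset.sum_div]

theorem iterate_dz₁_sum {α : Type*} (s : Finset α) {f : α → Cn (n + 1) → ℂ}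
    (hf : ∀ i, ContDiff ℝ ∞ (f i)) (hc : ∀ i, HasCompactSupport (f i)) (N : ℕ) :
    dz₁^[N] (fun z => ∑ i ∈ s, f i z) = fun z => ∑ i ∈ s, (dz₁^[N] (f i)) z := by
  induction N with
  | zero => rfl
  | succ N ih =>
    simp only [Function.iterate_succ_apply', ih]
    exact dz₁_sum s fun i => (iterate_dz₁_prop (hf i) (hc i) N).1

theorem iterate_dzbar₁_sum {α : Type*} (s : Finset α) {f : α → Cn (n + 1) → ℂ}
    (hf : ∀ i, ContDiff ℝ ∞ (f i)) (hc : ∀ i, HasCompactSupport (f i)) (N : ℕ) :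
    dzbar₁^[N] (fun z => ∑ i ∈ s, f i z) = fun z => ∑ i ∈ s, (dzbar₁^[N] (f i)) z := by
  induction N with
  | zero => rfl
  | succ N ih =>
    simp only [Function.iterate_succ_apply', ih]
    exact dzbar₁_sum s fun i => (iterate_dzbar₁_prop (hf i) (hc i) N).1

/-- The integral over `z₁ = 0` of `1/(a! b!) ∂^{a+b} f / ∂z₁^a ∂z̄₁^b`. -/
def sliceResidue (a b : ℕ) (f : Cn (n + 1) → ℂ) : ℂ :=
  (1 / (a.factorial * b.factorial : ℂ)) *
    ∫ y : Cn n, (dz₁^[a] (dzbar₁^[b] f)) (Fin.cons 0 y)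

theorem sliceResidue_sum {α : Type*} (s : Finset α) {f : α → Cn (n + 1) → ℂ}
    (hf : ∀ i, ContDiff ℝ ∞ (f i)) (hc : ∀ i, HasCompactSupport (f i)) (a b : ℕ) :
    sliceResidue a b (fun z => ∑ i ∈ s, f i z) = ∑ i ∈ s, sliceResidue a b (f i) := by
  have h1 := fun i => iterate_dzbar₁_prop (hf i) (hc i) b
  have h2 := fun i => iterate_dz₁_prop (h1 i).1 (h1 i).2 a
  simp only [sliceResidue]
  rw [iterate_dzbar₁_sum s hf hc, iterate_dz₁_sum s (fun i => (h1 i).1) fun i => (h1 i).2,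
    integral_finsetSum s fun i _ => integrable_comp_cons (h2 i).1.continuous (h2 i).2,
    Finset.mul_sum]

theorem fderiv_coord (z u : Cn (n + 1)) :
    fderiv ℝ (fun z : Cn (n + 1) => z 0) z u = u 0 := by
  have : HasFDerivAt (fun z : Cn (n + 1) => z 0)
    (ContinuousLinearMap.proj (R := ℝ) (0 : Fin (n + 1))) z :=
    (ContinuousLinearMap.proj (R := ℝ) (φ := fun _ : Fin (n + 1) => ℂ) 0).hasFDerivAt
  rw [this.fderiv]; rfl

theorem fderiv_conj_coord (z u : Cn (n + 1)) :
    fderiv ℝ (fun z : Cn (n + 1) => starRingEnd ℂ (z 0)) z u = starRingEnd ℂ (u 0) := by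
  have : HasFDerivAt (fun z : Cn (n + 1) => starRingEnd ℂ (z 0))
    (Complex.conjCLE.toContinuousLinearMap.comp
      (ContinuousLinearMap.proj (R := ℝ) (φ := fun _ : Fin (n + 1) => ℂ) 0)) z :=
    (Complex.conjCLE.toContinuousLinearMap.comp
      (ContinuousLinearMap.proj (R := ℝ) (φ := fun _ : Fin (n + 1) => ℂ) 0)).hasFDerivAt
  rw [this.fderiv]; rfl

theorem contDiff_coord : ContDiff ℝ ∞ fun z : Cn (n + 1) => z 0 := contDiff_apply ℝ ℂ 0

theorem contDiff_conj_coord : ContDiff ℝ ∞ fun z : Cn (n + 1) => starRingEnd ℂ (z 0) :=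
  Complex.conjCLE.contDiff.comp contDiff_coord

theorem dzbar₁_coord_mul {f : Cn (n + 1) → ℂ} (hf : ContDiff ℝ ∞ f) :
    dzbar₁ (fun z => z 0 * f z) = fun z => z 0 * dzbar₁ f z := by
  funext z
  have h := cdel_mul (c := Complex.I) (z := z)
    ((contDiff_coord (n := n)).differentiable (by simp)).differentiableAt
    (hf.differentiable (by simp)).differentiableAt (Pi.single 0 1)
  have h0 : cdel Complex.I (fun z : Cn (n + 1) => z 0) z (Pi.single 0 1) = 0 := by
    simp [cdel, fderiv_coord]
  simp only [dzbar₁, delbar_eq_cdel]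
  rw [h, h0]; ring

theorem dz₁_conj_coord_mul {f : Cn (n + 1) → ℂ} (hf : ContDiff ℝ ∞ f) :
    dz₁ (fun z => starRingEnd ℂ (z 0) * f z) = fun z => starRingEnd ℂ (z 0) * dz₁ f z := by
  funext z
  have h := cdel_mul (c := -Complex.I) (z := z)
    ((contDiff_conj_coord (n := n)).differentiable (by simp)).differentiableAt
    (hf.differentiable (by simp)).differentiableAt (Pi.single 0 1)
  have h0 : cdel (-Complex.I) (fun z : Cn (n + 1) => starRingEnd ℂ (z 0)) z (Pi.single 0 1) = 0 := by
    simp [cdel, fderiv_conj_coord]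
  simp only [dz₁, del_eq_cdel]
  rw [h, h0]; ring

theorem sliceResidue_coord_mul {f : Cn (n + 1) → ℂ} (hf : ContDiff ℝ ∞ f)
    (hc : HasCompactSupport f) (b : ℕ) : sliceResidue 0 b (fun z => z 0 * f z) = 0 := by
  have h : dzbar₁^[b] (fun z => z 0 * f z) = fun z => z 0 * (dzbar₁^[b] f) z := by
    induction b with
    | zero => rfl
    | succ b ih =>
      simp only [Function.iterate_succ_apply', ih]
      exact dzbar₁_coord_mul (iterate_dzbar₁_prop hf hc b).1
  simp [sliceResidue, h]

theorem sliceResidue_conj_coord_mul {f : Cn (n + 1) → ℂ} (hf : ContDiff ℝ ∞ f)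
    (hc : HasCompactSupport f) (a : ℕ) :
    sliceResidue a 0 (fun z => starRingEnd ℂ (z 0) * f z) = 0 := by
  have h : dz₁^[a] (fun z => starRingEnd ℂ (z 0) * f z) =
      fun z => starRingEnd ℂ (z 0) * (dz₁^[a] f) z := by
    induction a with
    | zero => rfl
    | succ a ih =>
      simp only [Function.iterate_succ_apply', ih]
      exact dz₁_conj_coord_mul (iterate_dz₁_prop hf hc a).1
  simp [sliceResidue, h]

theorem exists_contDiff_cutoff {U K : Set (Cn (n + 1))} (hK : IsCompact K) (hU : IsOpen U)
    (hKU : K ⊆ U) : ∃ χ : Cn (n + 1) → ℝ, ContDiff ℝ ∞ χ ∧ (∀ z ∈ K, χ z = 1) ∧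
      ∃ K' : Set (Cn (n + 1)), IsCompact K' ∧ K' ⊆ U ∧ ∀ z ∉ K', χ z = 0 := by
  obtain ⟨K', hK', h1, h2⟩ := exists_compact_between hK hU hKU
  obtain ⟨f, hf1, hf0, -⟩ := exists_contMDiffMap_one_nhds_of_subset_interior 𝓘(ℝ, Cn (n + 1))
    (n := ((⊤ : ℕ∞) : ℕ∞)) hK.isClosed h1
  exact ⟨f, f.contMDiff.contDiff, fun z hz => hf1.self_of_nhdsSet z hz, K', hK', h2, hf0⟩

theorem exists_contDiff_extension {U K : Set (Cn (n + 1))} (hK : IsCompact K) (hU : IsOpen U)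
    (hKU : K ⊆ U) {v : Cn (n + 1) → ℂ} (hv : ContDiffOn ℝ ∞ v U) :
    ∃ V : Cn (n + 1) → ℂ, ContDiff ℝ ∞ V ∧ ∀ z ∈ K, V z = v z := by
  obtain ⟨χ, hχ, h1, K', hK', hK'U, h0⟩ := exists_contDiff_cutoff hK hU hKU
  have h := contDiff_indicator hU hK' hK'U (F := fun z => (χ z : ℂ) * v z)
    ((Complex.ofRealCLM.contDiff.comp hχ).contDiffOn.mul hv)
    fun z _ hz => by rw [h0 z hz]; simp
  exact ⟨_, h.1, fun z hz => by rw [indicator_of_mem (hKU hz), h1 z hz]; simp⟩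

theorem cpow_eq_kern {x u r : ℝ} {w : ℂ} (hx : ‖w‖ = x) (hw : w ≠ 0) {k : ℕ} (hk : (k : ℝ) = r)
    (l : ℂ) :
    ((x ^ k * Real.exp u : ℝ) : ℂ) ^ (2 * l) =
      (x : ℂ) ^ (2 * (r * l)) * Complex.exp (l * (2 * u : ℝ)) := by
  have hx0 : 0 < x := hx ▸ norm_pos_iff.2 hw
  have hpos : 0 < x ^ k * Real.exp u := by positivity
  rw [Complex.cpow_def_of_ne_zero (by exact_mod_cast hpos.ne'),
    Complex.cpow_def_of_ne_zero (by exact_mod_cast hx0.ne'), ← Complex.exp_add,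
    ← Complex.ofReal_log hpos.le, ← Complex.ofReal_log hx0.le,
    Real.log_mul (by positivity) (Real.exp_ne_zero _), Real.log_pow, Real.log_exp, hk]
  congr 1; push_cast; ring

/-- The integrand `N^{2λ} f / (z₁^{a+1} z̄₁^{b+1})`. -/
def regIntegrand (N : Cn (n + 1) → ℝ) (a b : ℕ) (f : Cn (n + 1) → ℂ) (l : ℂ)
    (z : Cn (n + 1)) : ℂ :=
  (N z : ℂ) ^ (2 * l) * (f z / (z 0 ^ (a + 1) * starRingEnd ℂ (z 0) ^ (b + 1)))

theorem hasResidue_patch {N : Cn (n + 1) → ℝ} {v : Cn (n + 1) → ℝ} {U : Set (Cn (n + 1))}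
    (hU : IsOpen U) (hv : ContDiffOn ℝ ∞ v U) {r : ℕ} (hr : 1 ≤ r)
    (hN : ∀ z ∈ U, N z = ‖z 0‖ ^ r * Real.exp (v z)) {f : Cn (n + 1) → ℂ} (hf : ContDiff ℝ ∞ f)
    (hc : HasCompactSupport f) (hfU : tsupport f ⊆ U) (a b : ℕ) :
    HasResidue (fun l => ∫ z, regIntegrand N a b f l z) (Real.pi / r * sliceResidue a b f) ∧
      ∃ R : ℝ, ∀ l : ℂ, R < l.re → Integrable (regIntegrand N a b f l) := by
  obtain ⟨V, hV, hVv⟩ := exists_contDiff_extension hc hU hfU (v := fun z => ((2 * v z : ℝ) : ℂ))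
    (Complex.ofRealCLM.contDiff.comp_contDiffOn (contDiffOn_const.mul hv))
  have hr0 : (0 : ℝ) < r := by exact_mod_cast hr
  have key : ∀ l : ℂ, (fun z => kern ((r : ℝ) * l) (-(a + 1 : ℤ)) (-(b + 1 : ℤ)) z *
      (Complex.exp (l * V z) * f z)) =ᵐ[volume] regIntegrand N a b f l := by
    intro l
    filter_upwards [ae_ne_zero] with z hz
    by_cases hzs : z ∈ tsupport f
    · rw [regIntegrand, hN z (hfU hzs), cpow_eq_kern rfl hz rfl, hVv z hzs, kern]
      have h1 : z 0 ^ (-(a + 1 : ℤ)) = (z 0 ^ (a + 1))⁻¹ := by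
        rw [zpow_neg]; norm_cast
      have h2 : starRingEnd ℂ (z 0) ^ (-(b + 1 : ℤ)) = (starRingEnd ℂ (z 0) ^ (b + 1))⁻¹ := by
        rw [zpow_neg]; norm_cast
      rw [h1, h2, div_eq_mul_inv, mul_inv]; ring
    · rw [regIntegrand, image_eq_zero_of_notMem_tsupport hzs]; simp
  refine ⟨?_, ((a + b : ℝ) / r), fun l hl => ?_⟩
  · have h := hasResidue_integral_kern hV hf hc a b hr0
    refine h.congr 0 fun l _ => integral_congr_ae ?_
    simpa using key l
  · refine (integrable_kern_mul (f := fun z => Complex.exp (l * V z) * f z) ?_ hc.mul_left ?_).congr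
      (key l)
    · have := hV.continuous
      have := hf.continuous
      fun_prop
    · rw [div_lt_iff₀ hr0] at hl
      have h1 : ((r : ℝ) * l : ℂ).re = r * l.re := Complex.re_ofReal_mul _ _
      rw [h1]; push_cast
      nlinarith

/-- A form with coefficient `f / (z₁^{a+1} z̄₁^{b+1})` has on `U` no holomorphic, or no
antiholomorphic, pole. -/
def NoDoublePole (a b : ℕ) (f : Cn (n + 1) → ℂ) (U : Set (Cn (n + 1))) : Prop :=
  ∃ (c : ℕ) (t : Cn (n + 1) → ℂ), ContDiffOn ℝ ∞ t U ∧
    ((∀ z ∈ U, z 0 ≠ 0 → f z / (z 0 ^ (a + 1) * starRingEnd ℂ (z 0) ^ (b + 1)) =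
        t z / starRingEnd ℂ (z 0) ^ c) ∨
      ∀ z ∈ U, z 0 ≠ 0 → f z / (z 0 ^ (a + 1) * starRingEnd ℂ (z 0) ^ (b + 1)) = t z / z 0 ^ c)

theorem sliceResidue_eq_zero {N : Cn (n + 1) → ℝ} {v : Cn (n + 1) → ℝ} {U : Set (Cn (n + 1))}
    (hU : IsOpen U) (hv : ContDiffOn ℝ ∞ v U) {r : ℕ} (hr : 1 ≤ r)
    (hN : ∀ z ∈ U, N z = ‖z 0‖ ^ r * Real.exp (v z)) {f : Cn (n + 1) → ℂ} (hf : ContDiff ℝ ∞ f)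
    (hc : HasCompactSupport f) (hfU : tsupport f ⊆ U) {a b : ℕ} (h : NoDoublePole a b f U) :
    sliceResidue a b f = 0 := by
  obtain ⟨c, t, ht, h⟩ := h
  obtain ⟨χ, hχ, hχ1, K', hK', hK'U, hχ0⟩ := exists_contDiff_cutoff hc hU hfU
  have hr0 : (r : ℂ) ≠ 0 := by exact_mod_cast (by omega : r ≠ 0)
  obtain ⟨hg, hgc⟩ := contDiff_indicator hU hK' hK'U (F := fun z => (χ z : ℂ) * t z)
    ((Complex.ofRealCLM.contDiff.comp hχ).contDiffOn.mul ht)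
    fun z _ hz => by rw [hχ0 z hz]; simp
  set g : Cn (n + 1) → ℂ := U.indicator fun z => (χ z : ℂ) * t z with hgdef
  have hgK : tsupport g ⊆ U := by
    refine (closure_minimal (fun z hz => ?_) hK'.isClosed).trans hK'U
    by_contra hzK
    refine hz ?_
    by_cases hzU : z ∈ U
    · rw [hgdef, indicator_of_mem hzU, hχ0 z hzK]; simp
    · rw [hgdef, indicator_of_notMem hzU]
  have hgf : ∀ (q : Cn (n + 1) → ℂ), (∀ z ∈ U, z 0 ≠ 0 → q z ≠ 0) →
      (∀ z ∈ U, z 0 ≠ 0 → f z / (z 0 ^ (a + 1) * starRingEnd ℂ (z 0) ^ (b + 1)) = t z / q z) →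
      ∀ z, z 0 ≠ 0 → f z / (z 0 ^ (a + 1) * starRingEnd ℂ (z 0) ^ (b + 1)) = g z / q z := by
    intro q hq hfq z hz
    by_cases hzU : z ∈ U
    · rw [hgdef, indicator_of_mem hzU, hfq z hzU hz]
      by_cases hzs : z ∈ tsupport f
      · rw [hχ1 z hzs]; simp
      · have h1 := hfq z hzU hz
        rw [image_eq_zero_of_notMem_tsupport hzs, zero_div, eq_comm,
          div_eq_zero_iff, or_iff_left (hq z hzU hz)] at h1
        rw [h1, mul_zero]
    · rw [hgdef, indicator_of_notMem hzU,
        image_eq_zero_of_notMem_tsupport fun h => hzU (hfU h), zero_div, zero_div]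
  have main : ∀ (f' : Cn (n + 1) → ℂ) (a' b' : ℕ), ContDiff ℝ ∞ f' → HasCompactSupport f' →
      tsupport f' ⊆ U → sliceResidue a' b' f' = 0 →
      (∀ z, z 0 ≠ 0 → f z / (z 0 ^ (a + 1) * starRingEnd ℂ (z 0) ^ (b + 1)) =
        f' z / (z 0 ^ (a' + 1) * starRingEnd ℂ (z 0) ^ (b' + 1))) → sliceResidue a b f = 0 := by
    intro f' a' b' hf' hc' hfU' h0 heq
    have h1 := (hasResidue_patch hU hv hr hN hf hc hfU a b).1
    have h2 := (hasResidue_patch hU hv hr hN hf' hc' hfU' a' b').1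
    have h3 := h1.unique (h2.congr 0 fun l _ => integral_congr_ae (by
      filter_upwards [ae_ne_zero] with z hz
      rw [regIntegrand, regIntegrand, heq z hz]))
    rw [h0, mul_zero, mul_eq_zero, or_iff_right] at h3
    · exact h3
    · exact div_ne_zero (by exact_mod_cast Real.pi_ne_zero) hr0
  have hm : ContDiff ℝ ∞ fun z => starRingEnd ℂ (z 0) * g z := contDiff_conj_coord.mul hg
  have hm' : ContDiff ℝ ∞ fun z => z 0 * g z := contDiff_coord.mul hg
  rcases h with h | h
  · refine main (fun z => z 0 * (starRingEnd ℂ (z 0) * g z)) 0 c (contDiff_coord.mul hm)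
      hgc.mul_left.mul_left (((tsupport_mul_subset_right).trans
        tsupport_mul_subset_right).trans hgK) (sliceResidue_coord_mul hm hgc.mul_left c) ?_
    intro z hz
    have hz' : starRingEnd ℂ (z 0) ≠ 0 := (map_ne_zero _).2 hz
    rw [hgf (fun z => starRingEnd ℂ (z 0) ^ c)
      (fun z _ hz => pow_ne_zero _ ((map_ne_zero _).2 hz)) h z hz]
    field_simp
    ring
  · refine main (fun z => starRingEnd ℂ (z 0) * (z 0 * g z)) c 0 (contDiff_conj_coord.mul hm')
      hgc.mul_left.mul_left (((tsupport_mul_subset_right).trans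
        tsupport_mul_subset_right).trans hgK) (sliceResidue_conj_coord_mul hm' hgc.mul_left c) ?_
    intro z hz
    have hz' : starRingEnd ℂ (z 0) ≠ 0 := (map_ne_zero _).2 hz
    rw [hgf (fun z => z 0 ^ c) (fun z _ hz => pow_ne_zero _ hz) h z hz]
    field_simp
    ring

/-- The residue of a regularized integral in a slice chart, provided that the metric vanishes to
the fixed order `o` wherever there is a double pole. -/
theorem hasResidue_chart {N : Cn (n + 1) → ℝ} {T : Set (Cn (n + 1))} {f : Cn (n + 1) → ℂ}
    (hf : ContDiff ℝ ∞ f) (hc : HasCompactSupport f) (hfT : tsupport f ⊆ T) (a b o : ℕ)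
    (h : ∀ z ∈ T, ∃ (r : ℕ) (v : Cn (n + 1) → ℝ) (U : Set (Cn (n + 1))), 1 ≤ r ∧ IsOpen U ∧
      z ∈ U ∧ ContDiffOn ℝ ∞ v U ∧ (∀ y ∈ U, N y = ‖y 0‖ ^ r * Real.exp (v y)) ∧
      (r = o ∨ NoDoublePole a b f U)) :
    HasResidue (fun l => ∫ z, regIntegrand N a b f l z) (Real.pi / o * sliceResidue a b f) ∧
      ∃ R : ℝ, ∀ l : ℂ, R < l.re → Integrable (regIntegrand N a b f l) := by
  choose! r v U hr hU hzU hv hN hP using h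
  obtain ⟨t, htK, ht⟩ := hc.isCompact.elim_nhds_subcover U
    fun z hz => (hU z (hfT hz)).mem_nhds (hzU z (hfT hz))
  obtain ⟨χ, hχ⟩ := SmoothPartitionOfUnity.exists_isSubordinate 𝓘(ℝ, Cn (n + 1))
    (isClosed_tsupport f) (fun i : t => U i) (fun i => hU i (hfT (htK i i.2)))
    (by
      intro x hx
      have := ht hx
      simp only [mem_iUnion] at this ⊢
      obtain ⟨y, hy, hxy⟩ := this
      exact ⟨⟨y, hy⟩, hxy⟩)
  set g : t → Cn (n + 1) → ℂ := fun i z => (χ i z : ℂ) * f z with hg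
  have hχs : ∀ i, ContDiff ℝ ∞ fun z => (χ i z : ℂ) := fun i =>
    Complex.ofRealCLM.contDiff.comp (χ i).contMDiff.contDiff
  have hgs : ∀ i, ContDiff ℝ ∞ (g i) := fun i => (hχs i).mul hf
  have hgc : ∀ i, HasCompactSupport (g i) := fun i => hc.mul_left
  have hgU : ∀ i : t, tsupport (g i) ⊆ U i := fun i =>
    (tsupport_mul_subset_left.trans (closure_mono fun z hz => by
      simpa using hz)).trans (hχ i)
  have hsum : f = fun z => ∑ i, g i z := by
    funext z
    rw [hg, ← Finset.sum_mul]
    by_cases hz : z ∈ tsupport f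
    · have h1 := χ.sum_eq_one hz
      rw [finsum_eq_sum_of_fintype] at h1
      rw [← Complex.ofReal_sum, h1]; simp
    · rw [image_eq_zero_of_notMem_tsupport hz, mul_zero]
  have hpatch := fun i : t => hasResidue_patch (hU i (hfT (htK i i.2))) (hv i (hfT (htK i i.2)))
    (hr i (hfT (htK i i.2))) (hN i (hfT (htK i i.2))) (hgs i) (hgc i) (hgU i) a b
  have hres : ∀ i : t, HasResidue (fun l => ∫ z, regIntegrand N a b (g i) l z)
      (Real.pi / o * sliceResidue a b (g i)) := by
    intro i
    rcases hP i (hfT (htK i i.2)) with h | ⟨c, q, hq, h⟩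
    · have := (hpatch i).1
      rwa [h] at this
    · have h0 : sliceResidue a b (g i) = 0 := by
        refine sliceResidue_eq_zero (hU i (hfT (htK i i.2))) (hv i (hfT (htK i i.2)))
          (hr i (hfT (htK i i.2))) (hN i (hfT (htK i i.2))) (hgs i) (hgc i) (hgU i)
          ⟨c, fun z => χ i z * q z, (hχs i).contDiffOn.mul hq, ?_⟩
        refine h.imp (fun h z hz hz0 => ?_) fun h z hz hz0 => ?_
        · rw [mul_div_assoc, mul_div_assoc, h z hz hz0]
        · rw [mul_div_assoc, mul_div_assoc, h z hz hz0]
      have := (hpatch i).1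
      rwa [h0, mul_zero] at this ⊢
  choose R hR using fun i => (hpatch i).2
  obtain ⟨R', hR'⟩ := (Set.finite_range R).bddAbove
  have hR'' : ∀ l : ℂ, R' < l.re → ∀ i, Integrable (regIntegrand N a b (g i) l) :=
    fun l hl i => hR i l ((hR' (mem_range_self i)).trans_lt hl)
  have hint : ∀ l : ℂ, regIntegrand N a b f l = fun z => ∑ i, regIntegrand N a b (g i) l z := by
    intro l; funext z
    simp only [regIntegrand]
    rw [← Finset.mul_sum, ← Finset.sum_div]
    conv_lhs => rw [hsum]
  refine ⟨?_, R', fun l hl => ?_⟩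
  · have h1 := HasResidue.sum Finset.univ fun i _ => hres i
    rw [← Finset.mul_sum, ← sliceResidue_sum Finset.univ hgs hgc, ← hsum] at h1
    refine h1.congr R' fun l hl => ?_
    rw [hint, integral_finsetSum _ fun i _ => hR'' l hl i]
  · rw [hint]
    exact integrable_finsetSum _ fun i _ => hR'' l hl i

end ChartResidue

end CxForm
end

noncomputable section

namespace CxForm

set_option linter.unusedSectionVars false

/-! ### Poles in different slice charts -/

section Poles

variable {n : ℕ} {X : Type*} [TopologicalSpace X]
  [ChartedSpace (Cn (n + 1)) X] [IsManifold 𝓘(ℂ, Cn (n + 1)) ω X]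
  {D : Type*} {ι : D → X}

theorem rep_wedgeForm {k l m : ℕ} (h : k + l = m) (w : Form (n + 1) X k) (ξ : Form (n + 1) X l)
    (e : OpenPartialHomeomorph X (Cn (n + 1))) (z : Cn (n + 1)) :
    rep (wedgeForm h w ξ) e z = wedge h (rep w e z) (rep ξ e z) :=
  (wedge_compLinearMap h _ _ _).symm

theorem PoleAtMost.exists_topCoeff {k l : ℕ} (hkl : k + l = 2 * (n + 1))
    {w : Form (n + 1) X k} (ξ : smoothForm (n + 1) X l)
    {e e' : OpenPartialHomeomorph X (Cn (n + 1))} (he : IsSlice ι e) (he' : IsSlice ι e')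
    {z : Cn (n + 1)} (hz : z ∈ e.target) (hz' : e.symm z ∈ e'.source) (hz0 : z 0 = 0) {a b : ℕ}
    (h : PoleAtMost w e' (e.symm z) a b) :
    ∃ (U : Set (Cn (n + 1))) (T : Cn (n + 1) → ℂ), IsOpen U ∧ z ∈ U ∧ U ⊆ e.target ∧
      ContDiffOn ℝ ∞ T U ∧ ∀ y ∈ U, y 0 ≠ 0 →
        topCoeff (wedgeForm hkl w ξ.1) e y = T y / (y 0 ^ a * starRingEnd ℂ (y 0) ^ b) := by
  obtain ⟨V, t, hV, hzV, hVe, ht, hwt⟩ := h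
  obtain ⟨u, hu, hu0, hue⟩ := he.exists_unit he' hz hz0 hz'
  set S : Cn (n + 1) → ℂ := fun y => wedge hkl (t y) (rep ξ.1 e' y) (frame (n + 1)) with hS
  have hSs : ContDiffOn ℝ ∞ S V :=
    SmoothOn.wedge hkl ht (fun v => (ξ.2 e' he'.1 v).mono hVe) _
  have hcoef : ∀ y ∈ V, y 0 ≠ 0 →
      topCoeff (wedgeForm hkl w ξ.1) e' y = S y / (y 0 ^ a * starRingEnd ℂ (y 0) ^ b) := by
    intro y hy hy0
    have hne : y 0 ^ a * starRingEnd ℂ (y 0) ^ b ≠ 0 :=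
      mul_ne_zero (pow_ne_zero _ hy0) (pow_ne_zero _ ((map_ne_zero _).2 hy0))
    simp only [hS]
    rw [eq_div_iff hne, ← hwt y hy hy0, wedge_smul_left, topCoeff, rep_wedgeForm]
    simp [mul_comm]
  have hW := isOpen_overlap e e'
  have hτ := contDiffOn_coordChange_real he.1 he'.1
  have hev : ∀ᶠ y in 𝓝 z, y ∈ e.target ∩ e.symm ⁻¹' e'.source ∧ e' (e.symm y) ∈ V ∧
      AnalyticAt ℂ u y ∧ u y ≠ 0 ∧ e' (e.symm y) 0 = y 0 * u y :=
    (hW.eventually_mem ⟨hz, hz'⟩).and (((hτ.continuousOn.continuousAt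
      (hW.mem_nhds ⟨hz, hz'⟩)).eventually_mem (hV.mem_nhds hzV)).and
      (hu.eventually_analyticAt.and ((hu.continuousAt.eventually_ne hu0).and hue)))
  obtain ⟨U, hU, hUo, hzU⟩ := mem_nhds_iff.1 hev
  refine ⟨U, fun y => (jac e e' y : ℂ) * S (e' (e.symm y)) /
    (u y ^ a * starRingEnd ℂ (u y) ^ b), hUo, hzU, fun y hy => (hU hy).1.1, ?_, ?_⟩
  · intro y hy
    obtain ⟨h1, h2, h3, h4, -⟩ := hU hy
    have hur : ContDiffAt ℝ ∞ u y := h3.contDiffAt.restrict_scalars ℝ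
    simp only [div_eq_mul_inv]
    refine ContDiffAt.contDiffWithinAt (ContDiffAt.mul (ContDiffAt.mul ?_ ?_)
      (ContDiffAt.inv ?_ ?_))
    · exact Complex.ofRealCLM.contDiff.contDiffAt.comp y
        ((contDiffOn_jac he.1 he'.1).contDiffAt (hW.mem_nhds h1))
    · exact ContDiffAt.comp (g := S) y (hSs.contDiffAt (hV.mem_nhds h2)) (hτ.contDiffAt (hW.mem_nhds h1))
    · exact (hur.pow a).mul ((Complex.conjCLE.contDiff.contDiffAt.comp y hur).pow b)
    · exact mul_ne_zero (pow_ne_zero _ h4) (pow_ne_zero _ ((map_ne_zero _).2 h4))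
  · intro y hy hy0
    obtain ⟨h1, h2, h3, h4, h5⟩ := hU hy
    rw [topCoeff_coordChange _ he.1 he'.1 h1.1 h1.2,
      hcoef _ h2 (by rw [h5]; exact mul_ne_zero hy0 h4), h5, map_mul, mul_pow, mul_pow]
    have hy0' : starRingEnd ℂ (y 0) ≠ 0 := (map_ne_zero _).2 hy0
    have h4' : starRingEnd ℂ (u y) ≠ 0 := (map_ne_zero _).2 h4
    field_simp

theorem NoDoublePole.mono {a b : ℕ} {f : Cn (n + 1) → ℂ} {U V : Set (Cn (n + 1))}
    (h : NoDoublePole a b f U) (hV : V ⊆ U) : NoDoublePole a b f V := by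
  obtain ⟨c, t, ht, h⟩ := h
  exact ⟨c, t, ht.mono hV, h.imp (fun h z hz => h z (hV hz)) fun h z hz => h z (hV hz)⟩

theorem exists_noDoublePole {k l : ℕ} (hkl : k + l = 2 * (n + 1))
    {w : Form (n + 1) X k} (ξ : smoothForm (n + 1) X l)
    {e : OpenPartialHomeomorph X (Cn (n + 1))} (he : IsSlice ι e) {z : Cn (n + 1)}
    (hz : z ∈ e.target) {a b : ℕ} {f θ : Cn (n + 1) → ℂ} (hf : ContDiffOn ℝ ∞ f e.target)
    (hθ : ContDiffOn ℝ ∞ θ e.target)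
    (hfθ : ∀ y ∈ e.target, y 0 ≠ 0 → f y / (y 0 ^ (a + 1) * starRingEnd ℂ (y 0) ^ (b + 1)) =
      θ y * topCoeff (wedgeForm hkl w ξ.1) e y)
    (hp : ∀ p, ι p = e.symm z → ¬ HasBothPoles ι w p) :
    ∃ U : Set (Cn (n + 1)), IsOpen U ∧ z ∈ U ∧ U ⊆ e.target ∧ NoDoublePole a b f U := by
  by_cases hz0 : z 0 = 0
  · obtain ⟨p, hpz⟩ := (he.symm_mem_range hz).2 hz0
    have h := hp p hpz
    unfold HasBothPoles at h
    push Not at h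
    obtain ⟨e', he', hpe', h⟩ := h
    rw [hpz] at hpe' h
    have h' : ∃ a' b' : ℕ, (a' = 0 ∨ b' = 0) ∧ PoleAtMost w e' (e.symm z) a' b' := by
      by_cases hb : ∃ b', PoleAtMost w e' (e.symm z) 0 b'
      · obtain ⟨b', hb'⟩ := hb
        exact ⟨0, b', Or.inl rfl, hb'⟩
      · push Not at hb
        obtain ⟨a', ha'⟩ := h hb
        exact ⟨a', 0, Or.inr rfl, ha'⟩
    obtain ⟨a', b', hab, hpole⟩ := h'
    obtain ⟨U, T, hU, hzU, hUe, hT, hTη⟩ := hpole.exists_topCoeff hkl ξ he he' hz hpe' hz0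
    refine ⟨U, hU, hzU, hUe, a' + b', fun y => θ y * T y, (hθ.mono hUe).mul hT, ?_⟩
    rcases hab with rfl | rfl
    · left
      intro y hy hy0
      rw [hfθ y (hUe hy) hy0, hTη y hy hy0]; simp [mul_div_assoc]
    · right
      intro y hy hy0
      rw [hfθ y (hUe hy) hy0, hTη y hy hy0]; simp [mul_div_assoc]
  · refine ⟨e.target ∩ {y | y 0 ≠ 0}, e.open_target.inter
      (isOpen_ne_fun (continuous_apply 0) continuous_const), ⟨hz, hz0⟩, inter_subset_left, 0,
      fun y => f y / (y 0 ^ (a + 1) * starRingEnd ℂ (y 0) ^ (b + 1)), ?_, Or.inl ?_⟩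
    · simp only [div_eq_mul_inv]
      refine (hf.mono inter_subset_left).mul (ContDiffOn.inv (((contDiff_coord.pow _).mul
        (contDiff_conj_coord.pow _)).contDiffOn) fun y hy => ?_)
      exact mul_ne_zero (pow_ne_zero _ hy.2) (pow_ne_zero _ ((map_ne_zero _).2 hy.2))
    · intro y _ _
      simp

end Poles

/-! ### Existence of the choices in the definition of the residue -/

section ResidueExists

variable {n : ℕ} {X : Type*} [TopologicalSpace X]
  [ChartedSpace (Cn (n + 1)) X] [IsManifold 𝓘(ℂ, Cn (n + 1)) ω X]
  {D : Type*} {ι : D → X}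

theorem restr_mem_holAtlas {e : OpenPartialHomeomorph X (Cn (n + 1))}
    (he : e ∈ holAtlas (n + 1) X) {s : Set X} (hs : IsOpen s) :
    e.restr s ∈ holAtlas (n + 1) X :=
  restr_mem_maximalAtlas (contDiffGroupoid ω 𝓘(ℂ, Cn (n + 1))) he hs

theorem IsSlice.restr {e : OpenPartialHomeomorph X (Cn (n + 1))} (he : IsSlice ι e) {s : Set X}
    (hs : IsOpen s) : IsSlice ι (e.restr s) :=
  ⟨restr_mem_holAtlas he.1 hs, fun x hx => he.2 x (by simp at hx; exact hx.1)⟩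

/-- A chart followed by the translation by `c`. -/
def shiftChart (e : OpenPartialHomeomorph X (Cn (n + 1))) (c : Cn (n + 1)) :
    OpenPartialHomeomorph X (Cn (n + 1)) :=
  e.trans (Homeomorph.addRight c).toOpenPartialHomeomorph

theorem shiftChart_mem_holAtlas {e : OpenPartialHomeomorph X (Cn (n + 1))}
    (he : e ∈ holAtlas (n + 1) X) (c : Cn (n + 1)) : shiftChart e c ∈ holAtlas (n + 1) X := by
  have hf : (Homeomorph.addRight c).toOpenPartialHomeomorph ∈
      contDiffGroupoid ω 𝓘(ℂ, Cn (n + 1)) := by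
    rw [contDiffGroupoid, mem_groupoid_of_pregroupoid]
    constructor
    · have : ContDiffOn ℂ ω (fun z : Cn (n + 1) => z + c) univ :=
        (contDiff_id.add contDiff_const).contDiffOn
      simpa [contDiffPregroupoid] using! this
    · have : ContDiffOn ℂ ω (fun z : Cn (n + 1) => z + -c) univ :=
        (contDiff_id.add contDiff_const).contDiffOn
      simpa [contDiffPregroupoid] using! this
  rw [IsManifold.mem_maximalAtlas_iff, mem_maximalAtlas_iff] at he ⊢
  intro e' he'
  obtain ⟨h1, h2⟩ := he e' he'
  constructor
  · rw [shiftChart, OpenPartialHomeomorph.trans_symm_eq_symm_trans_symm,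
      OpenPartialHomeomorph.trans_assoc]
    exact StructureGroupoid.trans _ (StructureGroupoid.symm _ hf) h1
  · rw [shiftChart, ← OpenPartialHomeomorph.trans_assoc]
    exact StructureGroupoid.trans _ h2 hf

theorem exists_residueChart {k l : ℕ} (hkl : k + l = 2 * (n + 1))
    {w : Form (n + 1) X k} [TopologicalSpace D] (hw : IsQuasiMeromorphic ι w)
    (hι : IsClosed (range ι)) (ξ : smoothForm (n + 1) X l) (x : X) :
    ∃ e : OpenPartialHomeomorph X (Cn (n + 1)), IsSlice ι e ∧ x ∈ e.source ∧
      ∃ (a b : ℕ) (ψ : Cn (n + 1) → ℂ), ContDiffOn ℝ ∞ ψ e.target ∧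
        ∀ z ∈ e.target, z 0 ≠ 0 → rep (wedgeForm hkl w ξ.1) e z =
          (ψ z / (z 0 ^ (a + 1) * (starRingEnd ℂ (z 0)) ^ (b + 1))) • stdTop (n + 1) := by
  have key : ∀ (e : OpenPartialHomeomorph X (Cn (n + 1))) (a b : ℕ) (T : Cn (n + 1) → ℂ)
      (U : Set (Cn (n + 1))), ContDiffOn ℝ ∞ T U →
      (∀ y ∈ U, y 0 ≠ 0 → topCoeff (wedgeForm hkl w ξ.1) e y =
        T y / (y 0 ^ a * starRingEnd ℂ (y 0) ^ b)) →
      ∃ ψ : Cn (n + 1) → ℂ, ContDiffOn ℝ ∞ ψ U ∧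
        ∀ z ∈ U, z 0 ≠ 0 → rep (wedgeForm hkl w ξ.1) e z =
          (ψ z / (z 0 ^ (a + 1) * (starRingEnd ℂ (z 0)) ^ (b + 1))) • stdTop (n + 1) := by
    intro e a b T U hT hη
    refine ⟨fun z => z 0 * starRingEnd ℂ (z 0) * T z * (stdTop (n + 1) (frame (n + 1)))⁻¹,
      (((contDiff_coord.mul contDiff_conj_coord).contDiffOn.mul hT).mul contDiffOn_const), ?_⟩
    intro z hz hz0
    rw [eq_smul_stdTop (rep (wedgeForm hkl w ξ.1) e z)]
    congr 1
    have h1 := hη z hz hz0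
    rw [topCoeff] at h1
    rw [h1]
    have hz0' : starRingEnd ℂ (z 0) ≠ 0 := (map_ne_zero _).2 hz0
    have := stdTop_frame_ne_zero (n + 1)
    field_simp
    ring
  by_cases hx : x ∈ range ι
  · obtain ⟨p, rfl⟩ := hx
    obtain ⟨e, he, hpe, a, b, hab⟩ := hw.2 p
    have hab' : PoleAtMost w e (e.symm (e (ι p))) a b := by rwa [e.left_inv hpe]
    obtain ⟨U, T, hU, hzU, hUe, hT, hTη⟩ := hab'.exists_topCoeff hkl ξ he he (e.map_source hpe)
      (by rwa [e.left_inv hpe]) (he.apply_zero hpe)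
    obtain ⟨ψ, hψ, hψη⟩ := key e a b T U hT hTη
    have hs := e.isOpen_inter_preimage hU
    have htar : (e.restr (e.source ∩ e ⁻¹' U)).target ⊆ U := by
      intro z hz
      simp only [OpenPartialHomeomorph.restr_target, hs.interior_eq] at hz
      have := hz.2.2
      rwa [mem_preimage, e.right_inv hz.1] at this
    refine ⟨e.restr (e.source ∩ e ⁻¹' U), he.restr hs, ?_, a, b, ψ, hψ.mono htar,
      fun z hz hz0 => hψη z (htar hz) hz0⟩
    simp only [OpenPartialHomeomorph.restr_source, hs.interior_eq]
    exact ⟨hpe, hpe, hzU⟩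
  · set e₀ := chartAt (Cn (n + 1)) x with he₀
    set e₁ := shiftChart e₀ (Pi.single 0 (1 - e₀ x 0)) with he₁
    have hx₁ : x ∈ e₁.source := by simp [he₁, shiftChart, he₀]
    have hx0 : e₁ x 0 = 1 := by simp [he₁, shiftChart]
    set s : Set X := (e₁.source ∩ e₁ ⁻¹' {y | y 0 ≠ 0}) ∩ (range ι)ᶜ with hs
    have hso : IsOpen s := (e₁.isOpen_inter_preimage
      (isOpen_ne_fun (continuous_apply 0) continuous_const)).inter hι.isOpen_compl
    have hsrc : (e₁.restr s).source ⊆ s := by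
      intro y hy
      simp only [OpenPartialHomeomorph.restr_source, hso.interior_eq] at hy
      exact hy.2
    have hmem := restr_mem_holAtlas (shiftChart_mem_holAtlas (holAtlas_chartAt (d := n + 1) x)
      (Pi.single 0 (1 - e₀ x 0))) hso
    have hsm : ContDiffOn ℝ ∞ (topCoeff (wedgeForm hkl w ξ.1) (e₁.restr s))
        (e₁.restr s).target := by
      have h1 : SmoothOn (rep w (e₁.restr s)) (e₁.restr s).target := fun v =>
        (hw.1 _ hmem v).mono fun z hz => ⟨hz, (hsrc ((e₁.restr s).map_target hz)).2⟩
      have h2 := SmoothOn.wedge hkl h1 (ξ.2 _ hmem) (frame (n + 1))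
      refine h2.congr fun z _ => ?_
      rw [topCoeff, rep_wedgeForm]
    obtain ⟨ψ, hψ, hψη⟩ := key (e₁.restr s) 0 0 _ _ hsm (by intro y _ _; simp)
    refine ⟨e₁.restr s, ⟨hmem, fun y hy => ?_⟩, ?_, 0, 0, ψ, hψ, hψη⟩
    · have h1 := hsrc hy
      exact ⟨fun h => absurd h h1.2, fun h => absurd h h1.1.2⟩
    · simp only [OpenPartialHomeomorph.restr_source, hso.interior_eq]
      exact ⟨hx₁, ⟨hx₁, by simp [hx0]⟩, hx⟩

theorem nonempty_residueData [T2Space X] [CompactSpace X] {k l : ℕ} (hkl : k + l = 2 * (n + 1))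
    {w : Form (n + 1) X k} [TopologicalSpace D] [ChartedSpace (Cn n) D] (hw : IsQuasiMeromorphic ι w)
    (hι : IsClosed (range ι)) (ξ : smoothForm (n + 1) X l) :
    Nonempty (ResidueData ι (wedgeForm hkl w ξ.1)) := by
  choose E hE hxE a b ψ hψ hη using exists_residueChart hkl hw hι ξ
  obtain ⟨P, hP⟩ := exists_chartPartition E (fun x => (hE x).1) hxE
  choose x hx using hP
  exact ⟨{ P with
    slice := fun j => by rw [hx j]; exact hE _
    a := fun j => a (x j)
    b := fun j => b (x j)
    ψ := fun j => ψ (x j)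
    ψ_smooth := fun j => by rw [hx j]; exact hψ _
    eq := fun j => by rw [hx j]; exact hη _ }⟩

end ResidueExists

end CxForm
end

noncomputable section

namespace CxForm

set_option linter.unusedSectionVars false

/-! ### The value of the current in terms of slice residues -/

section Current

variable {n : ℕ} {X : Type*} [TopologicalSpace X] [T2Space X] [CompactSpace X]
  [ChartedSpace (Cn (n + 1)) X] [IsManifold 𝓘(ℂ, Cn (n + 1)) ω X]
  {D : Type*} [TopologicalSpace D] [ChartedSpace (Cn n) D]
  {ι : D → X}

/-- The function `ρⱼ ψⱼ`, extended by zero to all of `ℂ^d`. -/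
def ResidueData.ext {η : Form (n + 1) X (2 * (n + 1))} (R : ResidueData ι η) (j : Fin R.N) :
    Cn (n + 1) → ℂ :=
  (R.chart j).target.indicator fun y => (R.ρ j ((R.chart j).symm y) : ℂ) * R.ψ j y

theorem ResidueData.ext_eq_zero {η : Form (n + 1) X (2 * (n + 1))} (R : ResidueData ι η)
    (j : Fin R.N) {z : Cn (n + 1)} (hz : z ∉ (R.chart j) '' tsupport (R.ρ j)) :
    R.ext j z = 0 := by
  obtain ⟨-, -, h3⟩ := isCompact_image_tsupport (R.subordinate j)
  rw [ResidueData.ext]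
  by_cases hzt : z ∈ (R.chart j).target
  · rw [indicator_of_mem hzt, image_eq_zero_of_notMem_tsupport (h3 z hzt hz)]; simp
  · rw [indicator_of_notMem hzt]

theorem ResidueData.ext_prop {η : Form (n + 1) X (2 * (n + 1))} (R : ResidueData ι η)
    (j : Fin R.N) : ContDiff ℝ ∞ (R.ext j) ∧ HasCompactSupport (R.ext j) ∧
      tsupport (R.ext j) ⊆ (R.chart j) '' tsupport (R.ρ j) := by
  obtain ⟨h1, h2, h3⟩ := isCompact_image_tsupport (R.subordinate j)
  obtain ⟨h4, h5⟩ := contDiff_indicator (R.chart j).open_target h1 h2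
    ((contDiffOn_comp_symm (R.smooth j) (R.chart_mem j)).mul (R.ψ_smooth j))
    fun z hz hn => by rw [image_eq_zero_of_notMem_tsupport (h3 z hz hn)]; simp
  refine ⟨h4, h5, closure_minimal (fun z hz => ?_) h1.isClosed⟩
  by_contra h
  exact hz (R.ext_eq_zero j h)

theorem ResidueData.tsupport_ext_subset {η : Form (n + 1) X (2 * (n + 1))}
    (R : ResidueData ι η) (j : Fin R.N) : tsupport (R.ext j) ⊆ (R.chart j).target :=
  (R.ext_prop j).2.2.trans (isCompact_image_tsupport (R.subordinate j)).2.1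

variable {L : X → Type*} [TopologicalSpace (Bundle.TotalSpace ℂ L)]
  [∀ x, AddCommGroup (L x)] [∀ x, Module ℂ (L x)] [∀ x, TopologicalSpace (L x)]
  [FiberBundle ℂ L] [VectorBundle ℂ ℂ L] [ContMDiffVectorBundle ω ℂ L 𝓘(ℂ, Cn (n + 1))]
  {s : ∀ x, L x} {h : ∀ x, L x → ℝ}

theorem ResidueData.density_regularized {η : Form (n + 1) X (2 * (n + 1))} (R : ResidueData ι η)
    (h : ∀ x, L x → ℝ) (s : ∀ x, L x) (l : ℂ) (j : Fin R.N) {z : Cn (n + 1)}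
    (hz : z ∈ (R.chart j).target) (hz0 : z 0 ≠ 0) :
    R.density (regularized h s l η) j z = stdTop (n + 1) (frame (n + 1)) *
      regIntegrand (fun y => h ((R.chart j).symm y) (s ((R.chart j).symm y))) (R.a j) (R.b j)
        (R.ext j) l z := by
  have h1 : rep (regularized h s l η) (R.chart j) z =
      ((h ((R.chart j).symm z) (s ((R.chart j).symm z)) : ℂ) ^ (2 * l)) •
        rep η (R.chart j) z := rfl
  rw [ChartPartition.density, h1, R.eq j z hz hz0, regIntegrand, ResidueData.ext,
    indicator_of_mem hz]
  simp only [AlternatingMap.smul_apply, smul_eq_mul]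
  ring

theorem ResidueData.hasResidue_density (hs : IsHolSection n s)
    (hsD : ∀ x, s x = 0 ↔ x ∈ range ι) (hι : Function.Injective ι) (hh : IsMetric n h)
    {k l : ℕ} (hkl : k + l = 2 * (n + 1)) {w : Form (n + 1) X k} (ξ : smoothForm (n + 1) X l)
    (R : ResidueData ι (wedgeForm hkl w ξ.1)) {o : ℕ}
    (ho : ∀ p, HasBothPoles ι w p → vanishingOrder n ι s p = o) (j : Fin R.N) :
    HasResidue (fun lam => ∫ z in (R.chart j).target,
        R.density (regularized h s lam (wedgeForm hkl w ξ.1)) j z)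
      (stdTop (n + 1) (frame (n + 1)) *
        (Real.pi / o * sliceResidue (R.a j) (R.b j) (R.ext j))) ∧
    ∃ r : ℝ, ∀ lam : ℂ, r < lam.re →
      IntegrableOn (R.density (regularized h s lam (wedgeForm hkl w ξ.1)) j)
        (R.chart j).target := by
  set N : Cn (n + 1) → ℝ := fun y => h ((R.chart j).symm y) (s ((R.chart j).symm y)) with hN
  obtain ⟨he1, he2, -⟩ := R.ext_prop j
  have he3 := R.tsupport_ext_subset j
  obtain ⟨h1, r, hr⟩ := hasResidue_chart (N := N) he1 he2 he3 (R.a j) (R.b j) o (by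
    intro z hz
    obtain ⟨r, hr, hrp, v, U, hU, hzU, hUe, hv, hNU⟩ :=
      exists_metric_eq_exp hs hsD hι hh (R.slice j) hz
    by_cases hp : ∃ p, ι p = (R.chart j).symm z ∧ HasBothPoles ι w p
    · obtain ⟨p, hpz, hpp⟩ := hp
      exact ⟨r, v, U, hr, hU, hzU, hv, hNU, Or.inl ((hrp p hpz).trans (ho p hpp))⟩
    · push Not at hp
      obtain ⟨V, hV, hzV, hVe, hnd⟩ := exists_noDoublePole (a := R.a j) (b := R.b j) hkl ξ
        (R.slice j) hz he1.contDiffOn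
        (θ := fun y => (R.ρ j ((R.chart j).symm y) : ℂ) *
          (stdTop (n + 1) (frame (n + 1)))⁻¹)
        ((contDiffOn_comp_symm (R.smooth j) (R.chart_mem j)).mul contDiffOn_const)
        (by
          intro y hy hy0
          rw [topCoeff, R.eq j y hy hy0, ResidueData.ext, indicator_of_mem hy]
          have := stdTop_frame_ne_zero (n + 1)
          simp only [AlternatingMap.smul_apply, smul_eq_mul]
          field_simp) hp
      exact ⟨r, v, U ∩ V, hr, hU.inter hV, ⟨hzU, hzV⟩, hv.mono inter_subset_left,
        fun y hy => hNU y hy.1, Or.inr (hnd.mono inter_subset_right)⟩)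
  have hae : ∀ lam : ℂ, (fun z => stdTop (n + 1) (frame (n + 1)) *
      regIntegrand N (R.a j) (R.b j) (R.ext j) lam z)
      =ᵐ[volume.restrict (R.chart j).target]
      R.density (regularized h s lam (wedgeForm hkl w ξ.1)) j := by
    intro lam
    filter_upwards [ae_restrict_mem (R.chart j).open_target.measurableSet,
      ae_restrict_of_ae ae_ne_zero] with z hz hz0
    exact (R.density_regularized h s lam j hz hz0).symm
  refine ⟨?_, r, fun lam hlam => ?_⟩
  · refine (h1.const_mul (stdTop (n + 1) (frame (n + 1)))).congr 0 fun lam _ => ?_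
    rw [← integral_congr_ae (hae lam), integral_const_mul]
    congr 1
    refine (setIntegral_eq_integral_of_forall_compl_eq_zero fun z hz => ?_).symm
    rw [regIntegrand, ResidueData.ext, indicator_of_notMem hz]; simp
  · exact (((hr lam hlam).const_mul _).integrableOn).congr (hae lam)

theorem kappa_eq_one {k : ℕ} {w : Form (n + 1) X k} (hκ : 0 < kappa ι w) :
    kappa ι w = 1 ∧ ∃ p, HasBothPoles ι w p := by
  classical
  have hex : ∃ p, HasBothPoles ι w p := by
    by_contra hno
    push Not at hno
    have : kappa ι w = 0 := by
      rcases isEmpty_or_nonempty D with hE | hE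
      · simp [kappa, iSup, Set.range_eq_empty]
      · simp [kappa, hno]
    omega
  refine ⟨le_antisymm ?_ hκ, hex⟩
  have : Nonempty D := ⟨hex.choose⟩
  refine ciSup_le fun p => ?_
  split_ifs <;> omega

theorem oOrder_eq {k : ℕ} {w : Form (n + 1) X k} {o : ℕ} (ho1 : 1 ≤ o)
    (ho : ∀ p, HasBothPoles ι w p → vanishingOrder n ι s p = o) (hex : ∃ p, HasBothPoles ι w p) :
    oOrder ι w s = o := by
  classical
  obtain ⟨p, hp⟩ := hex
  have hle : ∀ q, (if HasBothPoles ι w q then vanishingOrder n ι s q else 1) ≤ o := by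
    intro q
    split_ifs with hq
    · exact (ho q hq).le
    · exact ho1
  refine le_antisymm ?_ ?_
  · have : Nonempty D := ⟨p⟩
    exact ciSup_le hle
  · have h1 := le_ciSup (f := fun q => if HasBothPoles ι w q then vanishingOrder n ι s q else 1)
      ⟨o, by rintro _ ⟨q, rfl⟩; exact hle q⟩ p
    simp only [if_pos hp, ho p hp] at h1
    refine h1.trans_eq ?_
    unfold oOrder
    congr!

theorem canonicalCurrentEq_residueData (hD : IsSmoothHypersurface n ι) (hs : IsHolSection n s)
    (hsD : ∀ x, s x = 0 ↔ x ∈ range ι) (hh : IsMetric n h)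
    {k l : ℕ} (hkl : k + l = 2 * (n + 1)) {w : Form (n + 1) X k} (hκ : 0 < kappa ι w)
    (hord : ∀ p q : D, HasBothPoles ι w p → HasBothPoles ι w q →
      vanishingOrder n ι s p = vanishingOrder n ι s q)
    (ξ : smoothForm (n + 1) X l) (R : ResidueData ι (wedgeForm hkl w ξ.1)) :
    CanonicalCurrentEq ι h s hkl w ξ.1 (-2 * Real.pi * Complex.I *
      ∑ j, stdTop n (frame n) * sliceResidue (R.a j) (R.b j) (R.ext j)) := by
  obtain ⟨hκ1, p, hp⟩ := kappa_eq_one hκ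
  set o := vanishingOrder n ι s p with hodef
  have ho : ∀ q, HasBothPoles ι w q → vanishingOrder n ι s q = o := fun q hq => hord q p hq hp
  have ho1 : 1 ≤ o := by
    obtain ⟨e, he, hpe, -⟩ := hD.2 p
    exact (exists_vanishing hs hsD he hpe).1
  have ho0 : (o : ℂ) ≠ 0 := by exact_mod_cast (by omega : o ≠ 0)
  have hj := fun j => R.hasResidue_density hs hsD hD.1.injective hh hkl ξ ho j
  choose r hr using fun j => (hj j).2
  obtain ⟨r', hr'⟩ := (Set.finite_range r).bddAbove
  have hr'' : ∀ lam : ℂ, r' < lam.re → ∀ j,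
      IntegrableOn (R.density (regularized h s lam (wedgeForm hkl w ξ.1)) j)
        (R.chart j).target :=
    fun lam hlam j => hr j lam ((hr' (mem_range_self j)).trans_lt hlam)
  have hsum := (HasResidue.sum Finset.univ fun j _ => (hj j).1).const_mul (o : ℂ)
  obtain ⟨F, hF, ⟨r₁, hFr⟩, hlim⟩ := hsum
  refine ⟨F, hF, ⟨max r₁ r', fun lam hlam => ⟨?_, ?_⟩⟩, ?_⟩
  · exact R.toChartPartition.formIntegrable (hr'' lam ((le_max_right _ _).trans_lt hlam))
  · rw [R.toChartPartition.formIntegral_eq (hr'' lam ((le_max_right _ _).trans_lt hlam)),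
      hFr lam ((le_max_left _ _).trans_lt hlam), oOrder_eq ho1 ho ⟨p, hp⟩]
  · rw [hκ1]
    simp only [pow_one]
    convert hlim using 2
    rw [Finset.mul_sum, Finset.mul_sum]
    refine Finset.sum_congr rfl fun j _ => ?_
    rw [stdTop_frame, stdTop_frame, pow_succ]
    field_simp

end Current

end CxForm
end

noncomputable section

namespace CxForm

set_option linter.unusedSectionVars false

/-! ### The charts induced on a hypersurface -/

section Induced

variable {d : ℕ} {M : Type*} [TopologicalSpace M] [ChartedSpace (Cn d) M]
  [IsManifold 𝓘(ℂ, Cn d) ω M]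

theorem mem_holAtlas_of_local {E : OpenPartialHomeomorph M (Cn d)}
    (h : ∀ q ∈ E.source, ∃ f ∈ holAtlas d M, q ∈ f.source ∧
      ContDiffAt ℂ ω (fun z => f (E.symm z)) (E q) ∧
      ContDiffAt ℂ ω (fun z => E (f.symm z)) (f q)) : E ∈ holAtlas d M := by
  rw [IsManifold.mem_maximalAtlas_iff, mem_maximalAtlas_iff]
  intro e' he'
  have he'' : e' ∈ holAtlas d M := IsManifold.subset_maximalAtlas he'
  have h1 : ContDiffOn ℂ ω (fun z => e' (E.symm z)) (E.target ∩ E.symm ⁻¹' e'.source) := by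
    intro z hz
    obtain ⟨f, hf, hqf, hf1, -⟩ := h (E.symm z) (E.map_target hz.1)
    rw [E.right_inv hz.1] at hf1
    have h2 : ContDiffAt ℂ ω (fun y => e' (f.symm y)) (f (E.symm z)) :=
      (contDiffOn_coordChange hf he'').contDiffAt ((isOpen_overlap f e').mem_nhds
        ⟨f.map_source hqf, by rw [mem_preimage, f.left_inv hqf]; exact hz.2⟩)
    refine ((ContDiffAt.comp z h2 hf1).congr_of_eventuallyEq ?_).contDiffWithinAt
    filter_upwards [(isOpen_overlap E f).mem_nhds ⟨hz.1, hqf⟩] with y hy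
    simp [f.left_inv hy.2]
  have h2 : ContDiffOn ℂ ω (fun z => E (e'.symm z)) (e'.target ∩ e'.symm ⁻¹' E.source) := by
    intro z hz
    obtain ⟨f, hf, hqf, -, hf1⟩ := h (e'.symm z) hz.2
    have h2 : ContDiffAt ℂ ω (fun y => f (e'.symm y)) z :=
      (contDiffOn_coordChange he'' hf).contDiffAt ((isOpen_overlap e' f).mem_nhds
        ⟨hz.1, hqf⟩)
    refine ((ContDiffAt.comp z hf1 h2).congr_of_eventuallyEq ?_).contDiffWithinAt
    filter_upwards [(isOpen_overlap e' f).mem_nhds ⟨hz.1, hqf⟩] with y hy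
    simp [f.left_inv hy.2]
  have key : ∀ e e' : OpenPartialHomeomorph M (Cn d),
      ContDiffOn ℂ ω (fun z => e' (e.symm z)) (e.target ∩ e.symm ⁻¹' e'.source) →
      ContDiffOn ℂ ω (fun z => e (e'.symm z)) (e'.target ∩ e'.symm ⁻¹' e.source) →
      e.symm.trans e' ∈ contDiffGroupoid ω 𝓘(ℂ, Cn d) := by
    intro e e' h1 h2
    rw [contDiffGroupoid, mem_groupoid_of_pregroupoid]
    constructor
    · simpa [contDiffPregroupoid] using! h1
    · simpa [contDiffPregroupoid] using! h2
  exact ⟨key _ _ h1 h2, key _ _ h2 h1⟩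

variable {n : ℕ} {X : Type*} [TopologicalSpace X]
  [ChartedSpace (Cn (n + 1)) X] [IsManifold 𝓘(ℂ, Cn (n + 1)) ω X]
  {D : Type*} [TopologicalSpace D] [ChartedSpace (Cn n) D] [IsManifold 𝓘(ℂ, Cn n) ω D]
  {ι : D → X}

theorem continuous_tail : Continuous (Fin.tail : Cn (n + 1) → Cn n) :=
  continuous_pi fun j => continuous_apply j.succ

theorem contDiff_tail : ContDiff ℂ ω (Fin.tail : Cn (n + 1) → Cn n) :=
  contDiff_pi.2 fun j => contDiff_apply ℂ ℂ j.succ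

theorem contDiff_cons_zero {𝕜 : Type*} [NontriviallyNormedField 𝕜] [NormedAlgebra 𝕜 ℂ]
    {m : WithTop ℕ∞} : ContDiff 𝕜 m (fun y : Cn n => (Fin.cons 0 y : Cn (n + 1))) :=
  contDiff_pi.2 fun j => by
    refine Fin.cases ?_ (fun j => ?_) j
    · simpa using contDiff_const
    · simpa using contDiff_apply 𝕜 ℂ j

theorem IsSlice.cons_tail {e : OpenPartialHomeomorph X (Cn (n + 1))} (he : IsSlice ι e) {p : D}
    (hp : ι p ∈ e.source) : (Fin.cons 0 (Fin.tail (e (ι p))) : Cn (n + 1)) = e (ι p) := by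
  conv_rhs => rw [← Fin.cons_self_tail (e (ι p)), he.apply_zero hp]

theorem IsSlice.exists_inducedChart [Nonempty D] (hD : IsSmoothHypersurface n ι)
    {e : OpenPartialHomeomorph X (Cn (n + 1))} (he : IsSlice ι e) :
    ∃ E : OpenPartialHomeomorph D (Cn n), E ∈ holAtlas n D ∧ E.source = ι ⁻¹' e.source ∧
      (∀ z, z ∈ E.target ↔ (Fin.cons 0 z : Cn (n + 1)) ∈ e.target) ∧
      (∀ q, E q = Fin.tail (e (ι q))) ∧
      ∀ z ∈ E.target, ι (E.symm z) = e.symm (Fin.cons 0 z) := by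
  have hinj := hD.1.injective
  have hinv : ∀ z : Cn n, (Fin.cons 0 z : Cn (n + 1)) ∈ e.target →
      ι (Function.invFun ι (e.symm (Fin.cons 0 z))) = e.symm (Fin.cons 0 z) := fun z hz =>
    Function.invFun_eq ((he.symm_mem_range hz).2 (by simp))
  let E : OpenPartialHomeomorph D (Cn n) :=
    { toFun := fun q => Fin.tail (e (ι q))
      invFun := fun z => Function.invFun ι (e.symm (Fin.cons 0 z))
      source := ι ⁻¹' e.source
      target := {z | (Fin.cons 0 z : Cn (n + 1)) ∈ e.target}
      map_source' := fun q hq => by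
        rw [mem_ofPred_eq, he.cons_tail hq]; exact e.map_source hq
      map_target' := fun z hz => by
        rw [mem_preimage, hinv z hz]; exact e.map_target hz
      left_inv' := fun q hq => by
        rw [he.cons_tail hq, e.left_inv hq]; exact Function.leftInverse_invFun hinj q
      right_inv' := fun z hz => by
        rw [hinv z hz, e.right_inv hz, Fin.tail_cons]
      open_source := e.open_source.preimage hD.1.continuous
      open_target := e.open_target.preimage continuous_cons_zero
      continuousOn_toFun := continuous_tail.comp_continuousOn
        (e.continuousOn.comp hD.1.continuous.continuousOn fun q hq => hq)
      continuousOn_invFun := by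
        rw [hD.1.isInducing.continuousOn_iff]
        refine (e.continuousOn_symm.comp continuous_cons_zero.continuousOn
          fun z hz => hz).congr fun z hz => hinv z hz }
  refine ⟨E, mem_holAtlas_of_local fun q hq => ?_, rfl, fun z => Iff.rfl, fun q => rfl, hinv⟩
  obtain ⟨f, hf, hqf, f', hf', hqf', hff'⟩ := hD.2 q
  have hιf : ContinuousAt (fun y => f'.symm y) (f' q) := f'.continuousAt_symm (f'.map_source hqf')
  have hEq : ι (E.symm (E q)) = ι q := by rw [E.left_inv hq]
  refine ⟨f', hf', hqf', ?_, ?_⟩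
  · have hz : (Fin.cons 0 (E q) : Cn (n + 1)) ∈ e.target := E.map_source hq
    have hsy : e.symm (Fin.cons 0 (E q)) = ι q := by rw [← hinv _ hz]; exact hEq
    have h1 : ContDiffAt ℂ ω (fun y => f (e.symm y)) (Fin.cons 0 (E q)) :=
      (contDiffOn_coordChange he.1 hf.1).contDiffAt ((isOpen_overlap e f).mem_nhds
        ⟨hz, by rw [mem_preimage, hsy]; exact hqf⟩)
    have h2 : ContDiffAt ℂ ω (fun y : Cn n => Fin.tail (f (e.symm (Fin.cons 0 y)))) (E q) :=
      contDiff_tail.contDiffAt.comp (E q) (ContDiffAt.comp (g := fun y => f (e.symm y)) (E q) h1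
        contDiff_cons_zero.contDiffAt)
    refine h2.congr_of_eventuallyEq ?_
    have hcont : ContinuousAt E.symm (E q) := E.continuousAt_symm (E.map_source hq)
    filter_upwards [E.open_target.mem_nhds (E.map_source hq), hcont.eventually_mem
      (f'.open_source.mem_nhds (by rwa [E.left_inv hq]))] with y hy hy'
    rw [← hinv y hy]
    have := (hff' _ hy').2
    change f' (E.symm y) = Fin.tail (f (ι (E.symm y)))
    rw [this, Fin.tail_cons]
  · have hz : (Fin.cons 0 (f' q) : Cn (n + 1)) ∈ f.target := by
      rw [← (hff' q hqf').2]; exact f.map_source hqf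
    have hsy : f.symm (Fin.cons 0 (f' q)) = ι q := by
      rw [← (hff' q hqf').2, f.left_inv hqf]
    have h1 : ContDiffAt ℂ ω (fun y => e (f.symm y)) (Fin.cons 0 (f' q)) :=
      (contDiffOn_coordChange hf.1 he.1).contDiffAt ((isOpen_overlap f e).mem_nhds
        ⟨hz, by rw [mem_preimage, hsy]; exact hq⟩)
    have h2 : ContDiffAt ℂ ω (fun y : Cn n => Fin.tail (e (f.symm (Fin.cons 0 y)))) (f' q) :=
      contDiff_tail.contDiffAt.comp (f' q) (ContDiffAt.comp (g := fun y => e (f.symm y)) (f' q) h1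
        contDiff_cons_zero.contDiffAt)
    refine h2.congr_of_eventuallyEq ?_
    filter_upwards [f'.open_target.mem_nhds (f'.map_source hqf')] with y hy
    have h3 := hff' _ (f'.map_target hy)
    rw [f'.right_inv hy] at h3
    rw [← h3.2, f.left_inv h3.1]
    rfl

end Induced

/-! ### The residue form -/

section ResidueForm

variable {n : ℕ}

theorem dz₁_congr {f g : Cn (n + 1) → ℂ} {z : Cn (n + 1)} (h : f =ᶠ[𝓝 z] g) :
    dz₁ f =ᶠ[𝓝 z] dz₁ g := by
  filter_upwards [h.eventuallyEq_nhds] with y hy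
  simp [dz₁, del, hy.fderiv_eq]

theorem dzbar₁_congr {f g : Cn (n + 1) → ℂ} {z : Cn (n + 1)} (h : f =ᶠ[𝓝 z] g) :
    dzbar₁ f =ᶠ[𝓝 z] dzbar₁ g := by
  filter_upwards [h.eventuallyEq_nhds] with y hy
  simp [dzbar₁, delbar, hy.fderiv_eq]

theorem iterate_congr {f g : Cn (n + 1) → ℂ} {z : Cn (n + 1)} (h : f =ᶠ[𝓝 z] g) (a b : ℕ) :
    (dz₁^[a] (dzbar₁^[b] f)) z = (dz₁^[a] (dzbar₁^[b] g)) z := by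
  have h1 : dzbar₁^[b] f =ᶠ[𝓝 z] dzbar₁^[b] g := by
    induction b with
    | zero => exact h
    | succ b ih => simp only [Function.iterate_succ_apply']; exact dzbar₁_congr ih
  have h2 : dz₁^[a] (dzbar₁^[b] f) =ᶠ[𝓝 z] dz₁^[a] (dzbar₁^[b] g) := by
    induction a with
    | zero => exact h1
    | succ a ih => simp only [Function.iterate_succ_apply']; exact dz₁_congr ih
  exact h2.self_of_nhds

theorem iterate_zero (a b : ℕ) (z : Cn (n + 1)) :
    (dz₁^[a] (dzbar₁^[b] (fun _ => 0))) z = 0 := by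
  have h0 : dz₁ (fun _ : Cn (n + 1) => (0 : ℂ)) = fun _ => 0 := by
    funext z; simp [dz₁, del]
  have h0' : dzbar₁ (fun _ : Cn (n + 1) => (0 : ℂ)) = fun _ => 0 := by
    funext z; simp [dzbar₁, delbar]
  rw [Function.iterate_fixed h0', Function.iterate_fixed h0]

variable {X : Type*} [TopologicalSpace X] [CompactSpace X]
  [ChartedSpace (Cn (n + 1)) X] [IsManifold 𝓘(ℂ, Cn (n + 1)) ω X]
  {D : Type*} [TopologicalSpace D] [ChartedSpace (Cn n) D] [IsManifold 𝓘(ℂ, Cn n) ω D]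
  {ι : D → X} {η : Form (n + 1) X (2 * (n + 1))}

/-- The smooth extension of the coefficient `1/(a! b!) ∂^{a+b}(ρⱼ ψⱼ)/∂z₁^a ∂z̄₁^b` to `ℂ^d`. -/
def ResidueData.extCoeff (R : ResidueData ι η) (j : Fin R.N) (z : Cn (n + 1)) : ℂ :=
  (1 / ((R.a j).factorial * (R.b j).factorial : ℂ)) *
    (dz₁^[R.a j] (dzbar₁^[R.b j] (R.ext j))) z

theorem ResidueData.coeff_eq (R : ResidueData ι η) (j : Fin R.N) {z : Cn (n + 1)}
    (hz : z ∈ (R.chart j).target) : R.coeff j z = R.extCoeff j z := by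
  rw [ResidueData.coeff, ResidueData.extCoeff]
  congr 1
  refine iterate_congr ?_ _ _
  filter_upwards [(R.chart j).open_target.mem_nhds hz] with y hy
  rw [ResidueData.ext, indicator_of_mem hy]

theorem ResidueData.extCoeff_eq_zero [T2Space X] (R : ResidueData ι η) (j : Fin R.N)
    {z : Cn (n + 1)} (hz : z ∉ (R.chart j) '' tsupport (R.ρ j)) : R.extCoeff j z = 0 := by
  rw [ResidueData.extCoeff, iterate_congr (g := fun _ => 0), iterate_zero, mul_zero]
  exact notMem_tsupport_iff_eventuallyEq.1 fun h => hz ((R.ext_prop j).2.2 h)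

theorem ResidueData.extCoeff_prop [T2Space X] (R : ResidueData ι η) (j : Fin R.N) :
    ContDiff ℝ ∞ (R.extCoeff j) ∧ HasCompactSupport (R.extCoeff j) := by
  obtain ⟨h1, h2, -⟩ := R.ext_prop j
  obtain ⟨h3, h4⟩ := iterate_dzbar₁_prop h1 h2 (R.b j)
  obtain ⟨h5, h6⟩ := iterate_dz₁_prop h3 h4 (R.a j)
  exact ⟨contDiff_const.mul h5, h6.mul_left⟩

open Classical in
/-- The contribution of the `j`-th chart to the residue form. -/
def ResidueData.term (R : ResidueData ι η) (j : Fin R.N) : Form n D (2 * n) := fun q =>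
  if ι q ∈ (R.chart j).source then
    R.coeff j (R.chart j (ι q)) • (stdTop n).compLinearMap
      (fderiv ℝ (fun y => Fin.tail (R.chart j (ι ((chartAt (Cn n) q).symm y))) : Cn n → Cn n)
        (chartAt (Cn n) q q) : Cn n →ₗ[ℝ] Cn n)
    else 0

theorem ResidueData.form_eq_sum (R : ResidueData ι η) : R.form = ∑ j, R.term j := by
  funext q
  rw [Finset.sum_apply]
  rfl

theorem ResidueData.term_prop [T2Space X] [T2Space D] [CompactSpace D] [Nonempty D]
    (hD : IsSmoothHypersurface n ι) (R : ResidueData ι η) (j : Fin R.N) :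
    R.term j ∈ smoothForm n D (2 * n) ∧
      formIntegral (R.term j) =
        stdTop n (frame n) * sliceResidue (R.a j) (R.b j) (R.ext j) := by
  obtain ⟨E, hE, hsrc, htar, hEap, hEsymm⟩ := (R.slice j).exists_inducedChart hD
  obtain ⟨hG, hGc⟩ := R.extCoeff_prop j
  have hcoef : ∀ z ∈ E.target, topCoeff (R.term j) E z =
      R.extCoeff j (Fin.cons 0 z) * stdTop n (frame n) := by
    intro z hz
    set q := E.symm z with hq
    have hqs : q ∈ E.source := E.map_target hz
    have hqs' : ι q ∈ (R.chart j).source := by rw [hsrc] at hqs; exact hqs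
    have hιq : R.chart j (ι q) = Fin.cons 0 z := by
      rw [hq, hEsymm z hz, (R.chart j).right_inv ((htar z).1 hz)]
    have hid : (fderiv ℝ (fun y => E ((chartAt (Cn n) q).symm y)) (chartAt (Cn n) q q)).comp
        (fderiv ℝ (fun y => chartAt (Cn n) q (E.symm y)) z) = ContinuousLinearMap.id ℝ _ := by
      have h1 := fderiv_coordChange_comp hE (holAtlas_chartAt q) hE hz (mem_chart_source _ q) hqs
      rw [← hq] at h1
      rw [← h1]
      have h2 : (fun y => E (E.symm y)) =ᶠ[𝓝 z] id := by
        filter_upwards [E.open_target.mem_nhds hz] with y hy using E.right_inv hy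
      rw [h2.fderiv_eq, fderiv_id]
    have hEfun : (fun y => Fin.tail (R.chart j (ι ((chartAt (Cn n) q).symm y)))) =
        fun y => E ((chartAt (Cn n) q).symm y) := by
      funext y; rw [hEap]
    rw [topCoeff, rep, ← hq, ResidueData.term, if_pos hqs', hEfun, hιq,
      R.coeff_eq j ((htar z).1 hz)]
    have hlin : ((stdTop n).compLinearMap
        (fderiv ℝ (fun y => E ((chartAt (Cn n) q).symm y)) (chartAt (Cn n) q q) :
          Cn n →ₗ[ℝ] Cn n)).compLinearMap
        (fderiv ℝ (fun y => chartAt (Cn n) q (E.symm y)) z : Cn n →ₗ[ℝ] Cn n) = stdTop n := by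
      ext v
      simp only [AlternatingMap.compLinearMap_apply]
      congr 1
      funext i
      exact DFunLike.congr_fun hid (v i)
    have h3 := congrArg (fun a : Alt n (2 * n) => a (frame n)) hlin
    simp only [AlternatingMap.compLinearMap_apply] at h3
    simp only [AlternatingMap.compLinearMap_apply, AlternatingMap.smul_apply, smul_eq_mul]
    rw [h3]
  have hzero : ∀ q, ι q ∉ tsupport (R.ρ j) → R.term j q = 0 := by
    intro q hq
    rw [ResidueData.term]
    split_ifs with h
    · rw [R.coeff_eq j ((R.chart j).map_source h), R.extCoeff_eq_zero j, zero_smul]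
      rintro ⟨x, hx, hxq⟩
      exact hq ((R.chart j).injOn (R.subordinate j hx) h hxq ▸ hx)
    · rfl
  have hzero' : ∀ q ∉ E.source, R.term j q = 0 := fun q hq => by
    rw [ResidueData.term, if_neg]
    rw [hsrc] at hq; exact hq
  have hGcons : ContDiff ℝ ∞ fun z : Cn n => R.extCoeff j (Fin.cons 0 z) :=
    hG.comp contDiff_cons_zero
  have hint := integrable_comp_cons hG.continuous hGc
  constructor
  · intro e he
    refine smoothOn_top_iff.2 fun z hz => ContDiffAt.contDiffWithinAt ?_
    by_cases hzE : e.symm z ∈ E.source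
    · have hm := (isOpen_overlap e E).mem_nhds ⟨hz, hzE⟩
      have h1 : ContDiffAt ℝ ∞ (fun y => (jac e E y : ℂ) *
          (R.extCoeff j (Fin.cons 0 (E (e.symm y))) * stdTop n (frame n))) z :=
        (Complex.ofRealCLM.contDiff.contDiffAt.comp z ((contDiffOn_jac he hE).contDiffAt hm)).mul
          ((ContDiffAt.comp z hGcons.contDiffAt
            ((contDiffOn_coordChange_real he hE).contDiffAt hm)).mul contDiffAt_const)
      refine h1.congr_of_eventuallyEq ?_
      filter_upwards [hm] with y hy
      rw [← hcoef _ (E.map_source hy.2), ← topCoeff_coordChange _ he hE hy.1 hy.2]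
      rfl
    · have hns : ι (e.symm z) ∉ tsupport (R.ρ j) := fun h => hzE (by
        rw [hsrc]; exact R.subordinate j h)
      refine (contDiffAt_const (c := (0 : ℂ))).congr_of_eventuallyEq ?_
      have hc : ContinuousAt (fun y => ι (e.symm y)) z :=
        hD.1.continuous.continuousAt.comp (e.continuousAt_symm hz)
      filter_upwards [hc.eventually_mem ((isClosed_tsupport (R.ρ j)).isOpen_compl.mem_nhds hns)]
        with y hy
      rw [rep, hzero _ hy]
      rfl
  · have hi : IntegrableOn (topCoeff (R.term j) E) E.target := by
      refine IntegrableOn.congr_fun ((hint.mul_const (stdTop n (frame n))).integrableOn)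
        (fun z hz => (hcoef z hz).symm) E.open_target.measurableSet
    rw [(formIntegral_eq_setIntegral hE hzero' hi).2,
      setIntegral_congr_fun E.open_target.measurableSet hcoef, integral_mul_const, mul_comm]
    congr 1
    rw [setIntegral_eq_integral_of_forall_compl_eq_zero]
    · simp only [ResidueData.extCoeff, sliceResidue, integral_const_mul]
    · intro z hz
      refine R.extCoeff_eq_zero j fun h => hz ((htar z).2 ?_)
      exact (isCompact_image_tsupport (R.subordinate j)).2.1 h

theorem formIntegral_finsetSum {d : ℕ} {M : Type*} [TopologicalSpace M] [ChartedSpace (Cn d) M]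
    [IsManifold 𝓘(ℂ, Cn d) ω M] [T2Space M] [CompactSpace M] {α : Type*} (s : Finset α)
    {a : α → Form d M (2 * d)} (ha : ∀ i, a i ∈ smoothForm d M (2 * d)) :
    formIntegral (∑ i ∈ s, a i) = ∑ i ∈ s, formIntegral (a i) := by
  classical
  induction s using Finset.induction_on with
  | empty =>
    have := formIntegral_smul 0 (zero_mem (smoothForm d M (2 * d)))
    simpa using this
  | insert i s hi ih =>
    rw [Finset.sum_insert hi, Finset.sum_insert hi,
      formIntegral_add (ha i) (Submodule.sum_mem _ fun i _ => ha i), ih]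

theorem ResidueData.form_prop [T2Space X] [T2Space D] [CompactSpace D] [Nonempty D]
    (hD : IsSmoothHypersurface n ι) (R : ResidueData ι η) :
    R.form ∈ smoothForm n D (2 * n) ∧
      formIntegral R.form =
        ∑ j, stdTop n (frame n) * sliceResidue (R.a j) (R.b j) (R.ext j) := by
  rw [R.form_eq_sum]
  refine ⟨Submodule.sum_mem _ fun j _ => (R.term_prop hD j).1, ?_⟩
  rw [formIntegral_finsetSum _ fun j => (R.term_prop hD j).1]
  exact Finset.sum_congr rfl fun j _ => (R.term_prop hD j).2

end ResidueForm

end CxForm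
end

open CxForm

theorem theorem3p9 {n : ℕ}
    {X : Type*} [TopologicalSpace X] [T2Space X] [CompactSpace X]
    [ChartedSpace (Cn (n + 1)) X] [IsManifold 𝓘(ℂ, Cn (n + 1)) ω X]
    {D : Type*} [TopologicalSpace D]
    [ChartedSpace (Cn n) D] [IsManifold 𝓘(ℂ, Cn n) ω D]
    (ι : D → X) (hD : IsSmoothHypersurface n ι)
    {L : X → Type*} [TopologicalSpace (Bundle.TotalSpace ℂ L)]
    [∀ x, AddCommGroup (L x)] [∀ x, Module ℂ (L x)] [∀ x, TopologicalSpace (L x)]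
    [FiberBundle ℂ L] [VectorBundle ℂ ℂ L] [ContMDiffVectorBundle ω ℂ L 𝓘(ℂ, Cn (n + 1))]
    (s : ∀ x, L x) (hs : IsHolSection n s) (hsD : ∀ x, s x = 0 ↔ x ∈ range ι)
    (h : ∀ x, L x → ℝ) (hh : IsMetric n h)
    {k l : ℕ} (hkl : k + l = 2 * (n + 1))
    (w : Form (n + 1) X k) (hw : IsQuasiMeromorphic ι w) (hκ : 0 < kappa ι w)
    (hord : ∀ p q : D, HasBothPoles ι w p → HasBothPoles ι w q →
      vanishingOrder n ι s p = vanishingOrder n ι s q)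
    (ξ : smoothForm (n + 1) X l) :
    Nonempty (ResidueData ι (wedgeForm hkl w ξ.1)) ∧
    ∀ R : ResidueData ι (wedgeForm hkl w ξ.1), ∃ hR : R.form ∈ smoothForm n D (2 * n), ∃ I : ℂ,
      IsClassIntegral (aeppliClass ⟨R.form, hR⟩) I ∧
      CanonicalCurrentEq ι h s hkl w ξ.1 (-2 * Real.pi * Complex.I * I) := by
  obtain ⟨-, p, hp⟩ := kappa_eq_one hκ
  have : Nonempty D := ⟨p⟩
  have : T2Space D := hD.1.isEmbedding.t2Space
  have : CompactSpace D := hD.1.compactSpace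
  refine ⟨nonempty_residueData hkl hw hD.1.isClosed_range ξ, fun R => ?_⟩
  obtain ⟨hR, hI⟩ := R.form_prop hD
  refine ⟨hR, _, isClassIntegral_formIntegral _, ?_⟩
  rw [hI]
  exact canonicalCurrentEq_residueData hD hs hsD hh hkl hκ hord ξ R
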